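/- **Setting.** Work over $\mathbb F=\mathbb Z/2$. Let $G$ be a toroidal grid diagram of size $n$ with free markings: every row and every column contains exactly one $O$ and at most one $X$; the row of an $O$ contains no $X$ if and only if its column contains none (that $O$ is then called *free*, all other markings *linked*), and there is at least one free $O$. Joining the linked markings in each row (from $O$ to $X$) and in each column (from $X$ to $O$) gives the oriented link $L=L_1\cup\dots\cup L_\ell$ that $G$ represents. $G$ is *sparse* if no two cyclically adjacent rows both contain linked markings and no two cyclically adjacent columns both contain linked markings. Let $\mathcal R=\mathbb F[[U_v]]$, with one variable for each $L_i$ and one for each free marking. **Positive pairs.** A set of linked markings is *consistent* if it does not contain both $O$'s and $X$'s of the same component. Let $\mathcal Z_0,\mathcal Z$ be disjoint with $\mathcal Z_0\cup\mathcal Z$ consistent, and choose for each $i$ a sign $s_i\in\{\pm\infty\}$, with $s_i=+\infty$ (resp. $-\infty$) whenever $\mathcal Z_0\cup\mathcal Z$ contains an $O$ (resp. an $X$) of $L_i$. Keep the free markings, the $O$'s of the components with $s_i=+\infty$ and the $X$'s of those with $s_i=-\infty$ (all now called $O$), and delete the rows and columns through $\mathcal Z_0$. This gives a grid $H$ with one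 $O$ in each row and column, each with the variable of its component or free marking. For $j\in\mathcal Z$ let $p_j$ be the lower left corner of the square of $j$. * $C^-$ is the free $\mathcal R$-module on the matchings $\mathbf x$ of the vertical with the horizontal circles of $H$; $\partial$ counts empty rectangles, weighted by the product of the variables of the $O$'s in them. * $EC^-$ is the free $\mathcal R$-module on the pairs $(\mathbf y,\epsilon)$, where $\mathbf y$ is a matching containing all $p_j$ and $\epsilon\in\{0,1\}^{\mathcal Z}$; it is the tensor product over $j\in\mathcal Z$ of the mapping cones, from $\epsilon_j=0$ to $\epsilon_j=1$, of $U_j-U_{j'}$ on the complex of the grid obtained from $H$ by deleting the rows and columns through $\mathcal Z$. Here $U_j$ is the variable of $j$, and $U_{j'}$ is that of the $O$ of $H$ in the row directly below $j$. * A *domain* from $\mathbf x$ to $\mathbf y$ is an integral combination $D$ of squares of $H$ such that the part of $\partial D$ on the horizontal circles has boundary $\mathbf y-\mathbf x$. Given integers $\rho_j$ ($j\in\mathcal Z$), let $a_j,b_j,c_j,d_j$ be the multiplicities of $D$ in the upper left, upper right, lower left and lower right square at $p_j$, and $f_j=b_j-\rho_j$. The triple $(D,\epsilon,\rho)$ is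 *positive* if $D\ge 0$ and, for all $j\in\mathcal Z$, $a_j\ge f_j$, $b_j\ge f_j$, $c_j\ge f_j+\epsilon_j-1$, $d_j\ge f_j+\epsilon_j$. It goes from $\mathbf x$ to $U^N(\mathbf y,\epsilon)$, where $N_v$ is the sum of the multiplicities of $D$ at the $O$'s not in $\mathcal Z$ with variable $U_v$ and of the $\rho_j$ for $j\in\mathcal Z$ with variable $U_v$. The pair $[\mathbf x,U^N(\mathbf y,\epsilon)]$ is *positive* if there is such a positive triple; its index is $M(\mathbf x)-M(\mathbf y)-\sum_j\epsilon_j+2\sum_v N_v$, where $M$ is the Maslov grading of $H$. **The complex.** View $[\mathbf x,U^N(\mathbf y,\epsilon)]$ as the homomorphism sending $\mathbf x$ to $U^N(\mathbf y,\epsilon)$ and all other matchings to $0$. Let $CP^d(G;\mathcal Z_0,\mathcal Z)$ be the $\mathbb F$-span, in the complex $\mathrm{Hom}_{\mathcal R}(C^-,EC^-)$ with differential $\varphi\mapsto\varphi\circ\partial+\partial\circ\varphi$, of the positive pairs of index $d$. Up to isomorphism this complex does not depend on $s$. For $k\ge0$ let $$CE^*(G;k)=\bigoplus_{|\mathcal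 Z|=k}CP^*(G;\mathcal Z_0,\mathcal Z),$$ the sum being over all disjoint $\mathcal Z_0,\mathcal Z$ with $\mathcal Z_0\cup\mathcal Z$ consistent and $|\mathcal Z|=k$, and let $HE^*(G;k)$ be its cohomology. **Theorem.** Let $G$ be a sparse toroidal grid diagram, with at least one free marking, representing a link $L$. Then, for all $k\ge 0$ (and any choice of the signs $s$ in each summand), $$HE^d(G;k)=0\qquad\text{whenever } d<\min\{0,2-k\}.$$ -/

import Mathlib

noncomputable section

/-! ### Grids with one marking per row and column, some of them marked for destabilization

A grid of size `m` is cut along vertical circles `β_c` and horizontal circles `α_r`, indexed by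
`Fin m` in cyclic order.  Column `c` is the annulus between `β_c` and the next vertical circle, and
row `r` is the annulus between `α_r` and the next horizontal circle, so that `β_c` is the left edge
of column `c` and `α_r` is the bottom edge of row `r`.  The square `(c, r)` has the point
`β_c ∩ α_r` as its lower left corner. -/

/-- A toroidal grid of size `m` carrying one `O` in each row and each column: the `O` of column `c`
lies in row `O c` and carries the variable `U_{var c}`; the `O`'s in the columns of `Z` are marked
for destabilization. -/
structure MarkedGrid (V : Type) (m : ℕ) where
  O : Equiv.Perm (Fin m)
  var : Fin m → V
  Z : Finset (Fin m)

/-- The columns (or rows) met when going in the positive direction from the circle `a` to the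
circle `b`; it is empty when `a = b`. -/
def cyclicIco {m : ℕ} (a b : Fin m) : Finset (Fin m) :=
  if a ≤ b then Finset.Ico a b else Finset.Ici a ∪ Finset.Iio b

/-- The circles strictly between the circles `a` and `b`, going in the positive direction. -/
def cyclicIoo {m : ℕ} (a b : Fin m) : Finset (Fin m) :=
  (cyclicIco a b).erase a

namespace MarkedGrid

variable {V : Type} {m : ℕ}

/-- The base ring `𝔽[[U_v : v ∈ V]]`, `𝔽 = ℤ/2`. -/
abbrev Coeff (V : Type) : Type := MvPowerSeries V (ZMod 2)

/-- A matching between vertical and horizontal circles; `x` consists of the points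
`β_c ∩ α_{x c}`. -/
abbrev Gen (m : ℕ) : Type := Equiv.Perm (Fin m)

/-- Empty rectangles starting at `x`.  For `a ≠ b`, the pair `(a, b)` stands for the rectangle with
lower left corner `β_a ∩ α_{x a}` and upper right corner `β_b ∩ α_{x b}`; it goes from `x` to
`x * swap a b`.  It is empty when no point of `x` is in its interior. -/
def emptyRects (x : Gen m) : Finset (Fin m × Fin m) :=
  {p | p.1 ≠ p.2 ∧ ∀ c ∈ cyclicIoo p.1 p.2, x c ∉ cyclicIoo (x p.1) (x p.2)}

/-- The columns whose `O` lies inside the rectangle `p` starting at `x`. -/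
def rectO (H : MarkedGrid V m) (x : Gen m) (p : Fin m × Fin m) : Finset (Fin m) :=
  {c | c ∈ cyclicIco p.1 p.2 ∧ H.O c ∈ cyclicIco (x p.1) (x p.2)}

/-- The differential of `C⁻(G)`, the free module over the base ring on the matchings, as a matrix:
the entry at `(x', x)` is the coefficient of `x'` in `∂x`.  It counts empty rectangles from `x` to
`x'`, with one power of `U` for each `O` in the rectangle. -/
def boundary (H : MarkedGrid V m) : Matrix (Gen m) (Gen m) (Coeff V) :=
  Matrix.of fun x' x =>
    ∑ p ∈ emptyRects x with x * Equiv.swap p.1 p.2 = x',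
      ∏ c ∈ H.rectO x p, (MvPowerSeries.X (H.var c) : Coeff V)

/-- Enhanced generators `(y, ε)`: the matching `y` contains the destabilization points (the lower
left corners of the squares of the `O`'s marked for destabilization), and `ε` assigns `0` (left)
or `1` (right) to each destabilization point.  Matchings of the destabilized grid are identified
with such `y` by adjoining the destabilization points. -/
abbrev EGen (H : MarkedGrid V m) : Type :=
  {y : Gen m // ∀ c ∈ H.Z, y c = H.O c} × (H.Z → Fin 2)

/-- Empty rectangles of the destabilized grid: the corners avoid the destabilization points, and
no point of `y` other than the destabilization points is in the interior. -/
def destabRects (H : MarkedGrid V m) (y : Gen m) : Finset (Fin m × Fin m) :=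
  {p | p.1 ≠ p.2 ∧ p.1 ∉ H.Z ∧ p.2 ∉ H.Z ∧
    ∀ c ∈ cyclicIoo p.1 p.2, c ∉ H.Z → y c ∉ cyclicIoo (y p.1) (y p.2)}

/-- The column of the `O` that lies in the row directly below the `O` of column `c`. -/
def below (H : MarkedGrid V m) (c : Fin m) : Fin m :=
  H.O.symm ((finRotate m).symm (H.O c))

/-- The differential of the enhanced destabilized complex `EC⁻(G, Z)`, the free module on the
enhanced generators, as a matrix: the entry at `(y', y)` is the coefficient of `y'` in `∂y`.
The complex is the tensor product over `j ∈ Z` of the mapping cones of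
`U_j - U_{j'} : C⁻(G^Z) → C⁻(G^Z)`, from `ε_j = 0` to `ε_j = 1`, where `j'` is the `O` in the row
directly below. Rectangles of the destabilized grid do not see the `O`'s in `Z`. -/
def eBoundary (H : MarkedGrid V m) : Matrix H.EGen H.EGen (Coeff V) :=
  Matrix.of fun y' y =>
    (∑ p ∈ H.destabRects y.1.1 with y.1.1 * Equiv.swap p.1 p.2 = y'.1.1 ∧ y'.2 = y.2,
      ∏ c ∈ H.rectO y.1.1 p \ H.Z, (MvPowerSeries.X (H.var c) : Coeff V)) +
    ∑ j : H.Z, if y'.1 = y.1 ∧ y.2 j = 0 ∧ y'.2 = Function.update y.2 j 1 then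
      (MvPowerSeries.X (H.var j) : Coeff V) - MvPowerSeries.X (H.var (H.below j)) else 0

/-- The `Hom` complex `Hom_R (C⁻(G), EC⁻(G, Z))`.  Both modules are free of finite rank, and a
homomorphism `φ` is given by its matrix, whose entry at `(y, x)` is the coefficient of `y` in
`φ(x)`. -/
abbrev HomCx (H : MarkedGrid V m) : Type := Matrix H.EGen (Gen m) (Coeff V)

/-- The differential `φ ↦ φ ∘ ∂ + ∂ ∘ φ` of the `Hom` complex, which on pairs reads
`d[x, y] = [∂*x, y] + [x, ∂y]` (signs do not matter over `𝔽 = ℤ/2`). -/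
def homD (H : MarkedGrid V m) : H.HomCx →ₗ[ZMod 2] H.HomCx where
  toFun φ := φ * H.boundary + H.eBoundary * φ
  map_add' φ ψ := by rw [Matrix.add_mul, Matrix.mul_add]; abel
  map_smul' a φ := by
    rw [RingHom.id_apply, Matrix.smul_mul, Matrix.mul_smul, smul_add]

/-- The pair `[x, U^N (y, ε)]`: the homomorphism that sends `x` to `U^N (y, ε)` and all other
matchings to `0`. -/
def pair (H : MarkedGrid V m) (x : Gen m) (N : V →₀ ℕ) (y : H.EGen) : H.HomCx :=
  Matrix.single y x (MvPowerSeries.monomial N (1 : ZMod 2))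

/-- The Maslov grading `M(x) = J(x, x) - 2 J(x, 𝕆) + J(𝕆, 𝕆) + 1`, where `J` is the symmetrization
of the count of pairs of points such that the second is above and to the right of the first;
the points of `x` are put at the lattice points of `[0, m) × [0, m)` and the `O`'s at the centres
of the unit squares. -/
def maslov (H : MarkedGrid V m) (x : Gen m) : ℤ :=
  (Finset.univ.filter fun p : Fin m × Fin m => p.1 < p.2 ∧ x p.1 < x p.2).card
    - (Finset.univ.filter fun p : Fin m × Fin m => p.1 ≤ p.2 ∧ x p.1 ≤ H.O p.2).card
    - (Finset.univ.filter fun p : Fin m × Fin m => p.1 < p.2 ∧ H.O p.1 < x p.2).card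
    + (Finset.univ.filter fun p : Fin m × Fin m => p.1 < p.2 ∧ H.O p.1 < H.O p.2).card + 1

/-- The index `I([x, U^N (y, ε)]) = M(x) - M(U^N (y, ε))`, where `M(y, ε) = M(y) + ∑ ε_j` and each
`U` lowers the grading by two. -/
def index (H : MarkedGrid V m) (x : Gen m) (N : V →₀ ℕ) (y : H.EGen) : ℤ :=
  H.maslov x - H.maslov y.1.1 - ∑ j : H.Z, ((y.2 j : ℕ) : ℤ) + 2 * (N.degree : ℤ)

/-- The two-chain `∑ D(c, r) · (square (c, r))` is a domain from `x` to `y`: the part of its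
boundary on the `α` circles is a one-chain with boundary `y - x`. -/
def IsDomain (x y : Gen m) (D : Fin m → Fin m → ℤ) : Prop :=
  ∀ c r : Fin m,
    D ((finRotate m).symm c) r + D c ((finRotate m).symm r)
        - D c r - D ((finRotate m).symm c) ((finRotate m).symm r) =
      (if y c = r then 1 else 0) - (if x c = r then 1 else 0)

/-- The enhanced domain `(D, ε, ρ)` is positive: `D` has nonnegative multiplicities, and around
each destabilization point the multiplicities `a, b, c, d` of the upper left, upper right, lower
left and lower right square satisfy `a ≥ f`, `b ≥ f`, `c ≥ f + ε - 1`, `d ≥ f + ε`, where `f`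
is the fake multiplicity, that is, the total multiplicity `b` minus the real multiplicity `ρ`. -/
def IsPositiveEnhanced (H : MarkedGrid V m) (D : Fin m → Fin m → ℤ) (ε : H.Z → Fin 2)
    (ρ : H.Z → ℤ) : Prop :=
  (∀ c r, 0 ≤ D c r) ∧
  ∀ j : H.Z,
    let f : ℤ := D j (H.O j) - ρ j
    let e : ℤ := ((ε j : ℕ) : ℤ)
    f ≤ D ((finRotate m).symm j) (H.O j) ∧
    f ≤ D j (H.O j) ∧
    f + e - 1 ≤ D ((finRotate m).symm j) ((finRotate m).symm (H.O j)) ∧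
    f + e ≤ D j ((finRotate m).symm (H.O j))

open Classical in
/-- The pair `[x, U^N (y, ε)]` is positive: there is a positive enhanced domain `(D, ε, ρ)` from
`x` to `U^N (y, ε)`.  The exponent of `U_v` is the sum of the multiplicities of `D` at the `O`'s
with variable `U_v` that are not marked for destabilization and of the real multiplicities at
those that are. -/
def IsPositivePair (H : MarkedGrid V m) (x : Gen m) (N : V →₀ ℕ) (y : H.EGen) : Prop :=
  ∃ (D : Fin m → Fin m → ℤ) (ρ : H.Z → ℤ),
    IsDomain x y.1.1 D ∧ H.IsPositiveEnhanced D y.2 ρ ∧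
    ∀ v : V, (N v : ℤ) =
      (∑ c : Fin m, if c ∉ H.Z ∧ H.var c = v then D c (H.O c) else 0) +
      ∑ j : H.Z, if H.var j = v then ρ j else 0

/-- The degree `d` part of the complex of positive pairs, as a subspace of the `Hom` complex.
(For each `d` there are only finitely many positive pairs of index `d`.) -/
def CP (H : MarkedGrid V m) (d : ℤ) : Submodule (ZMod 2) H.HomCx :=
  Submodule.span (ZMod 2)
    {φ | ∃ x N y, H.IsPositivePair x N y ∧ H.index x N y = d ∧ φ = H.pair x N y}

end MarkedGrid

/-! ### Grid diagrams of links, with free markings -/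

/-- The two types of markings. -/
inductive MarkKind where
  | O : MarkKind
  | X : MarkKind
  deriving DecidableEq

/-- A toroidal grid diagram of size `n` with at least one free marking: each row and each column
contains exactly one `O` (column `c` has its `O` in row `O c`), and at most one `X` (column `c` has
its `X` in row `r` if `X c = some r`, and has no `X` if `X c = none`); the column of an `O` has no
`X` if and only if its row has none, and then that `O` is called free.  The markings that are not
free are called linked.  Every such diagram represents an oriented link, obtained by joining the
linked markings in each row, from `O` to `X`, and in each column, from `X` to `O`. -/
structure GridDiagram (n : ℕ) where
  O : Equiv.Perm (Fin n)
  X : Fin n → Option (Fin n)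
  X_row : ∀ c c' r, X c = some r → X c' = some r → c = c'
  free_iff : ∀ c, X c = none ↔ ∀ c', X c' ≠ some (O c)
  exists_free : ∃ c, X c = none

namespace GridDiagram

variable {n : ℕ} (G : GridDiagram n)

/-- `G` is sparse: no two (cyclically) adjacent rows both contain linked markings, and no two
adjacent columns both contain linked markings. -/
def IsSparse : Prop :=
  (∀ r, (∃ c, G.X c = some r) → ¬ ∃ c, G.X c = some (finRotate n r)) ∧
  (∀ c, G.X c ≠ none → ¬ G.X (finRotate n c) ≠ none)

/-- The columns that contain linked markings; each contains one `O` and one `X`. -/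
abbrev LinkedCol : Type := {c : Fin n // (G.X c).isSome}

/-- The row of the `X` in a linked column. -/
def xRow (c : G.LinkedCol) : Fin n := (G.X c.1).get c.2

/-- The link components: linked columns are identified when the `X` of one and the `O` of the
other lie in the same row. -/
def Component : Type := Quot fun c c' : G.LinkedCol => G.xRow c = G.O c'.1

/-- The link component that runs through a linked column. -/
def comp (c : G.LinkedCol) : G.Component := Quot.mk _ c

/-- The variables of the base ring: `U_i` for each component of the link, and one more for each
free marking. -/
abbrev Var : Type := G.Component ⊕ {c : Fin n // ¬ (G.X c).isSome}

/-- The variable that belongs to the markings of column `c`. -/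
def var (c : Fin n) : G.Var :=
  if h : (G.X c).isSome then Sum.inl (G.comp ⟨c, h⟩) else Sum.inr ⟨c, h⟩

/-- A linked marking, given by its column and its type. -/
abbrev LinkedMarking : Type := G.LinkedCol × MarkKind

/-- A set of linked markings is consistent if it does not contain both `O`'s and `X`'s of any one
link component. -/
def Consistent (W : Finset G.LinkedMarking) : Prop :=
  ∀ Z ∈ W, ∀ Z' ∈ W, G.comp Z.1 = G.comp Z'.1 → Z.2 = Z'.2

/-- The set `J_∞(W)`.  An element `s` has one coordinate `s_i ∈ {+∞, -∞}` for each link component;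
`s_i = +∞` is encoded as `MarkKind.O` and `s_i = -∞` as `MarkKind.X`, the type of the markings of
the component that enter the exponent of `U_i` in the differential.  An `O` in `W` on the
component `i` forces `s_i = +∞`, and an `X` forces `s_i = -∞`. -/
def JInf (W : Finset G.LinkedMarking) : Type :=
  {s : G.Component → MarkKind // ∀ Z ∈ W, s (G.comp Z.1) = Z.2}

/-- The row of the marking in column `c` that enters the powers of `U` prescribed by `s`: the `X`
if `c` lies on a component with `s_i = -∞`, and the `O` otherwise. -/
def activeRow (s : G.Component → MarkKind) (c : Fin n) : Fin n :=
  if h : (G.X c).isSome then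
    match s (G.comp ⟨c, h⟩) with
    | MarkKind.X => G.xRow ⟨c, h⟩
    | MarkKind.O => G.O c
  else G.O c

theorem X_eq_some_xRow (c : G.LinkedCol) : G.X c.1 = some (G.xRow c) := by
  simp [xRow]

theorem activeRow_injective (s : G.Component → MarkKind) :
    Function.Injective (G.activeRow s) := by
  have key : ∀ (c c' : Fin n) (h : (G.X c).isSome), G.xRow ⟨c, h⟩ = G.O c' →
      ∃ h' : (G.X c').isSome, G.comp ⟨c, h⟩ = G.comp ⟨c', h'⟩ := by
    intro c c' h e
    have h' : (G.X c').isSome := by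
      rw [Option.isSome_iff_ne_none]
      intro hn
      refine (G.free_iff c').1 hn c ?_
      rw [← e]
      exact G.X_eq_some_xRow ⟨c, h⟩
    exact ⟨h', Quot.sound e⟩
  have dich : ∀ c, G.activeRow s c = G.O c ∧
        (∀ h : (G.X c).isSome, s (G.comp ⟨c, h⟩) = MarkKind.O) ∨
      ∃ h : (G.X c).isSome, s (G.comp ⟨c, h⟩) = MarkKind.X ∧
        G.activeRow s c = G.xRow ⟨c, h⟩ := by
    intro c
    by_cases h : (G.X c).isSome
    · cases hs : s (G.comp ⟨c, h⟩) with
      | O => exact Or.inl ⟨by simp [activeRow, h, hs], fun _ => hs⟩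
      | X => exact Or.inr ⟨h, hs, by simp [activeRow, h, hs]⟩
    · exact Or.inl ⟨by simp [activeRow, h], fun h' => absurd h' h⟩
  intro c c' e
  rcases dich c with ⟨h1, h2⟩ | ⟨h, h1, h2⟩ <;> rcases dich c' with ⟨h1', h2'⟩ | ⟨h', h1', h2'⟩
  · rw [h1, h1'] at e
    exact G.O.injective e
  · rw [h1, h2'] at e
    obtain ⟨hc, hcomp⟩ := key c' c h' e.symm
    rw [hcomp, h2 hc] at h1'
    exact absurd h1' (by decide)
  · rw [h2, h1'] at e
    obtain ⟨hc, hcomp⟩ := key c c' h e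
    rw [hcomp, h2' hc] at h1
    exact absurd h1 (by decide)
  · rw [h2, h2'] at e
    refine G.X_row c c' (G.xRow ⟨c, h⟩) (G.X_eq_some_xRow ⟨c, h⟩) ?_
    rw [e]
    exact G.X_eq_some_xRow ⟨c', h'⟩

/-- The markings that enter the powers of `U`; there is one in each row and each column. -/
def active (s : G.Component → MarkKind) : Equiv.Perm (Fin n) :=
  Equiv.ofBijective (G.activeRow s) (Finite.injective_iff_bijective.1 (G.activeRow_injective s))

/-- The columns of a set of linked markings. -/
def cols (W : Finset G.LinkedMarking) : Finset (Fin n) := W.image fun Z => Z.1.1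

/-- The columns that remain after destabilizing at `Z₀`.  If `s ∈ J_∞(Z₀)`, the rows that remain
are the rows of the active markings in these columns. -/
def keptCols (Z₀ : Finset G.LinkedMarking) : Finset (Fin n) := (G.cols Z₀)ᶜ

/-- For `s ∈ J_∞(Z₀ ∪ Z)`, the grid `G^{Z₀}` with the markings in `Z` marked for destabilization:
only the markings prescribed by `s` are kept (and all are regarded as `O`'s), the rows and
columns through the markings in `Z₀` are deleted, and the remaining rows and columns are
renumbered in increasing order.  All markings retain the variable they have in `G`. -/
def destab (s : G.Component → MarkKind) (Z₀ Z : Finset G.LinkedMarking) :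
    MarkedGrid G.Var (G.keptCols Z₀).card where
  O := ((G.keptCols Z₀).orderIsoOfFin rfl).toEquiv.trans
    (((G.active s).subtypeEquiv fun _ => (Finset.mem_map' (G.active s).toEmbedding).symm).trans
      (((G.keptCols Z₀).map (G.active s).toEmbedding).orderIsoOfFin
        (Finset.card_map _)).symm.toEquiv)
  var := fun c => G.var ((G.keptCols Z₀).orderIsoOfFin rfl c)
  Z := Finset.univ.filter fun c => ((G.keptCols Z₀).orderIsoOfFin rfl c : Fin n) ∈ G.cols Z

/-- The index set of the summand `CE^*(G; k)` of the extended complex: disjoint sets `Z₀`, `Z` of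
linked markings such that `Z₀ ∪ Z` is consistent and `Z` has `k` elements. -/
structure ExtIndex (k : ℕ) where
  Z₀ : Finset G.LinkedMarking
  Z : Finset G.LinkedMarking
  disjoint : Disjoint Z₀ Z
  consistent : G.Consistent (Z₀ ∪ Z)
  card_eq : Z.card = k

variable (k : ℕ) (s : ∀ i : G.ExtIndex k, G.JInf (i.Z₀ ∪ i.Z))

/-- The marked grid that belongs to a summand. -/
def summandGrid (i : G.ExtIndex k) : MarkedGrid G.Var (G.keptCols i.Z₀).card :=
  G.destab (s i).1 i.Z₀ i.Z

/-- The direct sum of the `Hom` complexes of all summands.  There are finitely many of them, so the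
direct sum is the same as the product. -/
abbrev ExtHom : Type := ∀ i : G.ExtIndex k, (G.summandGrid k s i).HomCx

/-- The differential on the direct sum. -/
def extD : G.ExtHom k s →ₗ[ZMod 2] G.ExtHom k s :=
  LinearMap.pi fun i => (G.summandGrid k s i).homD ∘ₗ LinearMap.proj i

/-- The degree `d` part of `CE^*(G; k) = ⨁ CP^*(G; Z₀, Z, s)`. -/
def CE (d : ℤ) : Submodule (ZMod 2) (G.ExtHom k s) :=
  Submodule.pi Set.univ fun i => (G.summandGrid k s i).CP d

/-- The cocycles in `CE^d(G; k)`. -/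
def cocycles (d : ℤ) : Submodule (ZMod 2) (G.ExtHom k s) :=
  G.CE k s d ⊓ LinearMap.ker (G.extD k s)

/-- The coboundaries of the elements of `CE^{d-1}(G; k)`. -/
def coboundaries (d : ℤ) : Submodule (ZMod 2) (G.ExtHom k s) :=
  (G.CE k s (d - 1)).map (G.extD k s)

/-- The cohomology `HE^d(G; k)` of the extended complex of positive pairs. -/
abbrev HE (d : ℤ) : Type :=
  ↥(G.cocycles k s d) ⧸ (G.coboundaries k s d).submoduleOf (G.cocycles k s d)

end GridDiagram

end

/-! Each summand of the extended complex has no cohomology in negative degrees, and this is proved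
by a discrete Morse matching on positive pairs.

Let `H` be the grid of a summand; it inherits sparsity from `G` (`destab_isSparse`). Exchanging the
points of `x` on the two sides of a marked column `j` is a thin rectangle, and in exactly one of its
two directions this rectangle avoids the `O` of `j`. Call `j` flippable if neither point is at the
height of `p_j`. By sparsity, flipping such a column keeps `[x, U^N (y, ε)]` positive with the same
`N` (`IsPositivePair.flip`), and it changes the index by one. Flipping the first flippable column
therefore matches all pairs that have such a column: the one of smaller index is called low, and its
differential contains its mate with coefficient one.

In an unmatched pair, every `p_j` has a point of `x` at its height on one of the two sides of column
`j`. Such a pair has index at least zero (`IsPositivePair.index_nonneg`). The proof uses the formula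
`M(x) - M(y) = n_x(D) + n_y(D) - 2 O(D)`, where `n` sums the average multiplicities at the points
(`maslov_sub`). Contributions away from the `p_j` are nonnegative, and those at the `p_j` are
bounded by the positivity inequalities.

The matching is acyclic because of a lexicographic monovariant. Its first entry, the index minus
`M(x)`, grows along every arrow except rectangles at the front that contain no `O`. Such a rectangle
either meets a square in an unmarked row and column, which `areaGrading` detects, or is thin in a
marked row or column. Among the thin ones, `rowGrading` detects all but the flips of flippable
columns (`grading_trichotomy`). A flip other than the matched one leaves a low pair low.

The algebraic step is `exists_preimage_of_matching`. It needs the square of the differential to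
vanish (`homD_homD`), which follows from the usual cancellation of pairs of rectangles. -/

namespace MarkedGrid

variable {V : Type} {m : ℕ}

/-! ### Cyclic successors and indicators of cyclic intervals. -/

theorem val_finRotate (c : Fin m) :
    (finRotate m c).val = if c.val + 1 = m then 0 else c.val + 1 := by
  obtain _ | n := m
  · exact c.elim0
  · split_ifs with h
    · have : c = Fin.last n := Fin.ext (by simpa using h)
      rw [this, finRotate_last]; rfl
    · exact coe_finRotate_of_ne_last (fun h' => h (by rw [h']; simp))

theorem val_finRotate_symm (c : Fin m) :
    ((finRotate m).symm c).val = if c.val = 0 then m - 1 else c.val - 1 := by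
  obtain ⟨b, rfl⟩ := (finRotate m).surjective c
  rw [Equiv.symm_apply_apply, val_finRotate]
  have := b.isLt
  split_ifs <;> first | omega | simp_all

/-- This integrates difference equations around the cycle: two functions with the same jumps differ
by a constant. -/
theorem const_of_finRotate {α : Type*} (f : Fin m → α)
    (h : ∀ c, f ((finRotate m).symm c) = f c) (a b : Fin m) : f a = f b := by
  have key : ∀ (i : ℕ) (hi : i < m), f ⟨i, hi⟩ = f ⟨0, by omega⟩ := by
    intro i
    induction i with
    | zero => intro _; rfl
    | succ i ih =>
      intro hi
      rw [← ih (by omega), ← h ⟨i + 1, hi⟩]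
      congr 1
      apply Fin.ext
      rw [val_finRotate_symm]
      simp
  rw [show a = ⟨a.1, a.2⟩ from rfl, show b = ⟨b.1, b.2⟩ from rfl, key a.1 a.2, key b.1 b.2]

theorem mem_cyclicIco {a b c : Fin m} :
    c ∈ cyclicIco a b ↔ (a ≤ b ∧ a ≤ c ∧ c < b) ∨ (b < a ∧ (a ≤ c ∨ c < b)) := by
  unfold cyclicIco
  split_ifs with h
  · simp [h, not_lt.2 h]
  · simp [h, not_le.1 h]

/-- The indicator function of a cyclic interval. -/
def ind (a b c : Fin m) : ℤ := if c ∈ cyclicIco a b then 1 else 0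

theorem ind_nonneg (a b c : Fin m) : 0 ≤ ind a b c := by
  unfold ind; split_ifs <;> simp

theorem ind_pred (a b c : Fin m) :
    ind a b ((finRotate m).symm c) =
      ind a b c + (if c = b then 1 else 0) - (if c = a then 1 else 0) := by
  have h := val_finRotate_symm c
  have ha := a.isLt
  have hb := b.isLt
  have hc := c.isLt
  simp only [ind, mem_cyclicIco, Fin.le_def, Fin.lt_def, Fin.ext_iff]
  generalize ((finRotate m).symm c).val = e at *
  split_ifs at h <;> split_ifs <;> omega

theorem ind_succ (a b c : Fin m) :
    ind a b c = ind a b (finRotate m c) + (if finRotate m c = b then 1 else 0) -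
      (if finRotate m c = a then 1 else 0) := by
  have := ind_pred a b (finRotate m c)
  rwa [Equiv.symm_apply_apply] at this

@[simp] theorem ind_self (a c : Fin m) : ind a a c = 0 := by
  simp only [ind, mem_cyclicIco, Fin.le_def, Fin.lt_def]
  split_ifs <;> omega

theorem ind_left {a b : Fin m} (h : a ≠ b) : ind a b a = 1 := by
  have : a.val ≠ b.val := fun h' => h (Fin.ext h')
  simp only [ind, mem_cyclicIco, Fin.le_def, Fin.lt_def]
  split_ifs <;> omega

@[simp] theorem ind_right (a b : Fin m) : ind a b b = 0 := by
  simp only [ind, mem_cyclicIco, Fin.le_def, Fin.lt_def]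
  split_ifs <;> omega

theorem ind_compl {a b : Fin m} (h : a ≠ b) (c : Fin m) : ind a b c + ind b a c = 1 := by
  have : a.val ≠ b.val := fun h' => h (Fin.ext h')
  simp only [ind, mem_cyclicIco, Fin.le_def, Fin.lt_def]
  split_ifs <;> omega

theorem ind_pred_left (a b : Fin m) : ind a b ((finRotate m).symm a) = 0 := by
  rcases eq_or_ne a b with rfl | h
  · simp
  · rw [ind_pred, ind_left h]; simp [h]

theorem ind_eq_one_iff {a b c : Fin m} : ind a b c = 1 ↔ c ∈ cyclicIco a b := by
  unfold ind; split_ifs <;> simp_all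

theorem ind_eq_zero_iff {a b c : Fin m} : ind a b c = 0 ↔ c ∉ cyclicIco a b := by
  unfold ind; split_ifs <;> simp_all

/-- Concatenation of cyclic intervals that do not go all the way around. -/
theorem ind_add {p a b : Fin m} (h : ind a b ((finRotate m).symm p) = 0) (c : Fin m) :
    ind p b c = ind p a c + ind a b c := by
  -- The difference of the two sides has no jumps, and it vanishes just before `p`.
  have := const_of_finRotate (fun c => ind p a c + ind a b c - ind p b c) (fun c => by
    simp only [ind_pred]; ring) c ((finRotate m).symm p)
  simp only [ind_pred_left, h] at this
  linarith

theorem ind_finRotate {a : Fin m} (h : finRotate m a ≠ a) (c : Fin m) :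
    ind a (finRotate m a) c = if c = a then 1 else 0 := by
  rcases eq_or_ne c a with rfl | hc
  · rw [ind_left h.symm, if_pos rfl]
  · have hv := val_finRotate a
    have h' : (finRotate m a).val ≠ a.val := fun e => h (Fin.ext e)
    have hc' : c.val ≠ a.val := fun e => hc (Fin.ext e)
    have := a.isLt
    have := c.isLt
    simp only [ind, mem_cyclicIco, Fin.le_def, Fin.lt_def, Fin.ext_iff]
    generalize (finRotate m a).val = e at *
    split_ifs at hv <;> split_ifs <;> omega

/-! ### Domains and the index formula for the Maslov grading. -/

/-- The sum of the multiplicities of the four squares around a lattice point. -/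
def quad (D : Fin m → Fin m → ℤ) (c r : Fin m) : ℤ :=
  D c r + D ((finRotate m).symm c) r + D c ((finRotate m).symm r) +
    D ((finRotate m).symm c) ((finRotate m).symm r)

theorem quad_add (D E : Fin m → Fin m → ℤ) (c r : Fin m) :
    quad (fun c r => D c r + E c r) c r = quad D c r + quad E c r := by
  unfold quad; ring

theorem quad_nonneg {D : Fin m → Fin m → ℤ} (hD : ∀ c r, 0 ≤ D c r) (c r : Fin m) :
    0 ≤ quad D c r := by
  unfold quad
  have := hD c r
  have := hD ((finRotate m).symm c) r
  have := hD c ((finRotate m).symm r)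
  have := hD ((finRotate m).symm c) ((finRotate m).symm r)
  omega

theorem IsDomain.add {x y z : Gen m} {D E : Fin m → Fin m → ℤ} (hD : IsDomain x y D)
    (hE : IsDomain y z E) : IsDomain x z (fun c r => D c r + E c r) := by
  intro c r
  linarith [hD c r, hE c r]

/-- The number of points of `x` in the rectangle `[0, i) × [0, j)`. -/
def lowerCount (x : Gen m) (i j : ℕ) : ℤ := ∑ c : Fin m, if c.val < i ∧ (x c).val < j then 1 else 0

/-- The domain from `x` to `y` that does not meet the last row and the last column. -/
def planarDomain (x y : Gen m) (c r : Fin m) : ℤ :=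
  lowerCount x (c + 1) (r + 1) - lowerCount y (c + 1) (r + 1)

theorem lowerCount_zero_left (x : Gen m) (j : ℕ) : lowerCount x 0 j = 0 := by simp [lowerCount]

theorem lowerCount_zero_right (x : Gen m) (j : ℕ) : lowerCount x j 0 = 0 := by simp [lowerCount]

/-- Each row has one point of any matching. This is what makes `planarDomain` close up across the
seam of the torus. -/
theorem lowerCount_top_left (x y : Gen m) (j : ℕ) : lowerCount x m j = lowerCount y m j := by
  have : ∀ x : Gen m, lowerCount x m j = ∑ c : Fin m, if c.val < j then 1 else 0 := by
    intro x
    rw [← Equiv.sum_comp x]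
    simp [lowerCount]
  rw [this, this]

theorem lowerCount_top_right (x y : Gen m) (j : ℕ) : lowerCount x j m = lowerCount y j m := by
  simp [lowerCount]

theorem planarDomain_pred_left (x y : Gen m) (c r : Fin m) :
    planarDomain x y ((finRotate m).symm c) r =
      lowerCount x c (r + 1) - lowerCount y c (r + 1) := by
  unfold planarDomain
  rw [val_finRotate_symm]
  have := c.isLt
  split_ifs with h
  · rw [h, Nat.sub_add_cancel (by omega), lowerCount_top_left x y]
    simp [lowerCount_zero_left]
  · rw [Nat.sub_add_cancel (by omega)]

theorem planarDomain_pred_right (x y : Gen m) (c r : Fin m) :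
    planarDomain x y c ((finRotate m).symm r) =
      lowerCount x (c + 1) r - lowerCount y (c + 1) r := by
  unfold planarDomain
  rw [val_finRotate_symm]
  have := r.isLt
  split_ifs with h
  · rw [h, Nat.sub_add_cancel (by omega), lowerCount_top_right x y]
    simp [lowerCount_zero_right]
  · rw [Nat.sub_add_cancel (by omega)]

theorem planarDomain_pred_pred (x y : Gen m) (c r : Fin m) :
    planarDomain x y ((finRotate m).symm c) ((finRotate m).symm r) =
      lowerCount x c r - lowerCount y c r := by
  rw [planarDomain_pred_left, val_finRotate_symm]
  have := r.isLt
  split_ifs with h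
  · rw [h, Nat.sub_add_cancel (by omega), lowerCount_top_right x y]
    simp [lowerCount_zero_right]
  · rw [Nat.sub_add_cancel (by omega)]

theorem lowerCount_mixed (x : Gen m) (c r : Fin m) :
    lowerCount x (c + 1) (r + 1) - lowerCount x c (r + 1) - lowerCount x (c + 1) r +
      lowerCount x c r = if x c = r then 1 else 0 := by
  unfold lowerCount
  rw [← Finset.sum_sub_distrib, ← Finset.sum_sub_distrib, ← Finset.sum_add_distrib,
    Finset.sum_eq_single c]
  · simp only [Fin.ext_iff]
    split_ifs <;> omega
  · intro b _ hb
    have : b.val ≠ c.val := fun h => hb (Fin.ext h)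
    split_ifs <;> omega
  · simp

theorem planarDomain_isDomain (x y : Gen m) : IsDomain x y (planarDomain x y) := by
  intro c r
  rw [planarDomain_pred_pred, planarDomain_pred_left, planarDomain_pred_right]
  have h1 := lowerCount_mixed x c r
  have h2 := lowerCount_mixed y c r
  unfold planarDomain
  linarith

/-- The difference of two domains with the same ends has vanishing mixed second difference, so it is
a combination of full columns and full rows. -/
theorem IsDomain.eq_planarDomain_add {x y : Gen m} {D : Fin m → Fin m → ℤ}
    (hD : IsDomain x y D) :
    ∃ u v : Fin m → ℤ, ∀ c r, D c r = planarDomain x y c r + (u c + v r) := by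
  obtain _ | n := m
  · exact ⟨fun _ => 0, fun _ => 0, fun c => c.elim0⟩
  set E : Fin (n + 1) → Fin (n + 1) → ℤ := fun c r => D c r - planarDomain x y c r with hE
  have h0 : ∀ c r, E ((finRotate _).symm c) r + E c ((finRotate _).symm r) - E c r -
      E ((finRotate _).symm c) ((finRotate _).symm r) = 0 := by
    intro c r
    simp only [hE]
    linarith [hD c r, planarDomain_isDomain x y c r]
  have h1 : ∀ c r s, E c r - E ((finRotate _).symm c) r = E c s - E ((finRotate _).symm c) s :=
    fun c r s => const_of_finRotate (fun r => E c r - E ((finRotate _).symm c) r)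
      (fun r => by linarith [h0 c r]) r s
  have h2 : ∀ r c d, E c r - E c 0 = E d r - E d 0 :=
    fun r c d => const_of_finRotate (fun c => E c r - E c 0)
      (fun c => by linarith [h1 c r 0]) c d
  refine ⟨fun c => E c 0, fun r => E 0 r - E 0 0, fun c r => ?_⟩
  have := h2 r c 0
  simp only [hE] at *
  linarith

/-- `1 + sign (b - a)`. -/
def sgnSucc (a b : Fin m) : ℤ := (if a ≤ b then 1 else 0) + if a < b then 1 else 0

/-- Four times the symmetrized count of the pairs formed by a point of `x` and a point of `y`
to the upper right of it. -/
def pairCount (x y : Gen m) : ℤ := ∑ c : Fin m, ∑ c' : Fin m, sgnSucc c' c * sgnSucc (x c') (y c)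

theorem sgnSucc_add (a b : Fin m) : sgnSucc a b + sgnSucc b a = 2 := by
  simp only [sgnSucc, Fin.le_def, Fin.lt_def]
  split_ifs <;> omega

/-- Reversing both comparisons changes the product by terms antisymmetric in the columns and in the
rows. Each of them sums to zero, since `x` and `y` run through all rows. -/
theorem pairCount_symm (x y : Gen m) : pairCount x y = pairCount y x := by
  have h1 : pairCount y x = ∑ c : Fin m, ∑ c' : Fin m, sgnSucc c c' * sgnSucc (y c) (x c') := by
    rw [pairCount, Finset.sum_comm]
  have h2 : ∀ c c' : Fin m, sgnSucc c c' * sgnSucc (y c) (x c') =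
      sgnSucc c' c * sgnSucc (x c') (y c) + (sgnSucc c c' - sgnSucc c' c) +
        (sgnSucc (y c) (x c') - sgnSucc (x c') (y c)) := by
    intro c c'
    have e1 : sgnSucc c c' = 2 - sgnSucc c' c := by linarith [sgnSucc_add c c']
    have e2 : sgnSucc (y c) (x c') = 2 - sgnSucc (x c') (y c) := by
      linarith [sgnSucc_add (y c) (x c')]
    rw [e1, e2]; ring
  have h3 : ∑ c : Fin m, ∑ c' : Fin m, (sgnSucc c c' - sgnSucc c' c) = 0 := by
    simp only [Finset.sum_sub_distrib]
    rw [sub_eq_zero, Finset.sum_comm]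
  have h4 : ∑ c : Fin m, ∑ c' : Fin m, (sgnSucc (y c) (x c') - sgnSucc (x c') (y c)) = 0 := by
    rw [← h3, Equiv.sum_comp y fun a => ∑ c' : Fin m, (sgnSucc a (x c') - sgnSucc (x c') a)]
    exact Finset.sum_congr rfl fun a _ =>
      Equiv.sum_comp x fun b => sgnSucc a b - sgnSucc b a
  rw [h1]
  simp only [h2, Finset.sum_add_distrib, h3, h4]
  simp [pairCount]

/-- The number of pairs of points of `x` such that the second is above and to the right of the
first. -/
def inCount (x : Gen m) : ℤ :=
  (Finset.univ.filter fun p : Fin m × Fin m => p.1 < p.2 ∧ x p.1 < x p.2).card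

theorem pairCount_self (x : Gen m) : pairCount x x = 4 * inCount x + m := by
  have h1 : inCount x = ∑ c : Fin m, ∑ c' : Fin m, if c' < c ∧ x c' < x c then 1 else 0 := by
    rw [inCount, Finset.card_filter, Finset.sum_comm]
    push_cast
    rw [← Finset.univ_product_univ, Finset.sum_product]
  have h2 : (m : ℤ) = ∑ c : Fin m, ∑ c' : Fin m, if c' = c then 1 else 0 := by simp
  rw [h1, h2, Finset.mul_sum, ← Finset.sum_add_distrib]
  refine Finset.sum_congr rfl fun c _ => ?_
  rw [Finset.mul_sum, ← Finset.sum_add_distrib]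
  refine Finset.sum_congr rfl fun c' _ => ?_
  rcases eq_or_ne c' c with rfl | h
  · simp [sgnSucc]
  · have h' : c'.val ≠ c.val := fun e => h (Fin.ext e)
    have h'' : (x c').val ≠ (x c).val := fun e => h (x.injective (Fin.ext e))
    simp only [sgnSucc, Fin.le_def, Fin.lt_def, h, if_false]
    split_ifs <;> omega

/-- The four lower counts around a lattice point combine the weak and strict comparisons in both
coordinates, which is exactly the product of two values of `sgnSucc`. -/
theorem sum_quad_planarDomain (x y z : Gen m) :
    ∑ c, quad (planarDomain x y) c (z c) = pairCount x z - pairCount y z := by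
  have key : ∀ x z : Gen m, pairCount x z = ∑ c : Fin m, (lowerCount x (c + 1) (z c + 1) +
      lowerCount x c (z c + 1) + lowerCount x (c + 1) (z c) + lowerCount x c (z c)) := by
    intro x z
    refine Finset.sum_congr rfl fun c _ => ?_
    simp only [lowerCount, ← Finset.sum_add_distrib]
    refine Finset.sum_congr rfl fun c' _ => ?_
    simp only [sgnSucc, Fin.le_def, Fin.lt_def, Nat.lt_succ_iff]
    split_ifs <;> omega
  rw [key, key, ← Finset.sum_sub_distrib]
  refine Finset.sum_congr rfl fun c _ => ?_
  rw [quad, planarDomain_pred_pred, planarDomain_pred_left, planarDomain_pred_right, planarDomain]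
  ring

theorem sum_quad_periodic (u v : Fin m → ℤ) (z : Gen m) :
    ∑ c, quad (fun c r => u c + v r) c (z c) = 4 * ∑ c, u c + 4 * ∑ r, v r := by
  have h1 : ∑ c, u ((finRotate m).symm c) = ∑ c, u c := Equiv.sum_comp _ u
  have h2 : ∑ c, v (z c) = ∑ c, v c := Equiv.sum_comp z v
  have h3 : ∑ c, v ((finRotate m).symm (z c)) = ∑ c, v c :=
    (Equiv.sum_comp z fun r => v ((finRotate m).symm r)).trans (Equiv.sum_comp _ v)
  simp only [quad, Finset.sum_add_distrib, h1, h2, h3]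
  ring

/-- The index formula for domains, in terms of point measures. -/
theorem maslov_sub (H : MarkedGrid V m) {x y : Gen m} {D : Fin m → Fin m → ℤ}
    (hD : IsDomain x y D) :
    4 * (H.maslov x - H.maslov y) =
      ∑ c, quad D c (x c) + ∑ c, quad D c (y c) - 8 * ∑ c, D c (H.O c) := by
  obtain ⟨u, v, huv⟩ := hD.eq_planarDomain_add
  obtain rfl : D = fun c r => planarDomain x y c r + (u c + v r) := funext₂ huv
  have hA : ∀ x : Gen m, (((Finset.univ.filter fun p : Fin m × Fin m =>
      p.1 ≤ p.2 ∧ x p.1 ≤ H.O p.2).card : ℕ) : ℤ) =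
      ∑ c : Fin m, lowerCount x (c + 1) (H.O c + 1) := by
    intro x
    rw [Finset.card_filter, ← Finset.univ_product_univ, Finset.sum_product, Finset.sum_comm]
    push_cast
    simp only [lowerCount, Fin.le_def, Nat.lt_succ_iff]
  -- Inclusion-exclusion on the two reversed inequalities: up to a constant, this count depends on
  -- `x` through the same sum as `hA`.
  have hB : ∀ x : Gen m, (((Finset.univ.filter fun p : Fin m × Fin m =>
      p.1 < p.2 ∧ H.O p.1 < x p.2).card : ℕ) : ℤ) =
      ∑ c : Fin m, lowerCount x (c + 1) (H.O c + 1) + ((m : ℤ) * m -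
        (∑ c : Fin m, ∑ c' : Fin m, if c' ≤ c then 1 else 0) -
        ∑ c : Fin m, ∑ c' : Fin m, if c' ≤ H.O c then 1 else 0) := by
    intro x
    have e1 : ∑ c : Fin m, ∑ c' : Fin m, (if c' ≤ H.O c then (1 : ℤ) else 0) =
        ∑ c : Fin m, ∑ c' : Fin m, if x c' ≤ H.O c then 1 else 0 :=
      Finset.sum_congr rfl fun c _ =>
        (Equiv.sum_comp x fun b => if b ≤ H.O c then (1 : ℤ) else 0).symm
    have e2 : (m : ℤ) * m = ∑ c : Fin m, ∑ c' : Fin m, 1 := by simp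
    rw [e1, e2, Finset.card_filter, ← Finset.univ_product_univ, Finset.sum_product]
    push_cast
    simp only [lowerCount]
    rw [← Finset.sum_sub_distrib, ← Finset.sum_sub_distrib, ← Finset.sum_add_distrib]
    refine Finset.sum_congr rfl fun c _ => ?_
    rw [← Finset.sum_sub_distrib, ← Finset.sum_sub_distrib, ← Finset.sum_add_distrib]
    refine Finset.sum_congr rfl fun c' _ => ?_
    simp only [Fin.le_def, Fin.lt_def, Nat.lt_succ_iff]
    split_ifs <;> omega
  have hO : ∑ c, (planarDomain x y c (H.O c) + (u c + v (H.O c))) =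
      ∑ c : Fin m, lowerCount x (c + 1) (H.O c + 1) -
        ∑ c : Fin m, lowerCount y (c + 1) (H.O c + 1) + (∑ c, u c + ∑ r, v r) := by
    simp only [Finset.sum_add_distrib, planarDomain, Finset.sum_sub_distrib, Equiv.sum_comp H.O v]
  -- The periodic part adds `4 (∑ u + ∑ v)` to each of the two point sums, which the `O` term
  -- cancels with its factor `8`.
  have hQ : ∀ z : Gen m, ∑ c, quad (fun c r => planarDomain x y c r + (u c + v r)) c (z c) =
      pairCount x z - pairCount y z + (4 * ∑ c, u c + 4 * ∑ r, v r) := by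
    intro z
    rw [← sum_quad_planarDomain, ← sum_quad_periodic u v z, ← Finset.sum_add_distrib]
    exact Finset.sum_congr rfl fun c _ => quad_add _ _ _ _
  simp only [hO, hQ, pairCount_self, pairCount_symm y x]
  have hI : ∀ z, H.maslov z = inCount z - _ - _ + _ + 1 := fun z => rfl
  rw [hI x, hI y, hA x, hA y, hB x, hB y]
  ring

/-! ### Rectangles and their Maslov index. -/

/-- The two-chain of the rectangle `p` starting at `x`. -/
def rectDomain (x : Gen m) (p : Fin m × Fin m) (c r : Fin m) : ℤ :=
  ind p.1 p.2 c * ind (x p.1) (x p.2) r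

theorem rectDomain_nonneg (x : Gen m) (p : Fin m × Fin m) (c r : Fin m) :
    0 ≤ rectDomain x p c r :=
  mul_nonneg (ind_nonneg _ _ _) (ind_nonneg _ _ _)

theorem rectDomain_isDomain (x : Gen m) (p : Fin m × Fin m) :
    IsDomain x (x * Equiv.swap p.1 p.2) (rectDomain x p) := by
  intro c r
  obtain ⟨a, b⟩ := p
  have hz : (x * Equiv.swap a b) c = if c = a then x b else if c = b then x a else x c := by
    rw [Equiv.Perm.mul_apply, Equiv.swap_apply_def]
    split_ifs <;> rfl
  simp only [rectDomain, ind_pred, hz, eq_comm (b := r)]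
  rcases eq_or_ne a b with rfl | hab
  · rcases eq_or_ne c a with rfl | ha <;> simp [*]
  · rcases eq_or_ne c a with rfl | ha
    · simp only [if_true, hab, if_false]; ring
    · rcases eq_or_ne c b with rfl | hb
      · simp only [if_true, ha, if_false]; ring
      · simp only [ha, hb, if_false]; ring

theorem quad_rectDomain (x : Gen m) (p : Fin m × Fin m) (c r : Fin m) :
    quad (rectDomain x p) c r =
      (2 * ind p.1 p.2 c + (if c = p.2 then 1 else 0) - (if c = p.1 then 1 else 0)) *
      (2 * ind (x p.1) (x p.2) r + (if r = x p.2 then 1 else 0) -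
        (if r = x p.1 then 1 else 0)) := by
  simp only [quad, rectDomain, ind_pred]
  ring

theorem rectDomain_apply_O (H : MarkedGrid V m) (x : Gen m) (p : Fin m × Fin m) (c : Fin m) :
    rectDomain x p c (H.O c) = if c ∈ H.rectO x p then 1 else 0 := by
  unfold rectDomain ind rectO
  split_ifs <;> simp_all

/-- Each of the two corners touches one square of the rectangle, and each interior point touches
four. The set `Z` of columns with tolerated interior points will be empty, the marked set, or
everything but the corners. -/
theorem sum_quad_rectDomain {x z : Gen m} {p : Fin m × Fin m} (hne : p.1 ≠ p.2) (Z : Finset (Fin m))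
    (h1 : p.1 ∉ Z) (h2 : p.2 ∉ Z)
    (hp : ∀ c ∈ cyclicIoo p.1 p.2, c ∉ Z → x c ∉ cyclicIoo (x p.1) (x p.2))
    (hz : z = x ∨ z = x * Equiv.swap p.1 p.2) :
    ∑ c, quad (rectDomain x p) c (z c) = 2 + 4 * ∑ c ∈ Z, rectDomain x p c (x c) := by
  obtain ⟨a, b⟩ := p
  simp only at *
  have hxne : x a ≠ x b := fun h => hne (x.injective h)
  have hterm : ∀ c, quad (rectDomain x (a, b)) c (z c) =
      (if c = a then 1 else 0) + (if c = b then 1 else 0) +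
        if c ∈ Z then 4 * rectDomain x (a, b) c (x c) else 0 := by
    intro c
    rw [quad_rectDomain]
    simp only
    rcases eq_or_ne c a with rfl | ha
    · rw [if_neg h1, if_pos rfl, if_neg hne, ind_left hne]
      rcases hz with rfl | rfl
      · rw [ind_left hxne, if_neg hxne, if_pos rfl]; ring
      · rw [Equiv.Perm.mul_apply, Equiv.swap_apply_left, ind_right, if_pos rfl, if_neg hxne.symm]
        ring
    rcases eq_or_ne c b with rfl | hb
    · rw [if_neg h2, if_pos rfl, if_neg ha, ind_right]
      rcases hz with rfl | rfl
      · rw [ind_right, if_pos rfl, if_neg hxne.symm]; ring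
      · rw [Equiv.Perm.mul_apply, Equiv.swap_apply_right, ind_left hxne, if_neg hxne, if_pos rfl]
        ring
    have hzc : z c = x c := by
      rcases hz with rfl | rfl
      · rfl
      · rw [Equiv.Perm.mul_apply, Equiv.swap_apply_of_ne_of_ne ha hb]
    have ha' : x c ≠ x a := fun h => ha (x.injective h)
    have hb' : x c ≠ x b := fun h => hb (x.injective h)
    rw [hzc, if_neg ha, if_neg hb, if_neg ha', if_neg hb', rectDomain]
    split_ifs with hcZ
    · ring
    · simp only [add_zero, sub_zero]
      by_cases hc : c ∈ cyclicIco a b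
      · have : x c ∉ cyclicIco (x a) (x b) := fun h =>
          hp c (Finset.mem_erase.2 ⟨ha, hc⟩) hcZ (Finset.mem_erase.2 ⟨ha', h⟩)
        rw [ind_eq_zero_iff.2 this]; ring
      · rw [ind_eq_zero_iff.2 hc]; ring
  simp only [hterm, Finset.sum_add_distrib, Finset.sum_ite_eq', Finset.mem_univ, if_true,
    Finset.sum_ite_mem, Finset.univ_inter, Finset.mul_sum]
  ring

/-- The change of the Maslov grading along a rectangle whose interior contains no other points of
`x` than those in the columns of `Z`, which are lower left corners of squares marked `O`. -/
theorem maslov_rect (H : MarkedGrid V m) {x : Gen m} {p : Fin m × Fin m} (hne : p.1 ≠ p.2)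
    (Z : Finset (Fin m)) (h1 : p.1 ∉ Z) (h2 : p.2 ∉ Z)
    (hp : ∀ c ∈ cyclicIoo p.1 p.2, c ∉ Z → x c ∉ cyclicIoo (x p.1) (x p.2))
    (hZ : ∀ c ∈ Z, x c = H.O c) :
    H.maslov x - H.maslov (x * Equiv.swap p.1 p.2) = 1 - 2 * ((H.rectO x p \ Z).card : ℤ) := by
  have h := H.maslov_sub (rectDomain_isDomain x p)
  rw [sum_quad_rectDomain hne Z h1 h2 hp (Or.inl rfl),
    sum_quad_rectDomain hne Z h1 h2 hp (Or.inr rfl)] at h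
  -- Interior points in `Z` come with their own `O`; the contributions cancel, leaving only the
  -- `O`'s outside `Z`.
  have e1 : ∑ c ∈ Z, rectDomain x p c (x c) = ((H.rectO x p ∩ Z).card : ℤ) := by
    rw [Finset.card_eq_sum_ones, Finset.inter_comm, ← Finset.filter_mem_eq_inter,
      Finset.sum_filter]
    push_cast
    exact Finset.sum_congr rfl fun c hc => by rw [hZ c hc, rectDomain_apply_O]
  have e2 : ∑ c, rectDomain x p c (H.O c) = ((H.rectO x p).card : ℤ) := by
    simp [rectDomain_apply_O]
  have e3 : ((H.rectO x p \ Z).card : ℤ) + ((H.rectO x p ∩ Z).card : ℤ) =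
      ((H.rectO x p).card : ℤ) := by
    exact_mod_cast Finset.card_sdiff_add_card_inter _ _
  rw [e1, e2] at h
  linarith

/-! ### Flipping a marked column and the bound for critical pairs. -/

/-- Replace column `c` by a copy of the column to its left, increased by one on the arc of the
circle `c` from `u` to `r`. -/
def flipDomain (D : Fin m → Fin m → ℤ) (c u r : Fin m) (c' s : Fin m) : ℤ :=
  if c' = c then D ((finRotate m).symm c) s + ind u r s else D c' s

theorem finRotate_symm_ne {c : Fin m} (h : finRotate m c ≠ c) : (finRotate m).symm c ≠ c :=
  fun h' => h (by rw [← Equiv.eq_symm_apply]; exact h'.symm)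

theorem flipDomain_nonneg {D : Fin m → Fin m → ℤ} (hD : ∀ c r, 0 ≤ D c r) (c u r c' s : Fin m) :
    0 ≤ flipDomain D c u r c' s := by
  unfold flipDomain
  split_ifs
  · exact add_nonneg (hD _ _) (ind_nonneg _ _ _)
  · exact hD _ _

theorem flipDomain_of_ne (D : Fin m → Fin m → ℤ) {c c' : Fin m} (h : c' ≠ c) (u r s : Fin m) :
    flipDomain D c u r c' s = D c' s := if_neg h

theorem flipDomain_self (D : Fin m → Fin m → ℤ) (c u r s : Fin m) :
    flipDomain D c u r c s = D ((finRotate m).symm c) s + ind u r s := if_pos rfl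

/-- On the circle `c` the new jump is the arc from `x (finRotate m c)` to `y c`, as the flipped
matching requires. The next circle receives the sum of both old jumps minus this arc. -/
theorem flipDomain_isDomain {x y : Gen m} {D : Fin m → Fin m → ℤ} (hD : IsDomain x y D)
    {c r : Fin m} (hc : finRotate m c ≠ c) (hr : y c = r) :
    IsDomain (x * Equiv.swap c (finRotate m c)) y (flipDomain D c (x (finRotate m c)) r) := by
  intro c' s
  have hpred := finRotate_symm_ne hc
  have hsymm : ∀ s, (if x (finRotate m c) = s then (1 : ℤ) else 0) =
    if s = x (finRotate m c) then 1 else 0 := fun s => by simp only [eq_comm]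
  have hx : (x * Equiv.swap c (finRotate m c)) c = x (finRotate m c) := by
    rw [Equiv.Perm.mul_apply, Equiv.swap_apply_left]
  have hx' : (x * Equiv.swap c (finRotate m c)) (finRotate m c) = x c := by
    rw [Equiv.Perm.mul_apply, Equiv.swap_apply_right]
  rcases eq_or_ne c' c with rfl | h1
  · rw [hx, hr, flipDomain_self, flipDomain_self, flipDomain_of_ne _ hpred,
      flipDomain_of_ne _ hpred, ind_pred, hsymm]
    simp only [eq_comm (a := r)]
    ring
  rcases eq_or_ne c' (finRotate m c) with rfl | h2
  · rw [Equiv.symm_apply_apply, hx', flipDomain_self, flipDomain_self, flipDomain_of_ne _ hc,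
      flipDomain_of_ne _ hc, ind_pred, ← hsymm]
    have e1 := hD c s
    have e2 := hD (finRotate m c) s
    rw [Equiv.symm_apply_apply] at e2
    rw [hr] at e1
    simp only [eq_comm (a := r)] at e1
    linarith
  · have h3 : (finRotate m).symm c' ≠ c := fun h => h2 (by rw [← h, Equiv.apply_symm_apply])
    rw [flipDomain_of_ne _ h1, flipDomain_of_ne _ h1, flipDomain_of_ne _ h3, flipDomain_of_ne _ h3,
      Equiv.Perm.mul_apply, Equiv.swap_apply_of_ne_of_ne h1 h2]
    exact hD c' s

/-- No two marked squares lie in cyclically adjacent columns or rows. -/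
def IsSparse (H : MarkedGrid V m) : Prop :=
  ∀ j ∈ H.Z, ∀ j' ∈ H.Z, j' ≠ finRotate m j ∧ H.O j' ≠ finRotate m (H.O j)

namespace IsSparse

variable {H : MarkedGrid V m}

/-- The case `j' = j` of sparsity: a marked column is never the whole grid. -/
theorem finRotate_ne (hH : H.IsSparse) {j : Fin m} (hj : j ∈ H.Z) : finRotate m j ≠ j :=
  (hH j hj j hj).1.symm

theorem finRotate_notMem (hH : H.IsSparse) {j : Fin m} (hj : j ∈ H.Z) : finRotate m j ∉ H.Z :=
  fun h => (hH j hj _ h).1 rfl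

theorem symm_ne (hH : H.IsSparse) {j j' : Fin m} (hj : j ∈ H.Z) (hj' : j' ∈ H.Z) :
    (finRotate m).symm j' ≠ j :=
  fun h => (hH j hj j' hj').1 (by rw [← h, Equiv.apply_symm_apply])

theorem symm_O_ne (hH : H.IsSparse) {j j' : Fin m} (hj : j ∈ H.Z) (hj' : j' ∈ H.Z) :
    (finRotate m).symm (H.O j') ≠ H.O j :=
  fun h => (hH j hj j' hj').2 (by rw [← h, Equiv.apply_symm_apply])

end IsSparse

/-- The thin rectangle in the column `c`. -/
theorem maslov_thin (H : MarkedGrid V m) (x : Gen m) {c : Fin m} (hc : finRotate m c ≠ c)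
    (hO : H.O c ∉ cyclicIco (x c) (x (finRotate m c))) :
    H.maslov x - H.maslov (x * Equiv.swap c (finRotate m c)) = 1 := by
  have h := H.maslov_rect (x := x) (p := (c, finRotate m c)) hc.symm ∅ (by simp) (by simp)
    (fun d hd => by
      have h1 := (Finset.mem_erase.1 hd)
      have h2 := ind_eq_one_iff.2 h1.2
      rw [ind_finRotate hc, if_neg h1.1] at h2
      omega) (by simp)
  have h0 : H.rectO x (c, finRotate m c) = ∅ := by
    rw [Finset.eq_empty_iff_forall_notMem]
    intro d hd
    simp only [rectO, Finset.mem_filter, Finset.mem_univ, true_and] at hd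
    have h2 := ind_eq_one_iff.2 hd.1
    rw [ind_finRotate hc] at h2
    split_ifs at h2 with h3
    · subst h3; exact hO hd.2
    · omega
  rw [h0] at h
  simpa using h

/-- The bound on the Maslov grading behind the nonnegativity of the index of the critical pairs. -/
theorem critical_bound {H : MarkedGrid V m} (hH : H.IsSparse) {y : Gen m}
    (hy : ∀ j ∈ H.Z, y j = H.O j) (n : ℕ) :
    ∀ (x : Gen m) (D : Fin m → Fin m → ℤ) (θ : Fin m → ℤ),
      (H.Z.filter fun j => x j ≠ H.O j).card = n → IsDomain x y D → (∀ c r, 0 ≤ D c r) →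
      (∀ j ∈ H.Z, (x j = H.O j ∧ θ j ≤ D ((finRotate m).symm j) (H.O j) +
          D j ((finRotate m).symm (H.O j)) - 2 * D j (H.O j)) ∨
        (x (finRotate m j) = H.O j ∧
          θ j ≤ D j ((finRotate m).symm (H.O j)) - D j (H.O j))) →
      ∑ j ∈ H.Z, θ j ≤ H.maslov x - H.maslov y +
        2 * ∑ c, if c ∈ H.Z then 0 else D c (H.O c) := by
  -- Induction on the number of marked columns whose `p_j` is not in `x`. The bounds `θ` vary along,
  -- since each flip lowers one of them by one.
  induction n with
  | zero =>
    intro x D θ hn hD h0 hθ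
    have hx : ∀ j ∈ H.Z, x j = H.O j := by
      intro j hj
      by_contra h
      rw [Finset.card_eq_zero] at hn
      exact Finset.notMem_empty j (hn ▸ Finset.mem_filter.2 ⟨hj, h⟩)
    have hM := H.maslov_sub hD
    -- Points outside the marked columns contribute nonnegatively and are dropped.
    have hq : ∀ z : Gen m, (∀ j ∈ H.Z, z j = H.O j) →
        ∑ j ∈ H.Z, quad D j (H.O j) ≤ ∑ c, quad D c (z c) := by
      intro z hz
      rw [Finset.sum_congr rfl fun j hj => by rw [← hz j hj]]
      exact Finset.sum_le_sum_of_subset_of_nonneg (Finset.subset_univ _)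
        fun c _ _ => quad_nonneg h0 _ _
    have hs : ∑ c, D c (H.O c) =
        ∑ c, (if c ∈ H.Z then 0 else D c (H.O c)) + ∑ j ∈ H.Z, D j (H.O j) := by
      rw [← Finset.univ_inter H.Z, ← Finset.sum_ite_mem, ← Finset.sum_add_distrib]
      refine Finset.sum_congr rfl fun c _ => ?_
      simp only [Finset.univ_inter]
      split_ifs <;> simp
    -- Both `x` and `y` contain `p_j`, so `a + d = b + c` there and the four multiplicities add up
    -- to `2 (a + d)`.
    have hl : ∑ j ∈ H.Z, (2 * θ j + 4 * D j (H.O j)) ≤ ∑ j ∈ H.Z, quad D j (H.O j) := by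
      refine Finset.sum_le_sum fun j hj => ?_
      have e := hD j (H.O j)
      rw [hx j hj, hy j hj] at e
      rcases hθ j hj with h | h
      · unfold quad
        linarith [h.2]
      · exact absurd (x.injective (h.1.trans (hx j hj).symm)) (hH.finRotate_ne hj)
    rw [Finset.sum_add_distrib, ← Finset.mul_sum, ← Finset.mul_sum] at hl
    have h1 := hq x hx
    have h2 := hq y hy
    linarith
  | succ n ih =>
    intro x D θ hn hD h0 hθ
    obtain ⟨j, hj⟩ := Finset.card_pos.1 (by omega : 0 < (H.Z.filter fun j => x j ≠ H.O j).card)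
    rw [Finset.mem_filter] at hj
    obtain ⟨hjZ, hxj⟩ := hj
    obtain ⟨hxj', hθj⟩ := (hθ j hjZ).resolve_left fun h => hxj h.1
    have hrot := hH.finRotate_ne hjZ
    set x' := x * Equiv.swap j (finRotate m j) with hx'
    have hx'j : x' j = H.O j := by
      rw [hx', Equiv.Perm.mul_apply, Equiv.swap_apply_left, hxj']
    have hx'i : ∀ i, i ≠ j → i ≠ finRotate m j → x' i = x i := fun i h1 h2 => by
      rw [hx', Equiv.Perm.mul_apply, Equiv.swap_apply_of_ne_of_ne h1 h2]
    have hD' := flipDomain_isDomain hD hrot (hy j hjZ)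
    -- The thin rectangle ends just below the row of the `O`.
    have hM : H.maslov x - H.maslov x' = 1 := H.maslov_thin x hrot (by
      rw [hxj', ← ind_eq_zero_iff, ind_right])
    have hcard : (H.Z.filter fun i => x' i ≠ H.O i).card = n := by
      have : H.Z.filter (fun i => x' i ≠ H.O i) = (H.Z.filter fun i => x i ≠ H.O i).erase j := by
        ext i
        simp only [Finset.mem_filter, Finset.mem_erase]
        rcases eq_or_ne i j with rfl | hij
        · simp [hx'j]
        · constructor
          · rintro ⟨hi, h⟩
            exact ⟨hij, hi, hx'i i hij (hH j hjZ i hi).1 ▸ h⟩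
          · rintro ⟨_, hi, h⟩
            exact ⟨hi, (hx'i i hij (hH j hjZ i hi).1).symm ▸ h⟩
      rw [this, Finset.card_erase_of_mem (Finset.mem_filter.2 ⟨hjZ, hxj⟩), hn]
      rfl
    have hmain := ih x' _ (Function.update θ j (θ j - 1)) hcard hD' (flipDomain_nonneg h0 _ _ _)
      (fun i hi => by
        rcases eq_or_ne i j with rfl | hij
        · refine Or.inl ⟨hx'j, ?_⟩
          -- Here `a + d - b - c = 1`. The new column copies the left one, so the new value of `a +
          -- d - 2 b` is `c - a`, which equals `d - b - 1` in the old multiplicities.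
          have e := hD i (H.O i)
          rw [hy i hjZ, if_pos rfl, if_neg hxj] at e
          rw [Function.update_self, flipDomain_self, flipDomain_self,
            flipDomain_of_ne _ (hH.symm_ne hjZ hjZ), hxj', ind_self, ind_self]
          linarith
        · have h1 := hH.symm_ne hjZ hi
          have h2 : finRotate m i ≠ j := (hH i hi j hjZ).1.symm
          rw [Function.update_of_ne hij, flipDomain_of_ne _ hij, flipDomain_of_ne _ hij,
            flipDomain_of_ne _ h1, hx'i i hij (hH j hjZ i hi).1,
            hx'i _ h2 fun h => hij ((finRotate m).injective h)]
          exact hθ i hi)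
    have hsum : ∑ c, (if c ∈ H.Z then 0 else
        flipDomain D j (x (finRotate m j)) (H.O j) c (H.O c)) =
        ∑ c, if c ∈ H.Z then 0 else D c (H.O c) := by
      refine Finset.sum_congr rfl fun c _ => ?_
      split_ifs with h
      · rfl
      · exact flipDomain_of_ne _ (fun h' : c = j => h (h'.symm ▸ hjZ)) _ _ _
    have hθsum : ∑ i ∈ H.Z, Function.update θ j (θ j - 1) i = ∑ i ∈ H.Z, θ i - 1 := by
      rw [Finset.sum_update_of_mem hjZ, ← Finset.add_sum_erase _ _ hjZ,
        Finset.sdiff_singleton_eq_erase]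
      ring
    rw [hsum, hθsum] at hmain
    linarith

/-! ### Positivity under the differential and under flips; the index of critical pairs. -/

/-- The multiplicity that the `O` of column `c` contributes to the exponent. -/
def mult (H : MarkedGrid V m) (D : Fin m → Fin m → ℤ) (ρ : Fin m → ℤ) (c : Fin m) : ℤ :=
  if c ∈ H.Z then ρ c else D c (H.O c)

open Classical in
/-- A positive enhanced domain from `x` to `U^N (y, ε)`, with the real multiplicities extended
to all columns. -/
structure IsWitness (H : MarkedGrid V m) (x : Gen m) (N : V →₀ ℕ) (y : H.EGen)
    (D : Fin m → Fin m → ℤ) (ρ : Fin m → ℤ) : Prop where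
  dom : IsDomain x y.1.1 D
  nonneg : ∀ c r, 0 ≤ D c r
  upperLeft : ∀ j : H.Z, D j (H.O j) - ρ j ≤ D ((finRotate m).symm j) (H.O j)
  -- This is `f ≤ b`, as `f = b - ρ`.
  upperRight : ∀ j : H.Z, 0 ≤ ρ j
  lowerLeft : ∀ j : H.Z, D j (H.O j) - ρ j + ((y.2 j : ℕ) : ℤ) - 1 ≤
    D ((finRotate m).symm j) ((finRotate m).symm (H.O j))
  lowerRight : ∀ j : H.Z, D j (H.O j) - ρ j + ((y.2 j : ℕ) : ℤ) ≤
    D j ((finRotate m).symm (H.O j))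
  exponent : ∀ v, (N v : ℤ) = ∑ c, if H.var c = v then H.mult D ρ c else 0

theorem sum_subtype_Z (H : MarkedGrid V m) (g : Fin m → ℤ) :
    ∑ j : H.Z, g j = ∑ c, if c ∈ H.Z then g c else 0 := by
  rw [Finset.sum_coe_sort H.Z g, Finset.sum_ite_mem, Finset.univ_inter]

theorem isPositivePair_iff (H : MarkedGrid V m) (x : Gen m) (N : V →₀ ℕ) (y : H.EGen) :
    H.IsPositivePair x N y ↔ ∃ D ρ, H.IsWitness x N y D ρ := by
  classical
  have key : ∀ (D : Fin m → Fin m → ℤ) (ρ : Fin m → ℤ) (v : V),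
      (∑ c : Fin m, if c ∉ H.Z ∧ H.var c = v then D c (H.O c) else 0) +
        (∑ j : H.Z, if H.var j = v then ρ j else 0) =
      ∑ c, if H.var c = v then H.mult D ρ c else 0 := by
    intro D ρ v
    rw [H.sum_subtype_Z fun c => if H.var c = v then ρ c else 0, ← Finset.sum_add_distrib]
    refine Finset.sum_congr rfl fun c _ => ?_
    unfold mult
    split_ifs <;> simp_all
  constructor
  · rintro ⟨D, ρ, hD, ⟨h0, hf⟩, hN⟩
    obtain ⟨ρ', hρ⟩ : ∃ ρ' : Fin m → ℤ, ∀ j : H.Z, ρ' j = ρ j :=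
      ⟨fun c => if h : c ∈ H.Z then ρ ⟨c, h⟩ else 0, fun j => dif_pos j.2⟩
    refine ⟨D, ρ', hD, h0, ?_, ?_, ?_, ?_, ?_⟩
    · intro j; rw [hρ]; exact (hf j).1
    · intro j; rw [hρ]; linarith [show D j (H.O j) - ρ j ≤ D j (H.O j) from (hf j).2.1]
    · intro j; rw [hρ]; exact (hf j).2.2.1
    · intro j; rw [hρ]; exact (hf j).2.2.2
    · intro v
      rw [hN v, ← key]
      simp only [hρ]
  · rintro ⟨D, ρ, h⟩
    refine ⟨D, fun j => ρ j, h.dom, ⟨h.nonneg, fun j => ⟨h.upperLeft j, ?_, h.lowerLeft j,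
      h.lowerRight j⟩⟩, fun v => ?_⟩
    · have := h.upperRight j; linarith
    · rw [h.exponent v, ← key]

/-- The exponent of the product of the variables of the `O`'s in a set of columns. -/
noncomputable def expo (H : MarkedGrid V m) (s : Finset (Fin m)) : V →₀ ℕ :=
  ∑ c ∈ s, Finsupp.single (H.var c) 1

theorem degree_expo (H : MarkedGrid V m) (s : Finset (Fin m)) : (H.expo s).degree = s.card := by
  simp [expo, map_sum]

theorem degree_eq_sum_mult {H : MarkedGrid V m} {x : Gen m} {N : V →₀ ℕ} {y : H.EGen}
    {D : Fin m → Fin m → ℤ} {ρ : Fin m → ℤ} (h : H.IsWitness x N y D ρ) :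
    (N.degree : ℤ) = ∑ c, H.mult D ρ c := by
  classical
  have h1 : N.degree = ∑ v ∈ N.support ∪ Finset.univ.image H.var, N v :=
    Finset.sum_subset Finset.subset_union_left fun v _ hv => Finsupp.notMem_support_iff.1 hv
  rw [h1]
  push_cast
  simp only [h.exponent]
  rw [Finset.sum_comm]
  refine Finset.sum_congr rfl fun c _ => ?_
  rw [Finset.sum_eq_single (H.var c)]
  · rw [if_pos rfl]
  · intro v _ hv; rw [if_neg hv.symm]
  · intro hv
    exact absurd (Finset.mem_union_right _ (Finset.mem_image_of_mem _ (Finset.mem_univ c))) hv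

open Classical in
theorem expo_apply (H : MarkedGrid V m) (s : Finset (Fin m)) (v : V) :
    (H.expo s v : ℤ) = ∑ c, if H.var c = v then (if c ∈ s then 1 else 0) else 0 := by
  have : ∀ c, (if H.var c = v then (if c ∈ s then (1 : ℤ) else 0) else 0) =
      if c ∈ s then (if H.var c = v then 1 else 0) else 0 := by
    intro c; split_ifs <;> rfl
  simp only [this, Finset.sum_ite_mem, Finset.univ_inter]
  rw [expo, Finsupp.finsetSum_apply]
  push_cast
  exact Finset.sum_congr rfl fun c _ => by rw [Finsupp.single_apply]; split_ifs <;> rfl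

/-- Positivity is preserved when a rectangle is put in front. -/
theorem IsPositivePair.prepend {H : MarkedGrid V m} {x : Gen m} {N : V →₀ ℕ} {y : H.EGen}
    (h : H.IsPositivePair x N y) (x' : Gen m) (p : Fin m × Fin m)
    (hx : x' * Equiv.swap p.1 p.2 = x) :
    H.IsPositivePair x' (N + H.expo (H.rectO x' p)) y := by
  rw [isPositivePair_iff] at h ⊢
  obtain ⟨D, ρ, h⟩ := h
  have hR := rectDomain_nonneg x' p
  -- The real multiplicity grows together with `b`, so `f` stays fixed while `a`, `c`, `d` do not
  -- decrease.
  refine ⟨fun c r => rectDomain x' p c r + D c r,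
    fun c => ρ c + if c ∈ H.rectO x' p then 1 else 0, ?_, ?_, ?_, ?_, ?_, ?_, ?_⟩
  · exact (rectDomain_isDomain x' p).add (hx ▸ h.dom)
  · exact fun c r => add_nonneg (hR c r) (h.nonneg c r)
  · intro j
    rw [← rectDomain_apply_O]
    linarith [h.upperLeft j, hR ((finRotate m).symm j) (H.O j)]
  · intro j
    rw [← rectDomain_apply_O]
    linarith [h.upperRight j, hR j (H.O j)]
  · intro j
    rw [← rectDomain_apply_O]
    linarith [h.lowerLeft j, hR ((finRotate m).symm j) ((finRotate m).symm (H.O j))]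
  · intro j
    rw [← rectDomain_apply_O]
    linarith [h.lowerRight j, hR j ((finRotate m).symm (H.O j))]
  · intro v
    rw [Finsupp.add_apply, Nat.cast_add, h.exponent, expo_apply, ← Finset.sum_add_distrib]
    refine Finset.sum_congr rfl fun c _ => ?_
    simp only [mult, ← rectDomain_apply_O]
    split_ifs <;> ring

/-- The enhanced generator at the end of a rectangle starting at `y`. -/
def swapE (H : MarkedGrid V m) (y : H.EGen) (p : Fin m × Fin m) (h1 : p.1 ∉ H.Z) (h2 : p.2 ∉ H.Z) :
    H.EGen :=
  ⟨⟨y.1.1 * Equiv.swap p.1 p.2, fun c hc => by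
    rw [Equiv.Perm.mul_apply, Equiv.swap_apply_of_ne_of_ne (fun h : c = p.1 => h1 (h ▸ hc))
      (fun h : c = p.2 => h2 (h ▸ hc))]
    exact y.1.2 c hc⟩, y.2⟩

/-- Positivity is preserved when a rectangle of the destabilized grid is appended. -/
theorem IsPositivePair.append {H : MarkedGrid V m} {x : Gen m} {N : V →₀ ℕ} {y : H.EGen}
    (h : H.IsPositivePair x N y) (p : Fin m × Fin m) (h1 : p.1 ∉ H.Z) (h2 : p.2 ∉ H.Z) :
    H.IsPositivePair x (N + H.expo (H.rectO y.1.1 p \ H.Z)) (H.swapE y p h1 h2) := by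
  rw [isPositivePair_iff] at h ⊢
  obtain ⟨D, ρ, h⟩ := h
  have hR := rectDomain_nonneg y.1.1 p
  -- No side of the rectangle lies on a circle through `p_j`. Hence `a`, `b`, `c`, `d`, and with
  -- fixed `ρ` also `f`, grow by the same amount.
  have hc : ∀ j : H.Z, ∀ r, rectDomain y.1.1 p ((finRotate m).symm j) r =
      rectDomain y.1.1 p j r := by
    intro j r
    have e1 : (j : Fin m) ≠ p.1 := fun h => h1 (h ▸ j.2)
    have e2 : (j : Fin m) ≠ p.2 := fun h => h2 (h ▸ j.2)
    simp only [rectDomain, ind_pred, e1, e2, if_false, add_zero, sub_zero]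
  have hr : ∀ j : H.Z, ∀ c, rectDomain y.1.1 p c ((finRotate m).symm (H.O j)) =
      rectDomain y.1.1 p c (H.O j) := by
    intro j c
    have e1 : H.O j ≠ y.1.1 p.1 := fun h => h1 (by
      rw [← y.1.2 j j.2] at h; exact y.1.1.injective h ▸ j.2)
    have e2 : H.O j ≠ y.1.1 p.2 := fun h => h2 (by
      rw [← y.1.2 j j.2] at h; exact y.1.1.injective h ▸ j.2)
    simp only [rectDomain, ind_pred, e1, e2, if_false, add_zero, sub_zero]
  refine ⟨fun c r => D c r + rectDomain y.1.1 p c r, ρ, ?_, ?_, ?_, ?_, ?_, ?_, ?_⟩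
  · exact h.dom.add (rectDomain_isDomain y.1.1 p)
  · exact fun c r => add_nonneg (h.nonneg c r) (hR c r)
  · intro j
    rw [hc]
    linarith [h.upperLeft j]
  · exact h.upperRight
  · intro j
    rw [hr, hc]
    have := h.lowerLeft j
    simp only [swapE]
    linarith
  · intro j
    rw [hr]
    have := h.lowerRight j
    simp only [swapE]
    linarith
  · intro v
    rw [Finsupp.add_apply, Nat.cast_add, h.exponent, expo_apply, ← Finset.sum_add_distrib]
    refine Finset.sum_congr rfl fun c _ => ?_
    simp only [mult, rectDomain_apply_O, Finset.mem_sdiff]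
    split_ifs <;> simp_all

/-- Positivity is preserved by the first component of the map in the mapping cone. -/
theorem IsPositivePair.cone {H : MarkedGrid V m} {x : Gen m} {N : V →₀ ℕ} {y : H.EGen}
    (h : H.IsPositivePair x N y) (j : H.Z) (hj : y.2 j = 0) :
    H.IsPositivePair x (N + H.expo {j.1}) (y.1, Function.update y.2 j 1) := by
  rw [isPositivePair_iff] at h ⊢
  obtain ⟨D, ρ, h⟩ := h
  have hε : ∀ i : H.Z, (((Function.update y.2 j 1 i : Fin 2) : ℕ) : ℤ) =
      ((y.2 i : ℕ) : ℤ) + if i = j then 1 else 0 := by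
    intro i
    rcases eq_or_ne i j with rfl | hi
    · simp [hj]
    · simp [hi]
  -- Raising `ρ_j` lowers `f_j` by one, which compensates for the larger `ε_j`.
  refine ⟨D, fun c => ρ c + if c = j then 1 else 0, h.dom, h.nonneg, ?_, ?_, ?_, ?_, ?_⟩
  · intro i
    have := h.upperLeft i
    split_ifs <;> linarith
  · intro i
    have := h.upperRight i
    split_ifs <;> linarith
  · intro i
    have := h.lowerLeft i
    rw [hε]
    simp only [Subtype.ext_iff]
    linarith
  · intro i
    have := h.lowerRight i
    rw [hε]
    simp only [Subtype.ext_iff]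
    linarith
  · intro v
    rw [Finsupp.add_apply, Nat.cast_add, h.exponent, expo_apply, ← Finset.sum_add_distrib]
    refine Finset.sum_congr rfl fun c _ => ?_
    simp only [mult, Finset.mem_singleton]
    split_ifs <;> simp_all

/-- Positivity is preserved by the second component of the map in the mapping cone. -/
theorem IsPositivePair.cone_below {H : MarkedGrid V m} (hH : H.IsSparse) {x : Gen m} {N : V →₀ ℕ}
    {y : H.EGen} (h : H.IsPositivePair x N y) (j : H.Z) (hj : y.2 j = 0) :
    H.IsPositivePair x (N + H.expo {H.below j}) (y.1, Function.update y.2 j 1) := by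
  rw [isPositivePair_iff] at h ⊢
  obtain ⟨D, ρ, h⟩ := h
  have hε : ∀ i : H.Z, (((Function.update y.2 j 1 i : Fin 2) : ℕ) : ℤ) =
      ((y.2 i : ℕ) : ℤ) + if i = j then 1 else 0 := by
    intro i
    rcases eq_or_ne i j with rfl | hi
    · simp [hj]
    · simp [hi]
  have hrow : ∀ i : H.Z, H.O i ≠ (finRotate m).symm (H.O j) := fun i =>
    (hH.symm_O_ne i.2 j.2).symm
  have hrow' : ∀ i : H.Z, (finRotate m).symm (H.O i) = (finRotate m).symm (H.O j) ↔ i = j :=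
    fun i => by
      rw [(finRotate m).symm.injective.eq_iff, H.O.injective.eq_iff, Subtype.ext_iff]
  have hbelow : ∀ c, H.O c = (finRotate m).symm (H.O j) ↔ c = H.below j := fun c => by
    rw [below, ← Equiv.eq_symm_apply]
  -- The full row below `j` is added. By sparsity it raises only `c_j` and `d_j` among the
  -- multiplicities around the `p_i`, and its `O` is unmarked.
  refine ⟨fun c r => D c r + if r = (finRotate m).symm (H.O j) then 1 else 0, ρ, ?_, ?_, ?_,
    h.upperRight, ?_, ?_, ?_⟩
  · intro c r
    have := h.dom c r
    dsimp only
    linarith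
  · intro c r
    have := h.nonneg c r
    split_ifs <;> linarith
  · intro i
    have := h.upperLeft i
    simp only [hrow]
    simpa using this
  · intro i
    have := h.lowerLeft i
    rw [hε]
    simp only [hrow, hrow', if_false]
    linarith
  · intro i
    have := h.lowerRight i
    rw [hε]
    simp only [hrow, hrow', if_false]
    linarith
  · intro v
    rw [Finsupp.add_apply, Nat.cast_add, h.exponent, expo_apply, ← Finset.sum_add_distrib]
    refine Finset.sum_congr rfl fun c _ => ?_
    have : c ∈ H.Z → c ≠ H.below j := fun hc e => hrow ⟨c, hc⟩ ((hbelow c).2 e)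
    simp only [mult, Finset.mem_singleton, hbelow]
    split_ifs <;> simp_all

/-- Positivity is preserved when the two points of `x` on the circles bounding a marked column
are interchanged, unless a destabilization point gets lost. -/
theorem IsPositivePair.flip {H : MarkedGrid V m} (hH : H.IsSparse) {x : Gen m} {N : V →₀ ℕ}
    {y : H.EGen} (h : H.IsPositivePair x N y) {j : Fin m} (hj : j ∈ H.Z)
    (hx : x (finRotate m j) ≠ H.O j) :
    H.IsPositivePair (x * Equiv.swap j (finRotate m j)) N y := by
  rw [isPositivePair_iff] at h ⊢
  obtain ⟨D, ρ, h⟩ := h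
  have hrot := hH.finRotate_ne hj
  have hyj := y.1.2 j hj
  -- The arc ending at `p_j` is nonempty, so it covers the last row below `p_j`. This is where `hx`
  -- enters.
  have hu : ind (x (finRotate m j)) (H.O j) ((finRotate m).symm (H.O j)) = 1 := by
    rw [ind_pred, ind_right, if_pos rfl, if_neg hx.symm]; ring
  have hdom := h.dom j (H.O j)
  rw [if_pos hyj] at hdom
  have hxj : (0 : ℤ) ≤ if x j = H.O j then 1 else 0 := by split_ifs <;> simp
  have hi : ∀ i : H.Z, i.1 ≠ j → ∀ s, flipDomain D j (x (finRotate m j)) (H.O j) i s = D i s :=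
    fun i hij s => flipDomain_of_ne _ hij _ _ _
  have hi' : ∀ i : H.Z, ∀ s, flipDomain D j (x (finRotate m j)) (H.O j)
      ((finRotate m).symm i) s = D ((finRotate m).symm i) s :=
    fun i s => flipDomain_of_ne _ (hH.symm_ne hj i.2) _ _ _
  -- At `p_j` the new `b` is the old `a`, and the new `d` is the old `c + 1`. Both lower conditions
  -- become `c ≥ a - ρ + ε - 1`, which follows from `a + d - b - c ≤ 1` and the old condition on
  -- `d`.
  refine ⟨flipDomain D j (x (finRotate m j)) (H.O j), ρ, flipDomain_isDomain h.dom hrot hyj,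
    flipDomain_nonneg h.nonneg _ _ _, ?_, h.upperRight, ?_, ?_, ?_⟩
  · intro i
    have := h.upperLeft i
    have h0 := h.upperRight i
    rw [hi']
    rcases eq_or_ne i.1 j with hij | hij
    · rw [hij] at this h0 ⊢
      rw [flipDomain_self, ind_right]
      linarith
    · rw [hi i hij]
      exact this
  · intro i
    rw [hi']
    rcases eq_or_ne i.1 j with hij | hij
    · have := h.lowerRight i
      rw [hij] at this ⊢
      rw [flipDomain_self, ind_right]
      linarith
    · rw [hi i hij]
      exact h.lowerLeft i
  · intro i
    rcases eq_or_ne i.1 j with hij | hij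
    · have := h.lowerRight i
      rw [hij] at this ⊢
      rw [flipDomain_self, flipDomain_self, ind_right, hu]
      linarith
    · rw [hi i hij, hi i hij]
      exact h.lowerRight i
  · intro v
    rw [h.exponent]
    refine Finset.sum_congr rfl fun c _ => ?_
    unfold mult
    split_ifs with h1 h2
    · rfl
    · rw [flipDomain_of_ne _ (fun h' : c = j => h2 (h'.symm ▸ hj))]
    · rfl

/-- The index of a critical positive pair is nonnegative. -/
theorem IsPositivePair.index_nonneg {H : MarkedGrid V m} (hH : H.IsSparse) {x : Gen m} {N : V →₀ ℕ}
    {y : H.EGen} (h : H.IsPositivePair x N y)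
    (hx : ∀ j ∈ H.Z, x j = H.O j ∨ x (finRotate m j) = H.O j) : 0 ≤ H.index x N y := by
  rw [isPositivePair_iff] at h
  obtain ⟨D, ρ, h⟩ := h
  set ε : Fin m → ℤ := fun c => if hc : c ∈ H.Z then ((y.2 ⟨c, hc⟩ : ℕ) : ℤ) else 0 with hε
  have hεj : ∀ j : H.Z, ε j = ((y.2 j : ℕ) : ℤ) := fun j => by simp [hε]
  -- The choice of `θ` is the negative of what `j` contributes to the index through `ε` and `ρ`. If
  -- `x` contains `p_j`, adding the bounds on `a` and `d` gives it; otherwise the bound on `d` and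
  -- `ρ ≥ 0` do.
  have key := critical_bound hH y.1.2 _ x D (fun j => ε j - 2 * ρ j) rfl h.dom h.nonneg
    (fun j hj => by
      have h1 := h.upperLeft ⟨j, hj⟩
      have h2 := h.upperRight ⟨j, hj⟩
      have h4 := h.lowerRight ⟨j, hj⟩
      rw [← hεj] at h4
      dsimp only at *
      rcases hx j hj with h' | h'
      · exact Or.inl ⟨h', by linarith⟩
      · exact Or.inr ⟨h', by linarith⟩)
  have hsum : ∑ j : H.Z, ((y.2 j : ℕ) : ℤ) = ∑ j ∈ H.Z, ε j := by
    rw [← Finset.sum_coe_sort H.Z]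
    exact Finset.sum_congr rfl fun j _ => (hεj j).symm
  have hdeg : ∑ c, H.mult D ρ c =
      ∑ c, (if c ∈ H.Z then 0 else D c (H.O c)) + ∑ j ∈ H.Z, ρ j := by
    rw [← Finset.univ_inter H.Z, ← Finset.sum_ite_mem, ← Finset.sum_add_distrib]
    refine Finset.sum_congr rfl fun c _ => ?_
    simp only [Finset.univ_inter, mult]
    split_ifs <;> simp
  rw [Finset.sum_sub_distrib, ← Finset.mul_sum] at key
  unfold index
  rw [degree_eq_sum_mult h, hdeg, hsum]
  linarith

/-! ### Gradings that make the matching acyclic. -/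

/-- The grid with the `O`'s of the columns `c` and `c'` exchanged. -/
def swapO (H : MarkedGrid V m) (c c' : Fin m) : MarkedGrid V m where
  O := H.O * Equiv.swap c c'
  var := H.var
  Z := H.Z

/-- A grading that is raised by a rectangle without `O`'s in front according to the number of
squares of the rectangle in unmarked rows and columns. -/
def areaGrading (H : MarkedGrid V m) (x : Gen m) : ℤ :=
  ∑ c ∈ H.Zᶜ, ∑ c' ∈ H.Zᶜ, (H.maslov x - (H.swapO c c').maslov x)

/-- Both Maslov gradings drop by one minus twice the number of `O`'s in the rectangle, so their
difference isolates the `O`'s of the modified grid. -/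
theorem areaGrading_rect {H : MarkedGrid V m} {x : Gen m} {p : Fin m × Fin m}
    (hp : p ∈ emptyRects x) (hO : H.rectO x p = ∅) :
    H.areaGrading x - H.areaGrading (x * Equiv.swap p.1 p.2) =
      ∑ c ∈ H.Zᶜ, ∑ c' ∈ H.Zᶜ, 2 * (((H.swapO c c').rectO x p).card : ℤ) := by
  simp only [emptyRects, Finset.mem_filter, Finset.mem_univ, true_and] at hp
  have key : ∀ H' : MarkedGrid V m, H'.maslov x - H'.maslov (x * Equiv.swap p.1 p.2) =
      1 - 2 * ((H'.rectO x p).card : ℤ) := fun H' => by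
    simpa using H'.maslov_rect hp.1 ∅ (by simp) (by simp) (fun c hc _ => hp.2 c hc) (by simp)
  have h0 := key H
  rw [hO] at h0
  simp only [areaGrading, ← Finset.sum_sub_distrib]
  refine Finset.sum_congr rfl fun c _ => Finset.sum_congr rfl fun c' _ => ?_
  have h1 := key (H.swapO c c')
  simp only [Finset.card_empty, Nat.cast_zero] at h0
  linarith

theorem areaGrading_le {H : MarkedGrid V m} {x : Gen m} {p : Fin m × Fin m}
    (hp : p ∈ emptyRects x) (hO : H.rectO x p = ∅) :
    H.areaGrading (x * Equiv.swap p.1 p.2) ≤ H.areaGrading x := by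
  have := areaGrading_rect hp hO
  have h2 : (0 : ℤ) ≤ ∑ c ∈ H.Zᶜ, ∑ c' ∈ H.Zᶜ, 2 * (((H.swapO c c').rectO x p).card : ℤ) :=
    Finset.sum_nonneg fun c _ => Finset.sum_nonneg fun c' _ => by positivity
  linarith

/-- Exchanging the `O`'s of `c` and `c'` puts one in the square `(c, O c')`. If this square lay in
the rectangle, the grading would drop. -/
theorem areaGrading_eq {H : MarkedGrid V m} {x : Gen m} {p : Fin m × Fin m}
    (hp : p ∈ emptyRects x) (hO : H.rectO x p = ∅)
    (h : H.areaGrading (x * Equiv.swap p.1 p.2) = H.areaGrading x) {c c' : Fin m} (hc : c ∉ H.Z)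
    (hc' : c' ∉ H.Z) (h1 : c ∈ cyclicIco p.1 p.2) :
    H.O c' ∉ cyclicIco (x p.1) (x p.2) := by
  intro h2
  have h3 := areaGrading_rect hp hO
  rw [h, sub_self] at h3
  have h4 : (0 : ℤ) < ∑ c ∈ H.Zᶜ, ∑ c' ∈ H.Zᶜ, 2 * (((H.swapO c c').rectO x p).card : ℤ) := by
    refine Finset.sum_pos' (fun c _ => Finset.sum_nonneg fun c' _ => by positivity)
      ⟨c, Finset.mem_compl.2 hc, Finset.sum_pos' (fun c' _ => by positivity)
        ⟨c', Finset.mem_compl.2 hc', ?_⟩⟩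
    have hOc : (H.swapO c c').O c = H.O c' := by
      rw [swapO, Equiv.Perm.mul_apply, Equiv.swap_apply_left]
    have : 0 < ((H.swapO c c').rectO x p).card :=
      Finset.card_pos.2 ⟨c, Finset.mem_filter.2 ⟨Finset.mem_univ _, h1, hOc.symm ▸ h2⟩⟩
    omega
  omega

theorem cyclicIco_thin {S : Set (Fin m)} (hS : ∀ i ∈ S, finRotate m i ∉ S) {a b : Fin m}
    (hab : a ≠ b) (h : ∀ c ∈ cyclicIco a b, c ∈ S) : a ∈ S ∧ b = finRotate m a := by
  have ha : a ∈ S := h a (ind_eq_one_iff.1 (ind_left hab))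
  refine ⟨ha, ?_⟩
  by_contra hb
  have h1 : ind a b (finRotate m a) = 0 :=
    ind_eq_zero_iff.2 fun h' => hS a ha (h _ h')
  have h2 := ind_succ a b a
  have h3 := ind_nonneg a b (finRotate m a)
  rw [ind_left hab, h1, if_neg (Ne.symm hb)] at h2
  split_ifs at h2 <;> omega

/-- The number of unmarked columns between the marked column `j` and the circle `t`. -/
def columnDist (H : MarkedGrid V m) (j t : Fin m) : ℤ := ∑ c ∈ H.Zᶜ, ind (finRotate m j) t c

/-- Crossing a marked column does not change a count of unmarked columns, unless it is the column
where the count starts. -/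
theorem columnDist_swap {H : MarkedGrid V m} {i j : Fin m} (hj : j ∈ H.Z)
    (hrot : finRotate m j ≠ j) (t : Fin m) (h : i ≠ j ∨ (t ≠ j ∧ t ≠ finRotate m j)) :
    H.columnDist i (Equiv.swap j (finRotate m j) t) = H.columnDist i t := by
  by_cases ht : t ≠ j ∧ t ≠ finRotate m j
  · rw [Equiv.swap_apply_of_ne_of_ne ht.1 ht.2]
  have hij := h.resolve_right ht
  have key : H.columnDist i (finRotate m j) = H.columnDist i j := by
    refine Finset.sum_congr rfl fun c hc => ?_
    rw [ind_add (a := j), ind_finRotate hrot, if_neg, add_zero]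
    · rintro rfl; exact Finset.mem_compl.1 hc hj
    · rw [Equiv.symm_apply_apply, ind_finRotate hrot, if_neg hij]
  rcases eq_or_ne t j with rfl | ht'
  · rw [Equiv.swap_apply_left, key]
  · obtain rfl : t = finRotate m j := by
      by_contra h'
      exact ht ⟨ht', h'⟩
    rw [Equiv.swap_apply_right, key]

/-- A secondary grading, lowered by thin rectangles in marked rows. -/
def rowGrading (H : MarkedGrid V m) (x : Gen m) : ℤ := ∑ j ∈ H.Z, H.columnDist j (x.symm (H.O j))

theorem mul_swap_symm_apply (x : Gen m) (a b r : Fin m) :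
    (x * Equiv.swap a b).symm r = Equiv.swap a b (x.symm r) := by
  rw [Equiv.symm_apply_eq, Equiv.Perm.mul_apply, Equiv.swap_apply_self, Equiv.apply_symm_apply]

/-- The behaviour of the gradings under empty rectangles without `O`'s. -/
theorem grading_trichotomy {H : MarkedGrid V m} (hH : H.IsSparse) {x : Gen m} {p : Fin m × Fin m}
    (hp : p ∈ emptyRects x) (hO : H.rectO x p = ∅) :
    H.areaGrading (x * Equiv.swap p.1 p.2) < H.areaGrading x ∨
    H.areaGrading (x * Equiv.swap p.1 p.2) = H.areaGrading x ∧
      H.rowGrading x < H.rowGrading (x * Equiv.swap p.1 p.2) ∨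
    H.areaGrading (x * Equiv.swap p.1 p.2) = H.areaGrading x ∧
      H.rowGrading x = H.rowGrading (x * Equiv.swap p.1 p.2) ∧
      ∃ j ∈ H.Z, p = (j, finRotate m j) ∧ x j ≠ H.O j ∧ x (finRotate m j) ≠ H.O j := by
  rcases (areaGrading_le hp hO).lt_or_eq with h | h
  · exact Or.inl h
  refine Or.inr ?_
  simp only [h, true_and]
  have hne : p.1 ≠ p.2 := by
    simp only [emptyRects, Finset.mem_filter, Finset.mem_univ, true_and] at hp
    exact hp.1
  have hfree : ∀ c, c ∈ cyclicIco p.1 p.2 → H.O c ∉ cyclicIco (x p.1) (x p.2) := by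
    intro c h1 h2
    have : c ∈ H.rectO x p := by simp [rectO, h1, h2]
    simp [hO] at this
  obtain ⟨a, b⟩ := p
  simp only at *
  by_cases hcol : ∀ c ∈ cyclicIco a b, c ∈ H.Z
  · obtain ⟨hj, rfl⟩ := cyclicIco_thin (S := (H.Z : Set (Fin m)))
      (fun i hi => hH.finRotate_notMem hi) hne hcol
    have hrot := hH.finRotate_ne hj
    have hxa : x a ≠ H.O a := by
      intro h1
      refine hfree a (ind_eq_one_iff.1 (ind_left hne)) (ind_eq_one_iff.1 ?_)
      rw [← h1]
      exact ind_left fun h2 => hne (x.injective h2)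
    have hterm : ∀ i ∈ H.Z, i ≠ a → H.columnDist i (x.symm (H.O i)) =
        H.columnDist i ((x * Equiv.swap a (finRotate m a)).symm (H.O i)) := by
      intro i _ hia
      rw [mul_swap_symm_apply, columnDist_swap hj hrot _ (Or.inl hia)]
    -- In this case the point at the height of the `O` moves from distance zero back across column
    -- `a`, to the largest possible distance.
    by_cases hxa' : x (finRotate m a) = H.O a
    · left
      refine Finset.sum_lt_sum (fun i hi => ?_) ⟨a, hj, ?_⟩
      · rcases eq_or_ne i a with rfl | hia
        · rw [← hxa', Equiv.symm_apply_apply]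
          simp only [columnDist, ind_self, Finset.sum_const_zero]
          exact Finset.sum_nonneg fun c _ => ind_nonneg _ _ _
        · exact (hterm i hi hia).le
      · rw [← hxa', mul_swap_symm_apply, Equiv.symm_apply_apply, Equiv.swap_apply_right]
        simp only [columnDist, ind_self, Finset.sum_const_zero]
        refine Finset.sum_pos' (fun c _ => ind_nonneg _ _ _)
          ⟨finRotate m a, Finset.mem_compl.2 (hH.finRotate_notMem hj), ?_⟩
        rw [ind_left hrot]
        exact one_pos
    · right
      refine ⟨Finset.sum_congr rfl fun i hi => ?_, a, hj, rfl, hxa, hxa'⟩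
      rcases eq_or_ne i a with rfl | hia
      · rw [mul_swap_symm_apply, columnDist_swap hj hrot _ (Or.inr ⟨?_, ?_⟩)]
        · rw [Ne, Equiv.symm_apply_eq]; exact fun h => hxa h.symm
        · rw [Ne, Equiv.symm_apply_eq]; exact fun h => hxa' h.symm
      · exact hterm i hi hia
  · left
    push Not at hcol
    obtain ⟨c₀, hc₀, hc₀Z⟩ := hcol
    have hrow : ∀ r ∈ cyclicIco (x a) (x b), H.O.symm r ∈ H.Z := by
      intro r hr
      by_contra hrZ
      refine areaGrading_eq hp hO h hc₀Z hrZ hc₀ ?_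
      rwa [Equiv.apply_symm_apply]
    obtain ⟨hj, hxb⟩ := cyclicIco_thin (S := {r | H.O.symm r ∈ H.Z})
      (fun i hi hi' => (hH _ hi _ hi').2 (by simp only [Equiv.apply_symm_apply]))
      (fun h => hne (x.injective h)) hrow
    set j := H.O.symm (x a) with hjdef
    have hxa : x a = H.O j := by rw [hjdef, Equiv.apply_symm_apply]
    have hjZ : j ∈ H.Z := hj
    -- The rectangle fills part of the row of the `O` in column `j` but avoids that `O`. So the
    -- point moving along its lower edge goes away from column `j` without passing it.
    have hjab : ind a b j = 0 := ind_eq_zero_iff.2 fun h1 => hfree j h1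
      (hxa ▸ ind_eq_one_iff.1 (ind_left fun h2 => hne (x.injective h2)))
    refine Finset.sum_lt_sum (fun i hi => ?_) ⟨j, hjZ, ?_⟩
    · rcases eq_or_ne i j with hij | hij
      · rw [hij, mul_swap_symm_apply, ← hxa, Equiv.symm_apply_apply, Equiv.swap_apply_left]
        refine Finset.sum_le_sum fun c _ => ?_
        rw [ind_add (a := a) (b := b) (by rwa [Equiv.symm_apply_apply])]
        linarith [ind_nonneg a b c]
      · rw [mul_swap_symm_apply, Equiv.swap_apply_of_ne_of_ne]
        · rw [Ne, Equiv.symm_apply_eq, hxa]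
          exact fun h => hij (H.O.injective h)
        · rw [Ne, Equiv.symm_apply_eq, hxb, hxa]
          exact (hH j hjZ i hi).2
    · rw [mul_swap_symm_apply, ← hxa, Equiv.symm_apply_apply, Equiv.swap_apply_left]
      refine Finset.sum_lt_sum (fun c _ => ?_) ⟨c₀, Finset.mem_compl.2 hc₀Z, ?_⟩
      · rw [ind_add (a := a) (b := b) (by rwa [Equiv.symm_apply_apply])]
        linarith [ind_nonneg a b c]
      · rw [ind_add (a := a) (b := b) (by rwa [Equiv.symm_apply_apply]), ind_eq_one_iff.2 hc₀]
        linarith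

/-! ### The differential on pairs. -/

theorem pair_apply (H : MarkedGrid V m) (x : Gen m) (N : V →₀ ℕ) (y y' : H.EGen) (x' : Gen m) :
    H.pair x N y y' x' =
      if y = y' ∧ x = x' then (MvPowerSeries.monomial N (1 : ZMod 2)) else 0 := by
  rw [pair, Matrix.single_apply]

theorem prod_X_eq (H : MarkedGrid V m) (s : Finset (Fin m)) :
    ∏ c ∈ s, (MvPowerSeries.X (H.var c) : Coeff V) = MvPowerSeries.monomial (H.expo s) 1 := by
  classical
  induction s using Finset.induction_on with
  | empty => simp [expo]
  | insert c s hc ih =>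
    rw [Finset.prod_insert hc, ih, MvPowerSeries.X, MvPowerSeries.monomial_mul_monomial, expo, expo,
      Finset.sum_insert hc, one_mul]

theorem X_eq_expo (H : MarkedGrid V m) (c : Fin m) :
    (MvPowerSeries.X (H.var c) : Coeff V) = MvPowerSeries.monomial (H.expo {c}) 1 := by
  simp [expo, MvPowerSeries.X]

/-- Precomposition runs rectangles backwards; as swaps are involutions, the start of a rectangle
ending at `x` is again `x * swap`. -/
theorem pair_mul_boundary (H : MarkedGrid V m) (x : Gen m) (N : V →₀ ℕ) (y : H.EGen) :
    H.pair x N y * H.boundary =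
      ∑ p : Fin m × Fin m with p ∈ emptyRects (x * Equiv.swap p.1 p.2),
        H.pair (x * Equiv.swap p.1 p.2)
          (N + H.expo (H.rectO (x * Equiv.swap p.1 p.2) p)) y := by
  ext1 y' x'
  have hswap : ∀ p : Fin m × Fin m, x' * Equiv.swap p.1 p.2 = x ↔ x * Equiv.swap p.1 p.2 = x' :=
    fun p => by rw [← eq_mul_inv_iff_mul_eq, Equiv.swap_inv, eq_comm]
  rw [Matrix.sum_apply, Matrix.mul_apply]
  simp only [pair_apply, ite_mul, zero_mul]
  rcases eq_or_ne y y' with rfl | hy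
  · simp only [true_and, Finset.sum_ite_eq, Finset.mem_univ, if_true, boundary, Matrix.of_apply,
      prod_X_eq]
    rw [← Finset.sum_filter, Finset.mul_sum]
    refine Finset.sum_congr ?_ fun p hp => ?_
    · ext p
      simp only [Finset.mem_filter, Finset.mem_univ, true_and, hswap]
      constructor
      · rintro ⟨h1, h2⟩; exact ⟨h2.symm ▸ h1, h2⟩
      · rintro ⟨h1, h2⟩; exact ⟨h2 ▸ h1, h2⟩
    · rw [(Finset.mem_filter.1 hp).2, MvPowerSeries.monomial_mul_monomial, one_mul]
  · simp [hy]

theorem notMem_of_mem_destabRects {H : MarkedGrid V m} {y : Gen m} {p : Fin m × Fin m}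
    (hp : p ∈ H.destabRects y) : p.1 ∉ H.Z ∧ p.2 ∉ H.Z := by
  simp only [destabRects, Finset.mem_filter, Finset.mem_univ, true_and] at hp
  exact ⟨hp.2.1, hp.2.2.1⟩

theorem eBoundary_mul_pair (H : MarkedGrid V m) (x : Gen m) (N : V →₀ ℕ) (y : H.EGen) :
    H.eBoundary * H.pair x N y =
      ∑ p : {p // p ∈ H.destabRects y.1.1},
        H.pair x (N + H.expo (H.rectO y.1.1 p \ H.Z)) (H.swapE y p
          (notMem_of_mem_destabRects p.2).1 (notMem_of_mem_destabRects p.2).2) +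
      ∑ j : H.Z, if y.2 j = 0 then
        H.pair x (N + H.expo {j.1}) (y.1, Function.update y.2 j 1) -
          H.pair x (N + H.expo {H.below j}) (y.1, Function.update y.2 j 1) else 0 := by
  ext1 y' x'
  rw [Matrix.add_apply, Matrix.sum_apply, Matrix.sum_apply, Matrix.mul_apply]
  have hite : ∀ j : H.Z, (if y.2 j = 0 then
        H.pair x (N + H.expo {j.1}) (y.1, Function.update y.2 j 1) -
          H.pair x (N + H.expo {H.below j}) (y.1, Function.update y.2 j 1) else 0) y' x' =
      if y.2 j = 0 then
        H.pair x (N + H.expo {j.1}) (y.1, Function.update y.2 j 1) y' x' -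
          H.pair x (N + H.expo {H.below j}) (y.1, Function.update y.2 j 1) y' x' else 0 := by
    intro j
    split_ifs <;> simp
  simp only [hite, pair_apply]
  rcases eq_or_ne x x' with rfl | hx
  · simp only [and_true, mul_ite, mul_zero, Finset.sum_ite_eq, Finset.mem_univ, if_true]
    rw [eBoundary, Matrix.of_apply, add_mul]
    congr 1
    · rw [Finset.sum_coe_sort_eq_attach, ← Finset.sum_filter, Finset.sum_mul, Finset.sum_filter,
        Finset.sum_filter, ← Finset.sum_attach]
      refine Finset.sum_congr rfl fun p _ => ?_
      have : (H.swapE y p (notMem_of_mem_destabRects p.2).1 (notMem_of_mem_destabRects p.2).2 = y') ↔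
          (y.1.1 * Equiv.swap p.1.1 p.1.2 = y'.1.1 ∧ y'.2 = y.2) := by
        rw [Prod.ext_iff, Subtype.ext_iff, eq_comm (a := y'.2)]
        rfl
      simp only [this]
      split_ifs
      · rw [prod_X_eq, MvPowerSeries.monomial_mul_monomial, one_mul, add_comm]
      · rfl
    · rw [Finset.sum_mul]
      refine Finset.sum_congr rfl fun j _ => ?_
      have : ((y.1, Function.update y.2 j 1) = y') ↔
          (y'.1 = y.1 ∧ y'.2 = Function.update y.2 j 1) := by
        rw [Prod.ext_iff, eq_comm (a := y'.1), eq_comm (a := y'.2)]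
      simp only [this, X_eq_expo, ite_mul, zero_mul, sub_mul, MvPowerSeries.monomial_mul_monomial,
        one_mul, add_comm _ N]
      split_ifs <;> simp_all
  · simp [hx]

theorem homD_pair (H : MarkedGrid V m) (x : Gen m) (N : V →₀ ℕ) (y : H.EGen) :
    H.homD (H.pair x N y) =
      (∑ p : Fin m × Fin m with p ∈ emptyRects (x * Equiv.swap p.1 p.2),
        H.pair (x * Equiv.swap p.1 p.2)
          (N + H.expo (H.rectO (x * Equiv.swap p.1 p.2) p)) y) +
      ((∑ p : {p // p ∈ H.destabRects y.1.1},
        H.pair x (N + H.expo (H.rectO y.1.1 p \ H.Z)) (H.swapE y p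
          (notMem_of_mem_destabRects p.2).1 (notMem_of_mem_destabRects p.2).2)) +
      ∑ j : H.Z, if y.2 j = 0 then
        H.pair x (N + H.expo {j.1}) (y.1, Function.update y.2 j 1) -
          H.pair x (N + H.expo {H.below j}) (y.1, Function.update y.2 j 1) else 0) := by
  rw [← pair_mul_boundary, ← eBoundary_mul_pair]
  rfl

theorem index_prepend (H : MarkedGrid V m) {x x' : Gen m} (N : V →₀ ℕ) (y : H.EGen)
    {p : Fin m × Fin m} (hp : p ∈ emptyRects x') (hx : x' * Equiv.swap p.1 p.2 = x) :
    H.index x' (N + H.expo (H.rectO x' p)) y = H.index x N y + 1 := by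
  simp only [emptyRects, Finset.mem_filter, Finset.mem_univ, true_and] at hp
  have h := H.maslov_rect hp.1 ∅ (by simp) (by simp) (fun c hc _ => hp.2 c hc) (by simp)
  rw [hx, Finset.sdiff_empty] at h
  unfold index
  rw [map_add, degree_expo]
  push_cast
  linarith

theorem index_append (H : MarkedGrid V m) (x : Gen m) (N : V →₀ ℕ) (y : H.EGen)
    {p : Fin m × Fin m} (hp : p ∈ H.destabRects y.1.1) :
    H.index x (N + H.expo (H.rectO y.1.1 p \ H.Z)) (H.swapE y p
      (notMem_of_mem_destabRects hp).1 (notMem_of_mem_destabRects hp).2) = H.index x N y + 1 := by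
  have hp' := hp
  simp only [destabRects, Finset.mem_filter, Finset.mem_univ, true_and] at hp'
  have h := H.maslov_rect hp'.1 H.Z hp'.2.1 hp'.2.2.1 hp'.2.2.2 y.1.2
  unfold index
  rw [map_add, degree_expo]
  simp only [swapE]
  push_cast
  linarith

theorem index_cone (H : MarkedGrid V m) (x : Gen m) (N : V →₀ ℕ) (y : H.EGen) (c : Fin m) {j : H.Z}
    (hj : y.2 j = 0) :
    H.index x (N + H.expo {c}) (y.1, Function.update y.2 j 1) = H.index x N y + 1 := by
  have h : ∑ i : H.Z, (((Function.update y.2 j 1 i : Fin 2) : ℕ) : ℤ) =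
      ∑ i : H.Z, ((y.2 i : ℕ) : ℤ) + 1 := by
    have : ∀ i : H.Z, (((Function.update y.2 j 1 i : Fin 2) : ℕ) : ℤ) =
        ((y.2 i : ℕ) : ℤ) + if i = j then 1 else 0 := by
      intro i
      rcases eq_or_ne i j with rfl | hi
      · simp [hj]
      · simp [hi]
    simp only [this, Finset.sum_add_distrib, Finset.sum_ite_eq', Finset.mem_univ, if_true]
  unfold index
  rw [map_add, degree_expo]
  simp only [h, Finset.card_singleton]
  push_cast
  linarith

/-! ### Successive rectangles and their total index. -/

theorem cyclicIco_rotate {a b c : Fin m} (hab : a ≠ b) (hbc : b ≠ c) (hac : a ≠ c) :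
    b ∈ cyclicIco a c ↔ c ∈ cyclicIco b a := by
  simp only [ne_eq, Fin.ext_iff] at hab hbc hac
  simp only [mem_cyclicIco, Fin.le_def, Fin.lt_def]
  omega

theorem cyclicIco_reverse {a b c : Fin m} (hbc : b ≠ c) (hac : a ≠ c) :
    b ∉ cyclicIco a c ↔ c ∈ cyclicIco a b := by
  simp only [ne_eq, Fin.ext_iff] at hbc hac
  simp only [mem_cyclicIco, Fin.le_def, Fin.lt_def]
  omega

theorem ind_concat {a b c : Fin m} (h : b ∈ cyclicIco a c) (d : Fin m) :
    ind a c d = ind a b d + ind b c d := by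
  simp only [ind, mem_cyclicIco, Fin.le_def, Fin.lt_def] at h ⊢
  split_ifs <;> omega

theorem mem_cyclicIoo {a b c : Fin m} : c ∈ cyclicIoo a b ↔ c ≠ a ∧ c ∈ cyclicIco a b := by
  rw [cyclicIoo, Finset.mem_erase]

theorem right_notMem_cyclicIco (a b : Fin m) : b ∉ cyclicIco a b :=
  ind_eq_zero_iff.1 (ind_right a b)

theorem mem_cyclicIco_compl {a b c : Fin m} (hab : a ≠ b) :
    c ∈ cyclicIco b a ↔ c ∉ cyclicIco a b := by
  rw [← ind_eq_one_iff, ← ind_eq_zero_iff]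
  have := ind_compl hab c
  constructor <;> intro h <;> linarith

/-- The exponent of a rectangle of the destabilized grid. -/
noncomputable def weight (H : MarkedGrid V m) (x : Gen m) (p : Fin m × Fin m) : V →₀ ℕ :=
  H.expo (H.rectO x p \ H.Z)

theorem degree_weight (H : MarkedGrid V m) (x : Gen m) (p : Fin m × Fin m) :
    ((H.weight x p).degree : ℤ) = ∑ c ∈ H.Zᶜ, rectDomain x p c (H.O c) := by
  rw [weight, degree_expo]
  simp only [rectDomain_apply_O, Finset.sum_boole]
  congr 2
  ext c
  simp [and_comm]

theorem weight_add_weight {H : MarkedGrid V m} {x x' y y' : Gen m} {p p' q q' : Fin m × Fin m}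
    (h : ∀ c, rectDomain x p c (H.O c) + rectDomain x' p' c (H.O c) =
      rectDomain y q c (H.O c) + rectDomain y' q' c (H.O c)) :
    H.weight x p + H.weight x' p' = H.weight y q + H.weight y' q' := by
  classical
  ext v
  rw [← Nat.cast_inj (R := ℤ), Finsupp.add_apply, Finsupp.add_apply, Nat.cast_add, Nat.cast_add,
    weight, weight, weight, weight, expo_apply, expo_apply, expo_apply, expo_apply,
    ← Finset.sum_add_distrib, ← Finset.sum_add_distrib]
  refine Finset.sum_congr rfl fun c _ => ?_
  have := h c
  simp only [rectDomain_apply_O] at this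
  simp only [Finset.mem_sdiff]
  split_ifs at * <;> simp_all

theorem mem_destabRects {H : MarkedGrid V m} {x : Gen m} {p : Fin m × Fin m} :
    p ∈ H.destabRects x ↔ p.1 ≠ p.2 ∧ p.1 ∉ H.Z ∧ p.2 ∉ H.Z ∧
      ∀ c ∈ cyclicIoo p.1 p.2, c ∉ H.Z → x c ∉ cyclicIoo (x p.1) (x p.2) := by
  simp [destabRects]

/-- The index of a rectangle is at least one, with equality if and only if it is empty. -/
theorem index_rect (H : MarkedGrid V m) {x : Gen m} (hx : ∀ c ∈ H.Z, x c = H.O c)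
    {p : Fin m × Fin m} (hne : p.1 ≠ p.2) (h1 : p.1 ∉ H.Z) (h2 : p.2 ∉ H.Z) :
    1 ≤ H.maslov x - H.maslov (x * Equiv.swap p.1 p.2) + 2 * (H.weight x p).degree ∧
    (p ∈ H.destabRects x ↔
      H.maslov x - H.maslov (x * Equiv.swap p.1 p.2) + 2 * (H.weight x p).degree = 1) := by
  have hm := H.maslov_sub (rectDomain_isDomain x p)
  -- With all columns but the corners tolerated, any rectangle is allowed. The interior points
  -- outside `H.Z` then measure how far the index exceeds one.
  rw [sum_quad_rectDomain hne {p.1, p.2}ᶜ (by simp) (by simp) ?_ (Or.inl rfl),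
    sum_quad_rectDomain hne {p.1, p.2}ᶜ (by simp) (by simp) ?_ (Or.inr rfl)] at hm
  · have e1 : ∑ c ∈ ({p.1, p.2}ᶜ : Finset (Fin m)), rectDomain x p c (x c) =
        ∑ c ∈ H.Z, rectDomain x p c (H.O c) +
          ∑ c ∈ ({p.1, p.2}ᶜ : Finset (Fin m)) \ H.Z, rectDomain x p c (x c) := by
      rw [← Finset.sum_sdiff (s₁ := H.Z) (s₂ := {p.1, p.2}ᶜ), add_comm]
      · congr 1
        exact Finset.sum_congr rfl fun c hc => by rw [hx c hc]
      · intro c hc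
        simp only [Finset.mem_compl, Finset.mem_insert, Finset.mem_singleton, not_or]
        exact ⟨fun h => h1 (h ▸ hc), fun h => h2 (h ▸ hc)⟩
    have e2 : ∑ c, rectDomain x p c (H.O c) =
        ∑ c ∈ H.Z, rectDomain x p c (H.O c) + ∑ c ∈ H.Zᶜ, rectDomain x p c (H.O c) :=
      (Finset.sum_add_sum_compl _ _).symm
    rw [e1, e2] at hm
    rw [degree_weight]
    have hnn : ∀ c ∈ ({p.1, p.2}ᶜ : Finset (Fin m)) \ H.Z, 0 ≤ rectDomain x p c (x c) :=
      fun c _ => rectDomain_nonneg x p c _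
    have h0 := Finset.sum_nonneg hnn
    have hiff : p ∈ H.destabRects x ↔
        ∑ c ∈ ({p.1, p.2}ᶜ : Finset (Fin m)) \ H.Z, rectDomain x p c (x c) = 0 := by
      rw [Finset.sum_eq_zero_iff_of_nonneg hnn, mem_destabRects]
      constructor
      · rintro ⟨-, -, -, h⟩ c hc
        simp only [Finset.mem_sdiff, Finset.mem_compl, Finset.mem_insert, Finset.mem_singleton,
          not_or] at hc
        by_contra h'
        rw [rectDomain, ← ne_eq, mul_ne_zero_iff, ne_eq, ne_eq, ind_eq_zero_iff, ind_eq_zero_iff,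
          not_not, not_not] at h'
        exact h c (mem_cyclicIoo.2 ⟨hc.1.1, h'.1⟩) hc.2
          (mem_cyclicIoo.2 ⟨fun e => hc.1.1 (x.injective e), h'.2⟩)
      · intro h
        refine ⟨hne, h1, h2, fun c hc hcZ hxc => ?_⟩
        rw [mem_cyclicIoo] at hc hxc
        have hc2 : c ≠ p.2 := by
          rintro rfl; exact right_notMem_cyclicIco _ _ hc.2
        have := h c (by simp [hc.1, hc2, hcZ])
        rw [rectDomain, ind_eq_one_iff.2 hc.2, ind_eq_one_iff.2 hxc.2] at this
        simp at this
    rw [hiff]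
    constructor
    · linarith
    · constructor <;> intro h <;> linarith
  all_goals
    intro c hc hc'
    simp only [Finset.mem_compl, Finset.mem_insert, Finset.mem_singleton, not_not] at hc'
    rcases hc' with rfl | rfl
    · exact absurd rfl (mem_cyclicIoo.1 hc).1
    · exact absurd (mem_cyclicIoo.1 hc).2 (right_notMem_cyclicIco _ _)

theorem swap_fix {H : MarkedGrid V m} {x : Gen m} (hx : ∀ c ∈ H.Z, x c = H.O c)
    {p : Fin m × Fin m} (h1 : p.1 ∉ H.Z) (h2 : p.2 ∉ H.Z) (c : Fin m) (hc : c ∈ H.Z) :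
    (x * Equiv.swap p.1 p.2) c = H.O c := by
  rw [Equiv.Perm.mul_apply, Equiv.swap_apply_of_ne_of_ne (fun h : c = p.1 => h1 (h ▸ hc))
    (fun h : c = p.2 => h2 (h ▸ hc)), hx c hc]

/-- Two successive empty rectangles starting at `x`. -/
def IsRectPair (H : MarkedGrid V m) (x : Gen m) (p q : Fin m × Fin m) : Prop :=
  p ∈ H.destabRects x ∧ q ∈ H.destabRects (x * Equiv.swap p.1 p.2)

/-- The end of two successive rectangles. -/
def pairEnd (x : Gen m) (p q : Fin m × Fin m) : Gen m :=
  x * Equiv.swap p.1 p.2 * Equiv.swap q.1 q.2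

/-- The exponent of two successive rectangles. -/
noncomputable def pairWeight (H : MarkedGrid V m) (x : Gen m) (p q : Fin m × Fin m) : V →₀ ℕ :=
  H.weight x p + H.weight (x * Equiv.swap p.1 p.2) q

open Classical in
/-- The contribution of two successive rectangles to the square of the differential. -/
noncomputable def pairTerm (H : MarkedGrid V m) (x z : Gen m) (p q : Fin m × Fin m) : Coeff V :=
  if H.IsRectPair x p q ∧ pairEnd x p q = z then MvPowerSeries.monomial (H.pairWeight x p q) 1
  else 0

theorem pairTerm_eq_zero {H : MarkedGrid V m} {x : Gen m} (z : Gen m) {p q : Fin m × Fin m}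
    (h : ¬ H.IsRectPair x p q) : H.pairTerm x z p q = 0 := by
  rw [pairTerm, if_neg fun h' => h h'.1]

/-- Whether two successive rectangles are empty depends on their sum only. -/
theorem pairTerm_congr {H : MarkedGrid V m} {x : Gen m} (hx : ∀ c ∈ H.Z, x c = H.O c) (z : Gen m)
    {p q p' q' : Fin m × Fin m} (hp : p.1 ≠ p.2) (hq : q.1 ≠ q.2) (hp' : p'.1 ≠ p'.2)
    (hq' : q'.1 ≠ q'.2) (hZ : ∀ c, (c = p.1 ∨ c = p.2 ∨ c = q.1 ∨ c = q.2) ↔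
      (c = p'.1 ∨ c = p'.2 ∨ c = q'.1 ∨ c = q'.2))
    (hend : pairEnd x p q = pairEnd x p' q')
    (hw : ∀ c, rectDomain x p c (H.O c) + rectDomain (x * Equiv.swap p.1 p.2) q c (H.O c) =
      rectDomain x p' c (H.O c) + rectDomain (x * Equiv.swap p'.1 p'.2) q' c (H.O c)) :
    H.pairTerm x z p q = H.pairTerm x z p' q' := by
  -- Both indices are at least one, so both rectangles are empty exactly when the total index is
  -- two. The total depends only on the ends and the total exponent.
  have key : ∀ p q : Fin m × Fin m, p.1 ≠ p.2 → q.1 ≠ q.2 → (H.IsRectPair x p q ↔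
      (∀ c, (c = p.1 ∨ c = p.2 ∨ c = q.1 ∨ c = q.2) → c ∉ H.Z) ∧
      H.maslov x - H.maslov (pairEnd x p q) + 2 * ((H.pairWeight x p q).degree : ℤ) = 2) := by
    intro p q hp hq
    unfold IsRectPair pairEnd pairWeight
    by_cases hZ : ∀ c, (c = p.1 ∨ c = p.2 ∨ c = q.1 ∨ c = q.2) → c ∉ H.Z
    · have h1 := H.index_rect hx hp (hZ p.1 (by simp)) (hZ p.2 (by simp))
      have h2 := H.index_rect (swap_fix hx (hZ p.1 (by simp)) (hZ p.2 (by simp))) hq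
        (hZ q.1 (by simp)) (hZ q.2 (by simp))
      rw [h1.2, h2.2, map_add]
      push_cast
      constructor
      · rintro ⟨e1, e2⟩; exact ⟨hZ, by linarith⟩
      · rintro ⟨-, e⟩; constructor <;> linarith [h1.1, h2.1]
    · constructor
      · rintro ⟨e1, e2⟩
        refine absurd ?_ hZ
        rw [mem_destabRects] at e1 e2
        rintro c (rfl | rfl | rfl | rfl)
        exacts [e1.2.1, e1.2.2.1, e2.2.1, e2.2.2.1]
      · exact fun h => absurd h.1 hZ
  have hW : H.pairWeight x p q = H.pairWeight x p' q' := weight_add_weight hw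
  have hiff : H.IsRectPair x p q ↔ H.IsRectPair x p' q' := by
    rw [key p q hp hq, key p' q' hp' hq', hend, hW]
    simp only [hZ]
  rw [pairTerm, pairTerm, hW]
  have hiff' : H.IsRectPair x p q ∧ pairEnd x p q = z ↔
      H.IsRectPair x p' q' ∧ pairEnd x p' q' = z := and_congr hiff (by rw [hend])
  by_cases h : H.IsRectPair x p q ∧ pairEnd x p q = z
  · rw [if_pos h, if_pos (hiff'.1 h)]
  · rw [if_neg h, if_neg (mt hiff'.2 h)]

end MarkedGrid

/-! ### Finite sums that cancel in characteristic two. -/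

section SumLemmas

variable {α M : Type*} [Fintype α] [AddCommMonoid M]

theorem sum_split_two [DecidableEq α] {a b : α} (hab : a ≠ b) (f : α → M) :
    ∑ c, f c = f a + f b + ∑ c, if c ≠ a ∧ c ≠ b then f c else 0 := by
  rw [← Finset.sum_filter, ← Finset.add_sum_erase _ _ (Finset.mem_univ a),
    ← Finset.add_sum_erase (Finset.univ.erase a) _ (a := b) (by simp [hab.symm]), add_assoc]
  congr 2
  refine Finset.sum_congr ?_ fun _ _ => rfl
  ext c
  simp [and_comm]

/-- The three parts correspond to pairs of rectangles that share two, one or no corner columns. -/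
theorem sum_split_pairs [DecidableEq α] (t : α → α → α → α → M) (h1 : ∀ a u v, t a a u v = 0)
    (h2 : ∀ a b u, t a b u u = 0) :
    ∑ a, ∑ b, ∑ u, ∑ v, t a b u v =
      ∑ a, ∑ b, (t a b a b + t a b b a) +
      ∑ a, ∑ b, ∑ c, (if a ≠ b ∧ c ≠ a ∧ c ≠ b then
        t a b a c + t a b c b + t a b c a + t a b b c else 0) +
      ∑ a, ∑ b, ∑ u, ∑ v,
        (if a ≠ b ∧ (u ≠ a ∧ u ≠ b) ∧ (v ≠ a ∧ v ≠ b) then t a b u v else 0) := by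
  rw [← Finset.sum_add_distrib, ← Finset.sum_add_distrib]
  refine Finset.sum_congr rfl fun a _ => ?_
  rw [← Finset.sum_add_distrib, ← Finset.sum_add_distrib]
  refine Finset.sum_congr rfl fun b _ => ?_
  by_cases hab : a = b
  · subst hab
    simp [h1]
  simp only [ne_eq, hab, not_false_eq_true, true_and]
  rw [sum_split_two hab (fun u => ∑ v, t a b u v), sum_split_two hab (t a b a),
    sum_split_two hab (t a b b), h2, h2]
  have : ∀ c, (if c ≠ a ∧ c ≠ b then ∑ v, t a b c v else 0) =
      (if c ≠ a ∧ c ≠ b then t a b c a + t a b c b else 0) +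
        ∑ v, if (c ≠ a ∧ c ≠ b) ∧ (v ≠ a ∧ v ≠ b) then t a b c v else 0 := by
    intro c
    by_cases hc : c ≠ a ∧ c ≠ b
    · rw [if_pos hc, if_pos hc, sum_split_two hab (t a b c)]
      congr 1
      exact Finset.sum_congr rfl fun v _ => by simp only [eq_true hc, true_and]
    · simp [hc]
  simp only [this, Finset.sum_add_distrib]
  have : ∀ c, (if ¬c = a ∧ ¬c = b then t a b a c + t a b c b + t a b c a + t a b b c else 0) =
      (if c ≠ a ∧ c ≠ b then t a b a c else 0) + (if c ≠ a ∧ c ≠ b then t a b b c else 0) +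
      (if c ≠ a ∧ c ≠ b then t a b c a + t a b c b else 0) := by
    intro c
    simp only [← ne_eq]
    by_cases hc : c ≠ a ∧ c ≠ b
    · simp only [if_pos hc]
      abel
    · simp only [if_neg hc, add_zero]
  simp only [this, Finset.sum_add_distrib]
  simp only [ne_eq]
  abel

theorem sum_rotate (f : α → α → α → M) : ∑ a, ∑ b, ∑ c, f b c a = ∑ a, ∑ b, ∑ c, f a b c := by
  rw [Finset.sum_comm]
  refine Finset.sum_congr rfl fun b _ => ?_
  rw [Finset.sum_comm]

theorem sum_reflect (f : α → α → α → M) : ∑ a, ∑ b, ∑ c, f a c b = ∑ a, ∑ b, ∑ c, f a b c :=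
  Finset.sum_congr rfl fun _ _ => Finset.sum_comm

theorem sum_reverse (f : α → α → α → M) : ∑ a, ∑ b, ∑ c, f c b a = ∑ a, ∑ b, ∑ c, f a b c := by
  rw [← sum_rotate f]
  exact sum_reflect fun a b c => f b c a

theorem sum_symm_eq_zero (h2 : ∀ x : M, x + x = 0) (f : α → α → M) (hs : ∀ p q, f p q = f q p)
    (h0 : ∀ p, f p p = 0) : ∑ p, ∑ q, f p q = 0 := by
  rw [← Finset.sum_product']
  refine Finset.sum_involution (fun p _ => (p.2, p.1)) ?_ ?_ ?_ ?_
  · intro p _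
    rw [hs p.2 p.1]; exact h2 _
  · rintro ⟨p, q⟩ _ h e
    simp only [Prod.mk.injEq] at e
    rw [e.1] at h
    exact h (h0 _)
  · simp
  · simp

/-- Terms that are indexed by triples of distinct elements in cyclic order, and that cancel in
pairs. -/
theorem sum_triples_eq_zero (h2 : ∀ x : M, x + x = 0) (X Y : α → α → α → Prop)
    (D : α → α → α → Prop) (hD : ∀ {a b c}, D a b c → D b c a)
    (hD' : ∀ {a b c}, D a b c → D a c b)
    (hX : ∀ {a b c}, D a b c → (X a b c ↔ X b c a))
    (hX' : ∀ {a b c}, D a b c → (¬ X a b c ↔ X a c b))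
    (hY : ∀ {a b c}, D a b c → (Y a b c ↔ Y b c a))
    (hY' : ∀ {a b c}, D a b c → (¬ Y a b c ↔ Y a c b))
    [∀ a b c, Decidable (D a b c)]
    (f₁ f₂ f₃ f₄ : α → α → α → M)
    (z₁ : ∀ {a b c}, D a b c → ¬ Y a b c → f₁ a b c = 0)
    (z₂ : ∀ {a b c}, D a b c → ¬ Y a b c → f₂ a b c = 0)
    (z₃ : ∀ {a b c}, D a b c → ¬ X a b c → f₃ a b c = 0)
    (z₄ : ∀ {a b c}, D a b c → ¬ X a b c → f₄ a b c = 0)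
    (e₁ : ∀ {a b c}, D a b c → X a b c → Y a b c → f₁ a b c = f₃ b c a)
    (e₂ : ∀ {a b c}, D a b c → X a b c → Y a b c → f₂ a b c = f₄ c a b)
    (e₃ : ∀ {a b c}, D a b c → ¬ X a b c → Y a b c → f₁ a b c = f₄ a c b)
    (e₄ : ∀ {a b c}, D a b c → ¬ X a b c → Y a b c → f₂ a b c = f₃ c b a) :
    ∑ a, ∑ b, ∑ c, (if D a b c then f₁ a b c + f₂ a b c + f₃ a b c + f₄ a b c else 0) = 0 := by
  classical
  obtain ⟨u, hdef⟩ : ∃ u : (α → α → α → Prop) → (α → α → α → M) → α → α → α → M,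
      ∀ P f a b c, u P f a b c = if D a b c ∧ P a b c then f a b c else 0 :=
    ⟨fun P f a b c => if D a b c ∧ P a b c then f a b c else 0, fun _ _ _ _ _ => rfl⟩
  have hu' : ∀ {P Q : α → α → α → Prop} {f g : α → α → α → M} {a b c a' b' c' : α},
      (D a b c ∧ P a b c ↔ D a' b' c' ∧ Q a' b' c') →
      (D a' b' c' ∧ Q a' b' c' → f a b c = g a' b' c') → u P f a b c = u Q g a' b' c' := by
    intro P Q f g a b c a' b' c' h1 h2
    by_cases h : D a' b' c' ∧ Q a' b' c'
    · simp only [hdef, if_pos h, if_pos (h1.2 h), h2 h]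
    · simp only [hdef, if_neg h, if_neg (mt h1.1 h)]
  -- After removing the vanishing terms, the sums are grouped so that each bracket cancels after
  -- reindexing. Rotations preserve `X` and `Y`; reversals exchange the class `¬ X ∧ Y` with `X ∧ ¬
  -- Y`.
  have hu : ∀ a b c, (if D a b c then f₁ a b c + f₂ a b c + f₃ a b c + f₄ a b c else 0) =
      (u (fun a b c => X a b c ∧ Y a b c) f₁ a b c + u (fun a b c => X a b c ∧ Y a b c) f₃ a b c) +
      (u (fun a b c => X a b c ∧ Y a b c) f₂ a b c + u (fun a b c => X a b c ∧ Y a b c) f₄ a b c) +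
      (u (fun a b c => ¬ X a b c ∧ Y a b c) f₁ a b c +
        u (fun a b c => X a b c ∧ ¬ Y a b c) f₄ a b c) +
      (u (fun a b c => ¬ X a b c ∧ Y a b c) f₂ a b c +
        u (fun a b c => X a b c ∧ ¬ Y a b c) f₃ a b c) := by
    intro a b c
    by_cases hd : D a b c
    · by_cases hx : X a b c <;> by_cases hy : Y a b c <;>
        simp only [hdef, hd, hx, hy, and_true, and_false, not_true, not_false_eq_true, if_true,
          if_false, add_zero, zero_add]
      · abel
      · rw [z₁ hd hy, z₂ hd hy]; abel
      · rw [z₃ hd hx, z₄ hd hx]; abel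
      · rw [z₁ hd hy, z₂ hd hy, z₃ hd hx, z₄ hd hx]; abel
    · simp [hdef, hd]
  simp only [hu, Finset.sum_add_distrib]
  have hDr : ∀ {a b c}, D a b c ↔ D b c a := fun {a b c} => ⟨hD, fun h => hD (hD h)⟩
  have hDs : ∀ {a b c}, D a b c ↔ D a c b := fun {a b c} => ⟨hD', hD'⟩
  have k₁ : ∑ a, ∑ b, ∑ c, u (fun a b c => X a b c ∧ Y a b c) f₁ a b c =
      ∑ a, ∑ b, ∑ c, u (fun a b c => X a b c ∧ Y a b c) f₃ a b c := by
    rw [← sum_rotate (u (fun a b c => X a b c ∧ Y a b c) f₃)]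
    refine Finset.sum_congr rfl fun a _ => Finset.sum_congr rfl fun b _ =>
      Finset.sum_congr rfl fun c _ => hu' ?_ fun h => ?_
    · exact ⟨fun h => ⟨hD h.1, (hX h.1).1 h.2.1, (hY h.1).1 h.2.2⟩, fun h =>
        have hd := hDr.2 h.1
        ⟨hd, (hX hd).2 h.2.1, (hY hd).2 h.2.2⟩⟩
    · have hd := hDr.2 h.1
      exact e₁ hd ((hX hd).2 h.2.1) ((hY hd).2 h.2.2)
  have k₂ : ∑ a, ∑ b, ∑ c, u (fun a b c => X a b c ∧ Y a b c) f₂ a b c =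
      ∑ a, ∑ b, ∑ c, u (fun a b c => X a b c ∧ Y a b c) f₄ a b c := by
    rw [← sum_rotate (u (fun a b c => X a b c ∧ Y a b c) f₂)]
    refine Finset.sum_congr rfl fun a _ => Finset.sum_congr rfl fun b _ =>
      Finset.sum_congr rfl fun c _ => hu' ?_ fun h => ?_
    · exact ⟨fun h =>
        have hd := hDr.2 h.1
        ⟨hd, (hX hd).2 h.2.1, (hY hd).2 h.2.2⟩,
        fun h => ⟨hD h.1, (hX h.1).1 h.2.1, (hY h.1).1 h.2.2⟩⟩
    · exact e₂ (hD h.1) ((hX h.1).1 h.2.1) ((hY h.1).1 h.2.2)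
  have k₃ : ∑ a, ∑ b, ∑ c, u (fun a b c => ¬ X a b c ∧ Y a b c) f₁ a b c =
      ∑ a, ∑ b, ∑ c, u (fun a b c => X a b c ∧ ¬ Y a b c) f₄ a b c := by
    rw [← sum_reflect (u (fun a b c => X a b c ∧ ¬ Y a b c) f₄)]
    refine Finset.sum_congr rfl fun a _ => Finset.sum_congr rfl fun b _ =>
      Finset.sum_congr rfl fun c _ => hu' ?_ fun h => ?_
    · exact ⟨fun h => ⟨hD' h.1, (hX' h.1).1 h.2.1, (hY' (hD' h.1)).2 h.2.2⟩, fun h =>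
        have hd := hD' h.1
        ⟨hd, (hX' hd).2 h.2.1, (hY' h.1).1 h.2.2⟩⟩
    · have hd := hD' h.1
      exact e₃ hd ((hX' hd).2 h.2.1) ((hY' h.1).1 h.2.2)
  have k₄ : ∑ a, ∑ b, ∑ c, u (fun a b c => ¬ X a b c ∧ Y a b c) f₂ a b c =
      ∑ a, ∑ b, ∑ c, u (fun a b c => X a b c ∧ ¬ Y a b c) f₃ a b c := by
    rw [← sum_reverse (u (fun a b c => X a b c ∧ ¬ Y a b c) f₃)]
    refine Finset.sum_congr rfl fun a _ => Finset.sum_congr rfl fun b _ =>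
      Finset.sum_congr rfl fun c _ => hu' ?_ fun h => ?_
    · exact ⟨fun h =>
        have hd := hD (hD' h.1)
        ⟨hd, (hX (hD' h.1)).1 ((hX' h.1).1 h.2.1),
          fun hy => ((hY' (hD' h.1)).2 h.2.2) ((hY (hD' h.1)).2 hy)⟩, fun h =>
        have hd := hD (hD' h.1)
        ⟨hd, fun hx => (hX' (hD' h.1)).2 h.2.1 ((hX (hD' h.1)).2 hx),
          (hY (hD' h.1)).1 ((hY' h.1).1 h.2.2)⟩⟩
    · have hd := hD (hD' h.1)
      exact e₄ hd (fun hx => (hX' (hD' h.1)).2 h.2.1 ((hX (hD' h.1)).2 hx))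
        ((hY (hD' h.1)).1 ((hY' h.1).1 h.2.2))
  rw [k₁, k₂, k₃, k₄]
  simp only [h2]

end SumLemmas

/-! ### Cancellation of pairs of rectangles. -/

namespace MarkedGrid

variable {V : Type} {m : ℕ}

theorem rectDomain_mul_swap {x : Gen m} {a b u v : Fin m} {r s : Fin m}
    (hu : x (Equiv.swap a b u) = r) (hv : x (Equiv.swap a b v) = s) (c d : Fin m) :
    rectDomain (x * Equiv.swap a b) (u, v) c d = ind u v c * ind r s d := by
  rw [rectDomain, Equiv.Perm.mul_apply, Equiv.Perm.mul_apply, hu, hv]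

theorem isRectPair_iff {H : MarkedGrid V m} {x : Gen m} {a b u v : Fin m} {r s : Fin m}
    (hu : x (Equiv.swap a b u) = r) (hv : x (Equiv.swap a b v) = s) :
    H.IsRectPair x (a, b) (u, v) ↔ (a, b) ∈ H.destabRects x ∧ u ≠ v ∧ u ∉ H.Z ∧ v ∉ H.Z ∧
      ∀ c ∈ cyclicIoo u v, c ∉ H.Z → x (Equiv.swap a b c) ∉ cyclicIoo r s := by
  rw [IsRectPair, mem_destabRects (p := (u, v))]
  simp only [Equiv.Perm.mul_apply, hu, hv]

/-- Three distinct circles. -/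
def Distinct (a b c : Fin m) : Prop := a ≠ b ∧ c ≠ a ∧ c ≠ b

theorem pairTerm_disjoint {H : MarkedGrid V m} {x : Gen m} (hx : ∀ c ∈ H.Z, x c = H.O c)
    (z : Gen m) {a b u v : Fin m} (hab : a ≠ b) (huv : u ≠ v) (hu : u ≠ a ∧ u ≠ b)
    (hv : v ≠ a ∧ v ≠ b) :
    H.pairTerm x z (a, b) (u, v) = H.pairTerm x z (u, v) (a, b) := by
  refine pairTerm_congr hx z hab huv huv hab (fun c => by simp only; tauto) ?_ fun c => ?_
  · simp only [pairEnd, mul_assoc]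
    rw [Equiv.mul_swap_eq_swap_mul, Equiv.swap_apply_of_ne_of_ne hu.1 hu.2,
      Equiv.swap_apply_of_ne_of_ne hv.1 hv.2]
  · rw [rectDomain_mul_swap (congrArg x (Equiv.swap_apply_of_ne_of_ne hu.1 hu.2))
      (congrArg x (Equiv.swap_apply_of_ne_of_ne hv.1 hv.2)),
      rectDomain_mul_swap (congrArg x (Equiv.swap_apply_of_ne_of_ne hu.1.symm hv.1.symm))
      (congrArg x (Equiv.swap_apply_of_ne_of_ne hu.2.symm hv.2.symm)), rectDomain, rectDomain,
      add_comm]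

section Triples

variable {H : MarkedGrid V m} {x : Gen m} {a b c : Fin m}

theorem swap_apply_third (h : Distinct a b c) : x (Equiv.swap a b c) = x c := by
  rw [Equiv.swap_apply_of_ne_of_ne h.2.1 h.2.2]

theorem swap_apply_fst (x : Gen m) (a b : Fin m) : x (Equiv.swap a b a) = x b := by
  rw [Equiv.swap_apply_left]

theorem swap_apply_snd (x : Gen m) (a b : Fin m) : x (Equiv.swap a b b) = x a := by
  rw [Equiv.swap_apply_right]

theorem distinct_apply (x : Gen m) (h : Distinct a b c) : Distinct (x a) (x b) (x c) :=
  ⟨x.injective.ne h.1, x.injective.ne h.2.1, x.injective.ne h.2.2⟩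

/-- Here and in the next three lemmas, one cyclic order of the other coordinates puts the third
point inside the first rectangle; the other order puts a point just moved inside the second. -/
theorem not_isRectPair_fst (h : Distinct a b c) (hY : x b ∉ cyclicIco (x a) (x c)) :
    ¬ H.IsRectPair x (a, b) (a, c) := by
  rw [isRectPair_iff (swap_apply_fst x a b) (swap_apply_third h), mem_destabRects]
  rintro ⟨⟨-, ha, hb, h1⟩, -, -, hc, h2⟩
  have h1 := fun k => h1 c k hc
  have h2 := fun k => h2 b k hb
  rw [swap_apply_snd] at h2
  rw [← not_and] at h1 h2
  obtain ⟨hx1, hx2, hx3⟩ := distinct_apply x h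
  obtain ⟨h3, h4, h5⟩ := h
  simp only [mem_cyclicIoo, mem_cyclicIco, Fin.le_def, Fin.lt_def, ne_eq, Fin.ext_iff] at *
  omega

theorem not_isRectPair_snd (h : Distinct a b c) (hY : x b ∉ cyclicIco (x a) (x c)) :
    ¬ H.IsRectPair x (a, b) (c, b) := by
  rw [isRectPair_iff (swap_apply_third h) (swap_apply_snd x a b), mem_destabRects]
  rintro ⟨⟨-, ha, hb, h1⟩, -, hc, -, h2⟩
  have h1 := fun k => h1 c k hc
  have h2 := fun k => h2 a k ha
  rw [swap_apply_fst] at h2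
  rw [← not_and] at h1 h2
  obtain ⟨hx1, hx2, hx3⟩ := distinct_apply x h
  obtain ⟨h3, h4, h5⟩ := h
  simp only [mem_cyclicIoo, mem_cyclicIco, Fin.le_def, Fin.lt_def, ne_eq, Fin.ext_iff] at *
  omega

theorem not_isRectPair_thd (h : Distinct a b c) (hX : b ∉ cyclicIco a c) :
    ¬ H.IsRectPair x (a, b) (c, a) := by
  rw [isRectPair_iff (swap_apply_third h) (swap_apply_fst x a b), mem_destabRects]
  rintro ⟨⟨-, ha, hb, h1⟩, -, hc, -, h2⟩
  have h1 := fun k => h1 c k hc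
  have h2 := fun k => h2 b k hb
  rw [swap_apply_snd] at h2
  rw [← not_and] at h1 h2
  obtain ⟨hx1, hx2, hx3⟩ := distinct_apply x h
  obtain ⟨h3, h4, h5⟩ := h
  simp only [mem_cyclicIoo, mem_cyclicIco, Fin.le_def, Fin.lt_def, ne_eq, Fin.ext_iff] at *
  omega

theorem not_isRectPair_fth (h : Distinct a b c) (hX : b ∉ cyclicIco a c) :
    ¬ H.IsRectPair x (a, b) (b, c) := by
  rw [isRectPair_iff (swap_apply_snd x a b) (swap_apply_third h), mem_destabRects]
  rintro ⟨⟨-, ha, hb, h1⟩, -, -, hc, h2⟩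
  have h1 := fun k => h1 c k hc
  have h2 := fun k => h2 a k ha
  rw [swap_apply_fst] at h2
  rw [← not_and] at h1 h2
  obtain ⟨hx1, hx2, hx3⟩ := distinct_apply x h
  obtain ⟨h3, h4, h5⟩ := h
  simp only [mem_cyclicIoo, mem_cyclicIco, Fin.le_def, Fin.lt_def, ne_eq, Fin.ext_iff] at *
  omega

theorem Distinct.rotate (h : Distinct a b c) : Distinct b c a := ⟨h.2.2.symm, h.1, h.2.1.symm⟩

theorem Distinct.reflect (h : Distinct a b c) : Distinct a c b := ⟨h.2.1.symm, h.1.symm, h.2.2.symm⟩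

theorem Distinct.mem_rotate (h : Distinct a b c) : b ∈ cyclicIco a c ↔ c ∈ cyclicIco b a :=
  cyclicIco_rotate h.1 h.2.2.symm h.2.1.symm

theorem Distinct.mem_reflect (h : Distinct a b c) : b ∉ cyclicIco a c ↔ c ∈ cyclicIco a b :=
  cyclicIco_reverse h.2.2.symm h.2.1.symm

theorem Distinct.swap_mul (h : Distinct a b c) :
    Equiv.swap a b * Equiv.swap a c = Equiv.swap b c * Equiv.swap a b := by
  rw [Equiv.mul_swap_eq_swap_mul, Equiv.swap_apply_left,
    Equiv.swap_apply_of_ne_of_ne h.2.1 h.2.2]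

/-- Here and in the next three lemmas, an L-shaped domain is cut in two ways at its reflex corner.
-/
theorem pairTerm_fst_eq_thd (hx : ∀ c ∈ H.Z, x c = H.O c) (z : Gen m) (h : Distinct a b c)
    (hX : b ∈ cyclicIco a c) (hY : x b ∈ cyclicIco (x a) (x c)) :
    H.pairTerm x z (a, b) (a, c) = H.pairTerm x z (b, c) (a, b) := by
  refine pairTerm_congr hx z h.1 h.2.1.symm h.2.2.symm h.1 (fun _ => by simp only; tauto) ?_
    fun d => ?_
  · simp only [pairEnd, mul_assoc]
    rw [h.swap_mul]
  · rw [rectDomain_mul_swap (swap_apply_fst x a b) (swap_apply_third h),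
      rectDomain_mul_swap (swap_apply_third h.rotate) (swap_apply_fst x b c), rectDomain,
      rectDomain, ind_concat hX, ind_concat hY]
    ring

theorem pairTerm_snd_eq_fth (hx : ∀ c ∈ H.Z, x c = H.O c) (z : Gen m) (h : Distinct a b c)
    (hX : b ∈ cyclicIco a c) (hY : x b ∈ cyclicIco (x a) (x c)) :
    H.pairTerm x z (a, b) (c, b) = H.pairTerm x z (c, a) (a, b) := by
  have hx' := distinct_apply x h
  refine pairTerm_congr hx z h.1 h.2.2 h.2.1 h.1 (fun _ => by simp only; tauto) ?_ fun d => ?_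
  · simp only [pairEnd, mul_assoc]
    rw [Equiv.swap_comm a b, Equiv.swap_comm c b, Equiv.swap_comm c a,
      h.reflect.rotate.rotate.swap_mul]
  · rw [rectDomain_mul_swap (swap_apply_third h) (swap_apply_snd x a b),
      rectDomain_mul_swap (swap_apply_snd x c a) (swap_apply_third h.rotate.rotate), rectDomain,
      rectDomain, ind_concat (h.rotate.mem_rotate.1 (h.mem_rotate.1 hX)) d,
      ind_concat (hx'.rotate.mem_rotate.1 (hx'.mem_rotate.1 hY)) (H.O d)]
    ring

theorem pairTerm_fst_eq_fth (hx : ∀ c ∈ H.Z, x c = H.O c) (z : Gen m) (h : Distinct a b c)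
    (hX : b ∉ cyclicIco a c) (hY : x b ∈ cyclicIco (x a) (x c)) :
    H.pairTerm x z (a, b) (a, c) = H.pairTerm x z (a, c) (c, b) := by
  refine pairTerm_congr hx z h.1 h.2.1.symm h.2.1.symm h.2.2 (fun _ => by simp only; tauto) ?_
    fun d => ?_
  · simp only [pairEnd, mul_assoc]
    rw [Equiv.mul_swap_eq_swap_mul (Equiv.swap a c), Equiv.swap_apply_right,
      Equiv.swap_apply_of_ne_of_ne h.1.symm h.2.2.symm]
  · rw [rectDomain_mul_swap (swap_apply_fst x a b) (swap_apply_third h),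
      rectDomain_mul_swap (swap_apply_snd x a c) (swap_apply_third h.reflect), rectDomain,
      rectDomain, ind_concat (h.mem_reflect.1 hX) d, ind_concat hY]
    ring

theorem pairTerm_snd_eq_thd (hx : ∀ c ∈ H.Z, x c = H.O c) (z : Gen m) (h : Distinct a b c)
    (hX : b ∉ cyclicIco a c) (hY : x b ∈ cyclicIco (x a) (x c)) :
    H.pairTerm x z (a, b) (c, b) = H.pairTerm x z (c, b) (a, c) := by
  have hx' := distinct_apply x h
  refine pairTerm_congr hx z h.1 h.2.2 h.2.2 h.2.1.symm (fun _ => by simp only; tauto) ?_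
    fun d => ?_
  · simp only [pairEnd, mul_assoc]
    rw [Equiv.mul_swap_eq_swap_mul (Equiv.swap c b), Equiv.swap_apply_left,
      Equiv.swap_apply_of_ne_of_ne h.2.1.symm h.1]
  · rw [rectDomain_mul_swap (swap_apply_third h) (swap_apply_snd x a b),
      rectDomain_mul_swap (swap_apply_third h.rotate.reflect.rotate.rotate) (swap_apply_fst x c b),
      rectDomain, rectDomain, ind_concat (h.mem_reflect.1 hX) d,
      ind_concat (hx'.rotate.mem_rotate.1 (hx'.mem_rotate.1 hY)) (H.O d)]
    ring

/-- Pairs of rectangles that share exactly one corner cancel. -/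
theorem sum_pairTerm_triples (hx : ∀ c ∈ H.Z, x c = H.O c) (z : Gen m) :
    ∑ a, ∑ b, ∑ c, (if a ≠ b ∧ c ≠ a ∧ c ≠ b then
      H.pairTerm x z (a, b) (a, c) + H.pairTerm x z (a, b) (c, b) + H.pairTerm x z (a, b) (c, a) +
        H.pairTerm x z (a, b) (b, c) else 0) = 0 :=
  sum_triples_eq_zero (fun y => ZModModule.add_self y) (fun a b c => b ∈ cyclicIco a c)
    (fun a b c => x b ∈ cyclicIco (x a) (x c)) (fun a b c => a ≠ b ∧ c ≠ a ∧ c ≠ b)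
    (fun h => Distinct.rotate h) (fun h => Distinct.reflect h)
    (fun h => Distinct.mem_rotate h) (fun h => Distinct.mem_reflect h)
    (fun h => Distinct.mem_rotate (distinct_apply x h))
    (fun h => Distinct.mem_reflect (distinct_apply x h))
    _ _ _ _
    (fun h hY => pairTerm_eq_zero z (not_isRectPair_fst h hY))
    (fun h hY => pairTerm_eq_zero z (not_isRectPair_snd h hY))
    (fun h hX => pairTerm_eq_zero z (not_isRectPair_thd h hX))
    (fun h hX => pairTerm_eq_zero z (not_isRectPair_fth h hX))
    (fun h hX hY => pairTerm_fst_eq_thd hx z h hX hY)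
    (fun h hX hY => pairTerm_snd_eq_fth hx z h hX hY)
    (fun h hX hY => pairTerm_fst_eq_fth hx z h hX hY)
    (fun h hX hY => pairTerm_snd_eq_thd hx z h hX hY)

end Triples

/-- Every circle of a set with at least two elements has a unique successor in that set. -/
theorem existsUnique_next {S : Finset (Fin m)} {a : Fin m} (h : ∃ b ∈ S, b ≠ a) :
    ∃! b, b ≠ a ∧ b ∈ S ∧ ∀ c ∈ S, c ∉ cyclicIoo a b := by
  obtain ⟨b₀, hb₀⟩ := h
  -- The cycle is cut open at `a`, so that the successor is a minimum.
  let f : Fin m → ℕ := fun b => if a ≤ b then (b : ℕ) else b + m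
  obtain ⟨b, hb, hmin⟩ := (S.erase a).exists_min_image f ⟨b₀, by simp [hb₀]⟩
  have hcond : ∀ c ∈ S, c ∉ cyclicIoo a b := by
    intro c hc hc'
    rw [mem_cyclicIoo, mem_cyclicIco] at hc'
    have := hmin c (by simp [hc, hc'.1])
    have hne := Finset.ne_of_mem_erase hb
    simp only [f, ne_eq, Fin.ext_iff, Fin.le_def, Fin.lt_def] at *
    split_ifs at this <;> omega
  refine ⟨b, ⟨Finset.ne_of_mem_erase hb, Finset.mem_of_mem_erase hb, hcond⟩, ?_⟩
  rintro b' ⟨h1, h2, h3⟩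
  have h4 := h3 b (Finset.mem_of_mem_erase hb)
  have h5 := hcond b' h2
  have h6 := Finset.ne_of_mem_erase hb
  simp only [mem_cyclicIoo, mem_cyclicIco, ne_eq, Fin.ext_iff, Fin.le_def, Fin.lt_def] at *
  omega

theorem sum_next {M : Type*} [AddCommMonoid M] {S : Finset (Fin m)} {a : Fin m} (ha : a ∈ S)
    (g : M) : (∑ b, if a ≠ b ∧ b ∈ S ∧ ∀ c ∈ S, c ∉ cyclicIoo a b then g else 0) =
      if 1 < S.card then g else 0 := by
  split_ifs with h
  · obtain ⟨b, hb, huniq⟩ := existsUnique_next (S.exists_mem_ne h a)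
    rw [Finset.sum_eq_single b, if_pos ⟨hb.1.symm, hb.2⟩]
    · intro b' _ hne
      exact if_neg fun h' => hne (huniq b' ⟨h'.1.symm, h'.2⟩)
    · simp
  · exact Finset.sum_eq_zero fun b _ => if_neg fun h' =>
      h (Finset.one_lt_card.2 ⟨a, ha, b, h'.2.1, h'.1⟩)

section Returning

variable {H : MarkedGrid V m} {x : Gen m} {a b : Fin m}

theorem pairEnd_self (x : Gen m) (a b : Fin m) : pairEnd x (a, b) (a, b) = x := by
  simp [pairEnd, mul_assoc]

theorem pairEnd_comm (x : Gen m) (a b : Fin m) : pairEnd x (a, b) (b, a) = x := by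
  simp [pairEnd, mul_assoc, Equiv.swap_comm b a]

/-- The rectangles occupy complementary rows of a vertical annulus, so a point on an unmarked circle
strictly between `a` and `b` would lie inside one of them. In `isRectPair_comm` the annulus is
horizontal. -/
theorem isRectPair_self (x : Gen m) (a b : Fin m) : H.IsRectPair x (a, b) (a, b) ↔
    a ∈ H.Zᶜ ∧ a ≠ b ∧ b ∈ H.Zᶜ ∧ ∀ c ∈ H.Zᶜ, c ∉ cyclicIoo a b := by
  rw [isRectPair_iff (swap_apply_fst x a b) (swap_apply_snd x a b), mem_destabRects]
  simp only [Finset.mem_compl]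
  constructor
  · rintro ⟨⟨hab, ha, hb, h1⟩, -, -, -, h2⟩
    refine ⟨ha, hab, hb, fun c hc h => ?_⟩
    have h1 := h1 c h hc
    have h2 := h2 c h hc
    have hcb : c ≠ b := by
      rintro rfl; exact right_notMem_cyclicIco _ _ (mem_cyclicIoo.1 h).2
    have hca := (mem_cyclicIoo.1 h).1
    rw [Equiv.swap_apply_of_ne_of_ne hca hcb, mem_cyclicIoo,
      mem_cyclicIco_compl (x.injective.ne hab)] at h2
    rw [mem_cyclicIoo] at h1
    exact h2 ⟨x.injective.ne hcb, fun h' => h1 ⟨x.injective.ne hca, h'⟩⟩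
  · rintro ⟨ha, hab, hb, h⟩
    exact ⟨⟨hab, ha, hb, fun c hc hcZ => absurd hc (h c hcZ)⟩, hab, ha, hb,
      fun c hc hcZ => absurd hc (h c hcZ)⟩

theorem isRectPair_comm (x : Gen m) (a b : Fin m) : H.IsRectPair x (a, b) (b, a) ↔
    a ∈ H.Zᶜ ∧ a ≠ b ∧ b ∈ H.Zᶜ ∧ ∀ c ∈ H.Zᶜ, x c ∉ cyclicIoo (x a) (x b) := by
  rw [isRectPair_iff (swap_apply_snd x a b) (swap_apply_fst x a b), mem_destabRects]
  simp only [Finset.mem_compl]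
  constructor
  · rintro ⟨⟨hab, ha, hb, h1⟩, -, -, -, h2⟩
    refine ⟨ha, hab, hb, fun c hc h => ?_⟩
    have h1 := fun k => h1 c k hc h
    have h2 := fun k => h2 c k hc
    have hcb : c ≠ b := by
      rintro rfl; exact right_notMem_cyclicIco _ _ (mem_cyclicIoo.1 h).2
    have hca : c ≠ a := fun e => (mem_cyclicIoo.1 h).1 (congrArg x e)
    rw [Equiv.swap_apply_of_ne_of_ne hca hcb] at h2
    rw [mem_cyclicIoo] at h1 h2
    refine h2 ⟨hcb, ?_⟩ h
    rw [mem_cyclicIco_compl hab]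
    exact fun h' => h1 ⟨hca, h'⟩
  · rintro ⟨ha, hab, hb, h⟩
    refine ⟨⟨hab, ha, hb, fun c hc hcZ => h c hcZ⟩, hab.symm, hb, ha, fun c hc hcZ => ?_⟩
    have hca : c ≠ a := by
      rintro rfl; exact right_notMem_cyclicIco _ _ (mem_cyclicIoo.1 hc).2
    rw [Equiv.swap_apply_of_ne_of_ne hca (mem_cyclicIoo.1 hc).1]
    exact h c hcZ

theorem rectDomain_self_add (hab : a ≠ b) (c d : Fin m) : rectDomain x (a, b) c d +
    rectDomain (x * Equiv.swap a b) (a, b) c d = ind a b c := by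
  rw [rectDomain_mul_swap (swap_apply_fst x a b) (swap_apply_snd x a b), rectDomain]
  have := ind_compl (x.injective.ne hab) d
  simp only at this ⊢
  rw [← mul_add, this, mul_one]

theorem rectDomain_comm_add (hab : a ≠ b) (c d : Fin m) : rectDomain x (a, b) c d +
    rectDomain (x * Equiv.swap a b) (b, a) c d = ind (x a) (x b) d := by
  rw [rectDomain_mul_swap (swap_apply_snd x a b) (swap_apply_fst x a b), rectDomain]
  have := ind_compl hab c
  simp only at this ⊢
  rw [← add_mul, this, one_mul]

theorem pairWeight_eq_single {p q : Fin m × Fin m} {e : Fin m} (h : ∀ c ∈ H.Zᶜ,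
      rectDomain x p c (H.O c) + rectDomain (x * Equiv.swap p.1 p.2) q c (H.O c) =
        if c = e then 1 else 0) (he : e ∉ H.Z) :
    H.pairWeight x p q = Finsupp.single (H.var e) 1 := by
  classical
  ext v
  rw [← Nat.cast_inj (R := ℤ), pairWeight, Finsupp.add_apply, Nat.cast_add,
    weight, weight, expo_apply, expo_apply, ← Finset.sum_add_distrib,
    Finset.sum_eq_single e, Finsupp.single_apply]
  · have := h e (by simpa using he)
    simp only [rectDomain_apply_O] at this
    simp only [Finset.mem_sdiff]
    split_ifs at * <;> simp_all
  · intro c _ hce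
    by_cases hc : c ∈ H.Z
    · simp [hc]
    have := h c (by simpa using hc)
    simp only [rectDomain_apply_O, if_neg hce] at this
    simp only [Finset.mem_sdiff]
    split_ifs at * <;> simp_all
  · simp

-- An annulus starting at `a` must end at the next unmarked circle, and its only unmarked `O` is
-- that of column `a`.
open Classical in
theorem sum_pairTerm_self (H : MarkedGrid V m) (x z : Gen m) :
    ∑ a, ∑ b, H.pairTerm x z (a, b) (a, b) = ∑ a, if a ∈ H.Zᶜ then
      (if 1 < H.Zᶜ.card then
        (if x = z then MvPowerSeries.monomial (Finsupp.single (H.var a) 1) 1 else 0) else 0)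
      else (0 : Coeff V) := by
  refine Finset.sum_congr rfl fun a _ => ?_
  by_cases ha : a ∈ H.Zᶜ
  · rw [if_pos ha, ← sum_next ha]
    refine Finset.sum_congr rfl fun b _ => ?_
    have hiff : H.IsRectPair x (a, b) (a, b) ∧ pairEnd x (a, b) (a, b) = z ↔
        (a ≠ b ∧ b ∈ H.Zᶜ ∧ ∀ c ∈ H.Zᶜ, c ∉ cyclicIoo a b) ∧ x = z := by
      rw [isRectPair_self, pairEnd_self, eq_true ha, true_and]
    by_cases h : H.IsRectPair x (a, b) (a, b) ∧ pairEnd x (a, b) (a, b) = z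
    · obtain ⟨h1, h2⟩ := hiff.1 h
      rw [pairTerm, if_pos h, if_pos h1, if_pos h2,
        pairWeight_eq_single (e := a) _ (by simpa using ha)]
      intro c hc
      rw [rectDomain_self_add h1.1]
      have := h1.2.2 c hc
      rw [mem_cyclicIoo] at this
      split_ifs with hca
      · rw [hca, ind_left h1.1]
      · exact ind_eq_zero_iff.2 fun h' => this ⟨hca, h'⟩
    · rw [pairTerm, if_neg h]
      split_ifs with h1 h2
      · exact absurd (hiff.2 ⟨h1, h2⟩) h
      · rfl
      · rfl
  · rw [if_neg ha]
    exact Finset.sum_eq_zero fun b _ => pairTerm_eq_zero z fun h =>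
      ha ((isRectPair_self x a b).1 h).1

open Classical in
theorem sum_pairTerm_comm {H : MarkedGrid V m} {x : Gen m} (hx : ∀ c ∈ H.Z, x c = H.O c)
    (z : Gen m) :
    ∑ a, ∑ b, H.pairTerm x z (a, b) (b, a) = ∑ a, if a ∈ H.Zᶜ then
      (if 1 < H.Zᶜ.card then
        (if x = z then MvPowerSeries.monomial (Finsupp.single (H.var a) 1) 1 else 0) else 0)
      else (0 : Coeff V) := by
  have hmem : ∀ a, H.O.symm (x a) ∈ H.Zᶜ ↔ a ∈ H.Zᶜ := by
    intro a
    rw [Finset.mem_compl, Finset.mem_compl, not_iff_not]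
    constructor
    · intro h
      have := hx _ h
      rw [Equiv.apply_symm_apply, x.injective.eq_iff] at this
      rwa [this] at h
    · intro h
      rwa [hx a h, Equiv.symm_apply_apply]
  -- The annulus starting at the height `x a` is indexed by the column of the `O` in that row. This
  -- gives the same sum as the vertical annuli, so the two kinds cancel.
  refine Eq.trans ?_ (Equiv.sum_comp (x.trans H.O.symm) _)
  refine Finset.sum_congr rfl fun a _ => ?_
  rw [Equiv.trans_apply]
  by_cases ha : a ∈ H.Zᶜ
  · rw [if_pos ((hmem a).2 ha), ← Finset.card_map x.toEmbedding,
      ← sum_next (a := x a) (by simpa using ha)]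
    refine Eq.trans ?_ (Equiv.sum_comp x _)
    refine Finset.sum_congr rfl fun b _ => ?_
    have hiff : H.IsRectPair x (a, b) (b, a) ∧ pairEnd x (a, b) (b, a) = z ↔
        (x a ≠ x b ∧ x b ∈ H.Zᶜ.map x.toEmbedding ∧
          ∀ c ∈ H.Zᶜ.map x.toEmbedding, c ∉ cyclicIoo (x a) (x b)) ∧ x = z := by
      rw [isRectPair_comm, pairEnd_comm, eq_true ha, true_and, x.injective.ne_iff]
      rw [Finset.forall_mem_map, Finset.mem_map_equiv, Equiv.symm_apply_apply]
      rfl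
    by_cases h : H.IsRectPair x (a, b) (b, a) ∧ pairEnd x (a, b) (b, a) = z
    · obtain ⟨h1, h2⟩ := hiff.1 h
      rw [pairTerm, if_pos h, if_pos h1, if_pos h2,
        pairWeight_eq_single (e := H.O.symm (x a)) _ (by simpa using (hmem a).2 ha)]
      intro c hc
      rw [rectDomain_comm_add (fun e => h1.1 (congrArg x e))]
      have := h1.2.2 (H.O c) (by
        rw [Finset.mem_map_equiv, ← hmem, Equiv.apply_symm_apply, Equiv.symm_apply_apply]
        exact hc)
      rw [mem_cyclicIoo] at this
      split_ifs with hca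
      · rw [hca, Equiv.apply_symm_apply, ind_left h1.1]
      · exact ind_eq_zero_iff.2 fun h' =>
          this ⟨fun e => hca (by rw [← e, Equiv.symm_apply_apply]), h'⟩
    · rw [pairTerm, if_neg h]
      split_ifs with h1 h2
      · exact absurd (hiff.2 ⟨h1, h2⟩) h
      · rfl
      · rfl
  · rw [if_neg (mt (hmem a).1 ha)]
    exact Finset.sum_eq_zero fun b _ => pairTerm_eq_zero z fun h =>
      ha ((isRectPair_comm x a b).1 h).1

end Returning

/-- Pairs of empty rectangles with the same end cancel. -/
theorem sum_pairTerm_eq_zero {H : MarkedGrid V m} {x : Gen m} (hx : ∀ c ∈ H.Z, x c = H.O c)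
    (z : Gen m) : ∑ p, ∑ q, H.pairTerm x z p q = 0 := by
  have h2 : ∀ y : Coeff V, y + y = 0 := fun y => ZModModule.add_self y
  have := sum_split_pairs (fun a b u v => H.pairTerm x z (a, b) (u, v))
    (fun a u v => pairTerm_eq_zero z fun h => (mem_destabRects.1 h.1).1 rfl)
    (fun a b u => pairTerm_eq_zero z fun h => (mem_destabRects.1 h.2).1 rfl)
  simp only [Fintype.sum_prod_type]
  rw [this, sum_pairTerm_triples hx z, add_zero]
  simp only [Finset.sum_add_distrib]
  rw [sum_pairTerm_self, sum_pairTerm_comm hx, h2, zero_add]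
  have := sum_symm_eq_zero h2 (fun p q : Fin m × Fin m => if p.1 ≠ p.2 ∧ (q.1 ≠ p.1 ∧ q.1 ≠ p.2) ∧
    (q.2 ≠ p.1 ∧ q.2 ≠ p.2) ∧ q.1 ≠ q.2 then H.pairTerm x z p q else 0) ?_ ?_
  · simp only [Fintype.sum_prod_type] at this
    refine Eq.trans ?_ this
    refine Finset.sum_congr rfl fun a _ => Finset.sum_congr rfl fun b _ =>
      Finset.sum_congr rfl fun u _ => Finset.sum_congr rfl fun v _ => ?_
    by_cases huv : u = v
    · subst huv
      rw [pairTerm_eq_zero z fun h => (mem_destabRects.1 h.2).1 rfl]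
      simp
    · simp only [ne_eq, huv, not_false_eq_true, and_true]
  · rintro ⟨a, b⟩ ⟨u, v⟩
    simp only
    by_cases h : a ≠ b ∧ (u ≠ a ∧ u ≠ b) ∧ (v ≠ a ∧ v ≠ b) ∧ u ≠ v
    · rw [if_pos h, if_pos ⟨h.2.2.2, ⟨h.2.1.1.symm, h.2.2.1.1.symm⟩,
        ⟨h.2.1.2.symm, h.2.2.1.2.symm⟩, h.1⟩,
        pairTerm_disjoint hx z h.1 h.2.2.2 h.2.1 h.2.2.1]
    · rw [if_neg h, if_neg]
      rintro ⟨h1, h2, h3, h4⟩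
      exact h ⟨h4, ⟨h2.1.symm, h3.1.symm⟩, ⟨h2.2.symm, h3.2.symm⟩, h1⟩
  · rintro ⟨a, b⟩
    exact if_neg fun h => h.2.1.1 rfl


end MarkedGrid

/-! ### The square of the differential vanishes. -/

open scoped Kronecker

namespace MarkedGrid

variable {V : Type} {m : ℕ}

/-- The differential of the destabilized complex, extended to all matchings. -/
noncomputable def destabBoundary (H : MarkedGrid V m) : Matrix (Gen m) (Gen m) (Coeff V) :=
  Matrix.of fun x' x => ∑ p, if p ∈ H.destabRects x ∧ x * Equiv.swap p.1 p.2 = x' then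
    MvPowerSeries.monomial (H.weight x p) 1 else 0

theorem destabBoundary_apply (H : MarkedGrid V m) (x' x : Gen m) : H.destabBoundary x' x =
    ∑ p ∈ H.destabRects x with x * Equiv.swap p.1 p.2 = x',
      ∏ c ∈ H.rectO x p \ H.Z, (MvPowerSeries.X (H.var c) : Coeff V) := by
  simp only [prod_X_eq]
  rw [destabBoundary, Matrix.of_apply, ← Finset.sum_filter]
  refine Finset.sum_congr ?_ fun _ _ => rfl
  ext p
  simp

theorem destabBoundary_mul_self_apply {H : MarkedGrid V m} {x : Gen m}
    (hx : ∀ c ∈ H.Z, x c = H.O c) (z : Gen m) : (H.destabBoundary * H.destabBoundary) z x = 0 := by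
  rw [← sum_pairTerm_eq_zero hx z, Matrix.mul_apply]
  simp only [destabBoundary, Matrix.of_apply, Finset.sum_mul_sum]
  rw [Finset.sum_comm]
  refine (Finset.sum_congr rfl fun _ _ => Finset.sum_comm).trans (Finset.sum_comm.trans ?_)
  refine Finset.sum_congr rfl fun p _ => Finset.sum_congr rfl fun q _ => ?_
  rw [Finset.sum_eq_single (x * Equiv.swap p.1 p.2)]
  · by_cases h1 : p ∈ H.destabRects x
    · by_cases h2 : q ∈ H.destabRects (x * Equiv.swap p.1 p.2) ∧
          x * Equiv.swap p.1 p.2 * Equiv.swap q.1 q.2 = z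
      · rw [if_pos h2, if_pos ⟨h1, rfl⟩, pairTerm, if_pos ⟨⟨h1, h2.1⟩, h2.2⟩,
          MvPowerSeries.monomial_mul_monomial, mul_one, pairWeight, add_comm]
      · rw [if_neg h2, zero_mul, pairTerm, if_neg fun h => h2 ⟨h.1.2, h.2⟩]
    · rw [if_neg (c := p ∈ H.destabRects x ∧ _) fun h => h1 h.1, mul_zero,
        pairTerm_eq_zero z fun h => h1 h.1]
  · intro w _ hw
    rw [if_neg (c := p ∈ H.destabRects x ∧ _) fun h => hw h.2.symm, mul_zero]
  · simp

/-- The part of the enhanced differential that changes the signs. -/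
noncomputable def coneBoundary (H : MarkedGrid V m) :
    Matrix (H.Z → Fin 2) (H.Z → Fin 2) (Coeff V) :=
  Matrix.of fun ε' ε => ∑ j : H.Z, if ε j = 0 ∧ ε' = Function.update ε j 1 then
    (MvPowerSeries.X (H.var j) : Coeff V) - MvPowerSeries.X (H.var (H.below j)) else 0

/-- Two signs can be raised in either order, with the same coefficient. -/
theorem coneBoundary_mul_self (H : MarkedGrid V m) : H.coneBoundary * H.coneBoundary = 0 := by
  refine Matrix.ext fun ε'' ε => ?_
  rw [Matrix.mul_apply, Matrix.zero_apply]
  let u : H.Z → Coeff V := fun j => MvPowerSeries.X (H.var j) - MvPowerSeries.X (H.var (H.below j))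
  have h : ∀ ε', H.coneBoundary ε'' ε' * H.coneBoundary ε' ε =
      ∑ k : H.Z, ∑ j : H.Z, if ε' = Function.update ε j 1 then
        (if ε j = 0 ∧ Function.update ε j 1 k = 0 ∧
          ε'' = Function.update (Function.update ε j 1) k 1 then u k * u j else 0) else 0 := by
    intro ε'
    rw [coneBoundary, Matrix.of_apply, Matrix.of_apply, Finset.sum_mul_sum]
    refine Finset.sum_congr rfl fun k _ => Finset.sum_congr rfl fun j _ => ?_
    by_cases h : ε' = Function.update ε j 1
    · subst h
      rw [if_pos rfl, ite_mul, zero_mul]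
      by_cases h1 : ε j = 0 <;> simp [h1, u]
    · rw [if_neg h, if_neg (fun h' : ε j = 0 ∧ _ => h h'.2), mul_zero]
  simp only [h]
  rw [Finset.sum_comm]
  refine (Finset.sum_congr rfl fun k _ => Finset.sum_comm).trans ?_
  simp only [Finset.sum_ite_eq', Finset.mem_univ, if_true]
  refine sum_symm_eq_zero (fun y : Coeff V => ZModModule.add_self y) _ (fun k j => ?_) fun j => ?_
  · by_cases hjk : k = j
    · rw [hjk]
    · rw [Function.update_of_ne hjk, Function.update_of_ne (Ne.symm hjk),
        Function.update_comm hjk, mul_comm]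
      simp only [← and_assoc, and_comm]
  · simp

/-- The differential of the destabilized complex. -/
noncomputable def fixedBoundary (H : MarkedGrid V m) : Matrix
    {y : Gen m // ∀ c ∈ H.Z, y c = H.O c} {y : Gen m // ∀ c ∈ H.Z, y c = H.O c} (Coeff V) :=
  Matrix.of fun y' y => H.destabBoundary y'.1 y.1

/-- Rectangles with corners off the marked columns preserve the destabilization points, so
restricting the intermediate matching loses nothing. -/
theorem fixedBoundary_mul_self (H : MarkedGrid V m) :
    H.fixedBoundary * H.fixedBoundary = 0 := by
  refine Matrix.ext fun z x => ?_
  rw [Matrix.zero_apply, ← H.destabBoundary_mul_self_apply x.2 z.1, Matrix.mul_apply,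
    Matrix.mul_apply,
    ← Fintype.sum_subtype_add_sum_subtype (fun y : Gen m => ∀ c ∈ H.Z, y c = H.O c)]
  simp only [fixedBoundary, Matrix.of_apply]
  rw [left_eq_add]
  refine Finset.sum_eq_zero fun w _ => ?_
  convert mul_zero _
  rw [destabBoundary, Matrix.of_apply]
  refine Finset.sum_eq_zero fun p _ => if_neg ?_
  rintro ⟨h1, h2⟩
  refine w.2 fun c hc => ?_
  rw [← h2]
  exact swap_fix x.2 (notMem_of_mem_destabRects h1).1 (notMem_of_mem_destabRects h1).2 c hc

theorem eBoundary_eq (H : MarkedGrid V m) : H.eBoundary =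
    H.fixedBoundary ⊗ₖ (1 : Matrix (H.Z → Fin 2) (H.Z → Fin 2) (Coeff V)) +
      (1 : Matrix {y : Gen m // ∀ c ∈ H.Z, y c = H.O c} {y : Gen m // ∀ c ∈ H.Z, y c = H.O c}
        (Coeff V)) ⊗ₖ H.coneBoundary := by
  refine Matrix.ext fun y' y => ?_
  rw [eBoundary, Matrix.of_apply, Matrix.add_apply, Matrix.kronecker_apply, Matrix.kronecker_apply,
    fixedBoundary, Matrix.of_apply, destabBoundary_apply, coneBoundary, Matrix.of_apply,
    Matrix.one_apply, Matrix.one_apply]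
  congr 1
  · by_cases h : y'.2 = y.2 <;> simp [h]
  · by_cases h : y'.1 = y.1 <;> simp [h]

theorem eBoundary_mul_self (H : MarkedGrid V m) : H.eBoundary * H.eBoundary = 0 := by
  rw [eBoundary_eq, Matrix.add_mul, Matrix.mul_add, Matrix.mul_add, ← Matrix.mul_kronecker_mul,
    ← Matrix.mul_kronecker_mul, ← Matrix.mul_kronecker_mul, ← Matrix.mul_kronecker_mul,
    fixedBoundary_mul_self, coneBoundary_mul_self, Matrix.one_mul, Matrix.mul_one, Matrix.one_mul,
    Matrix.mul_one, Matrix.one_mul, Matrix.zero_kronecker, Matrix.kronecker_zero, zero_add, add_zero,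
    ZModModule.add_self]

theorem boundary_mul_self (H : MarkedGrid V m) : H.boundary * H.boundary = 0 := by
  have h : H.boundary = destabBoundary { H with Z := ∅ } := by
    refine Matrix.ext fun x' x => ?_
    rw [boundary, Matrix.of_apply, destabBoundary_apply]
    simp [emptyRects, destabRects, rectO]
  rw [h]
  exact Matrix.ext fun z x => destabBoundary_mul_self_apply (by simp) z

theorem homD_homD (H : MarkedGrid V m) (φ : H.HomCx) : H.homD (H.homD φ) = 0 := by
  change (φ * H.boundary + H.eBoundary * φ) * H.boundary +
    H.eBoundary * (φ * H.boundary + H.eBoundary * φ) = 0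
  rw [Matrix.add_mul, Matrix.mul_add, Matrix.mul_assoc, boundary_mul_self, Matrix.mul_zero,
    ← Matrix.mul_assoc H.eBoundary H.eBoundary, eBoundary_mul_self, Matrix.zero_mul,
    Matrix.mul_assoc, zero_add, add_zero, ZModModule.add_self]

end MarkedGrid

/-! ### The algebraic discrete Morse lemma. -/

/-- Vanishing of cohomology by a discrete Morse matching. The cells `S δ` of degree `δ` are basis
vectors `e a`, with coordinate functions `coef a`; every cell that satisfies `low` is matched with
`mate a`, which does not, and in the degrees considered all other cells arise in this way. The
matching is acyclic because of the monovariant `Ψ`. -/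
theorem exists_preimage_of_matching {κ M P : Type*} [AddCommGroup M] [Module (ZMod 2) M]
    [LinearOrder P] (S : ℤ → Set κ) (e : κ → M) (coef : κ → M →ₗ[ZMod 2] ZMod 2)
    (hself : ∀ a, coef a (e a) = 1) (hne : ∀ a b, a ≠ b → coef a (e b) = 0)
    (d : M →ₗ[ZMod 2] M) (hd : ∀ φ, d (d φ) = 0) (low : κ → Prop) (mate : κ → κ) (Ψ : κ → P)
    (hlow : ∀ δ, ∀ a ∈ S δ, low a → mate a ∈ S (δ + 1) ∧ ¬ low (mate a) ∧ Ψ (mate a) = Ψ a ∧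
      d (e a) - e (mate a) ∈ Submodule.span (ZMod 2)
        (e '' {b | b ∈ S (δ + 1) ∧ (low b ∨ Ψ a < Ψ b)}))
    (hinj : ∀ a b, low a → low b → mate a = mate b → a = b)
    (δ : ℤ) (hup : ∀ b ∈ S δ, ¬ low b → ∃ a ∈ S (δ - 1), low a ∧ mate a = b)
    (hfin : (Ψ '' S δ).Finite)
    (φ : M) (hφ : φ ∈ Submodule.span (ZMod 2) (e '' S δ)) (hdφ : d φ = 0) :
    φ ∈ (Submodule.span (ZMod 2) (e '' S (δ - 1))).map d := by
  classical
  set B := (Submodule.span (ZMod 2) (e '' S (δ - 1))).map d with hB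
  set T := B ⊔ Submodule.span (ZMod 2) (e '' {a | a ∈ S δ ∧ low a}) with hT
  -- Modulo coboundaries, low cells span degree `δ`. A counterexample with largest `Ψ` is the mate
  -- of some `a`, and all other terms of `d (e a)` are low or have larger `Ψ`.
  have hupT : ∀ b ∈ S δ, e b ∈ T := by
    by_contra! hbad
    obtain ⟨b₀, hb₀, hb₀T⟩ := hbad
    obtain ⟨q, ⟨b, ⟨hbS, hbT⟩, rfl⟩, hmax⟩ := Set.exists_max_image
      (Ψ '' {b | b ∈ S δ ∧ e b ∉ T}) id
      (hfin.subset (Set.image_mono fun b hb => hb.1)) ⟨_, b₀, ⟨hb₀, hb₀T⟩, rfl⟩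
    have hTlow : ∀ a ∈ S δ, low a → e a ∈ T := fun a ha hl =>
      Submodule.mem_sup_right (Submodule.subset_span ⟨a, ⟨ha, hl⟩, rfl⟩)
    obtain ⟨a, haS, hal, rfl⟩ := hup b hbS fun hl => hbT (hTlow b hbS hl)
    obtain ⟨-, -, hΨ, hr⟩ := hlow _ a haS hal
    rw [sub_add_cancel] at hr
    have hr' : d (e a) - e (mate a) ∈ T := by
      refine Submodule.span_le.2 ?_ hr
      rintro _ ⟨b, ⟨hb, hb'⟩, rfl⟩
      rcases hb' with hb' | hb'
      · exact hTlow b hb hb'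
      · by_contra hbT'
        have := hmax _ ⟨b, ⟨hb, hbT'⟩, rfl⟩
        simp only [id] at this
        rw [hΨ] at this
        exact absurd hb' (not_lt.2 this)
    have hda : d (e a) ∈ T :=
      Submodule.mem_sup_left ⟨e a, Submodule.subset_span ⟨a, haS, rfl⟩, rfl⟩
    exact hbT (by simpa using T.sub_mem hda hr')
  have hφT : φ ∈ T := Submodule.span_le.2 (by rintro _ ⟨b, hb, rfl⟩; exact hupT b hb) hφ
  obtain ⟨β, hβ, l, hl, rfl⟩ := Submodule.mem_sup.1 hφT
  obtain ⟨ψ, -, rfl⟩ := id hβ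
  obtain ⟨f, hf, rfl⟩ := (Finsupp.mem_span_image_iff_linearCombination _).1 hl
  suffices f = 0 by
    rw [this, map_zero, add_zero]
    exact hβ
  rw [map_add, hd, zero_add, Finsupp.linearCombination_apply, Finsupp.sum, map_sum] at hdφ
  by_contra hf0
  -- A nonzero combination of low cells is not a cocycle: the mate of a low cell with smallest `Ψ`
  -- occurs only in the differential of that cell.
  obtain ⟨a₀, ha₀, hmin⟩ := f.support.exists_min_image Ψ (Finsupp.support_nonempty_iff.2 hf0)
  have hmem : ∀ a ∈ f.support, a ∈ S δ ∧ low a := fun a ha => hf ha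
  have hcoef : ∀ a ∈ f.support, coef (mate a₀) (d (e a)) = if a = a₀ then 1 else 0 := by
    intro a ha
    obtain ⟨hS, hlo⟩ := hmem a ha
    obtain ⟨hS₀, hlo₀⟩ := hmem a₀ ha₀
    obtain ⟨-, hm₀, hΨ₀, -⟩ := hlow _ a₀ hS₀ hlo₀
    obtain ⟨-, -, -, hr⟩ := hlow _ a hS hlo
    have hr0 : coef (mate a₀) (d (e a) - e (mate a)) = 0 := by
      rw [← LinearMap.mem_ker]
      refine Submodule.span_le.2 ?_ hr
      rintro _ ⟨b, ⟨-, hb⟩, rfl⟩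
      refine hne _ _ ?_
      rintro rfl
      rcases hb with hb | hb
      · exact hm₀ hb
      · rw [hΨ₀] at hb
        exact absurd hb (not_lt.2 (hmin a ha))
    rw [map_sub, sub_eq_zero] at hr0
    rw [hr0]
    split_ifs with h
    · rw [h, hself]
    · exact hne _ _ fun h' => h (hinj _ _ hlo hlo₀ h'.symm)
  have h0 := congrArg (coef (mate a₀)) hdφ
  rw [map_zero, map_sum, Finset.sum_eq_single a₀] at h0
  · rw [map_smul, map_smul, hcoef a₀ ha₀, if_pos rfl, smul_eq_mul, mul_one] at h0
    exact Finsupp.mem_support_iff.1 ha₀ h0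
  · intro a ha hne'
    rw [map_smul, map_smul, hcoef a ha, if_neg hne', smul_zero]
  · exact fun h => absurd ha₀ h

/-! ### The Morse matching on positive pairs. -/

namespace MarkedGrid

variable {V : Type} {m : ℕ}

/-- The matching `x` with its points on the two sides of column `j` exchanged. -/
def flip (x : Gen m) (j : Fin m) : Gen m := x * Equiv.swap j (finRotate m j)

theorem flip_flip (x : Gen m) (j : Fin m) : flip (flip x j) j = x := by
  simp [flip, mul_assoc]

theorem flip_left (x : Gen m) (j : Fin m) : flip x j j = x (finRotate m j) := by
  rw [flip, Equiv.Perm.mul_apply, Equiv.swap_apply_left]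

theorem flip_right (x : Gen m) (j : Fin m) : flip x j (finRotate m j) = x j := by
  rw [flip, Equiv.Perm.mul_apply, Equiv.swap_apply_right]

theorem flip_of_ne {H : MarkedGrid V m} (hH : H.IsSparse) (x : Gen m) {i j : Fin m} (hi : i ∈ H.Z)
    (hj : j ∈ H.Z) (hij : i ≠ j) :
    flip x j i = x i ∧ flip x j (finRotate m i) = x (finRotate m i) := by
  rw [flip, Equiv.Perm.mul_apply, Equiv.Perm.mul_apply,
    Equiv.swap_apply_of_ne_of_ne hij (hH j hj i hi).1,
    Equiv.swap_apply_of_ne_of_ne (hH i hi j hj).1.symm ((finRotate m).injective.ne hij)]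
  exact ⟨rfl, rfl⟩

/-- The marked columns whose destabilization point is at the same height as no point of `x` on
either side of the column. -/
def flippable (H : MarkedGrid V m) (x : Gen m) : Finset (Fin m) :=
  {j ∈ H.Z | x j ≠ H.O j ∧ x (finRotate m j) ≠ H.O j}

theorem mem_flippable {H : MarkedGrid V m} {x : Gen m} {j : Fin m} :
    j ∈ H.flippable x ↔ j ∈ H.Z ∧ x j ≠ H.O j ∧ x (finRotate m j) ≠ H.O j := by
  simp only [flippable, Finset.mem_filter]

theorem flippable_flip {H : MarkedGrid V m} (hH : H.IsSparse) (x : Gen m) {j : Fin m}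
    (hj : j ∈ H.Z) : H.flippable (flip x j) = H.flippable x := by
  ext i
  rw [mem_flippable, mem_flippable]
  refine and_congr_right fun hi => ?_
  by_cases hij : i = j
  · rw [hij, flip_left, flip_right, and_comm]
  · rw [(flip_of_ne hH x hi hj hij).1, (flip_of_ne hH x hi hj hij).2]

/-- The matchings with a flippable column that are the sources of the Morse matching. -/
def IsLow (H : MarkedGrid V m) (x : Gen m) : Prop :=
  ∃ i, IsLeast (H.flippable x : Set (Fin m)) i ∧ H.O i ∈ cyclicIco (x i) (x (finRotate m i))

/-- The matching `x` with its first flippable column flipped. -/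
noncomputable def mate (H : MarkedGrid V m) (x : Gen m) : Gen m :=
  if h : (H.flippable x).Nonempty then flip x ((H.flippable x).min' h) else x

section Mate

variable {H : MarkedGrid V m} {x : Gen m} {i : Fin m}

theorem mate_eq (h : IsLeast (H.flippable x : Set (Fin m)) i) : H.mate x = flip x i := by
  have hne : (H.flippable x).Nonempty := ⟨i, h.1⟩
  rw [mate, dif_pos hne, ((H.flippable x).isLeast_min' hne).unique h]

theorem isLow_iff (h : IsLeast (H.flippable x : Set (Fin m)) i) :
    H.IsLow x ↔ H.O i ∈ cyclicIco (x i) (x (finRotate m i)) :=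
  ⟨fun ⟨_, hk, hk'⟩ => hk.unique h ▸ hk', fun h' => ⟨i, h, h'⟩⟩

theorem isLow_flip (hH : H.IsSparse) (h : IsLeast (H.flippable x : Set (Fin m)) i) :
    H.IsLow (flip x i) ↔ ¬ H.IsLow x := by
  have hi := (mem_flippable.1 h.1).1
  rw [isLow_iff h, isLow_iff (x := flip x i) (by rwa [flippable_flip hH x hi]), flip_left,
    flip_right, mem_cyclicIco_compl (x.injective.ne (hH.finRotate_ne hi).symm)]

theorem mate_flip (hH : H.IsSparse) (h : IsLeast (H.flippable x : Set (Fin m)) i) :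
    H.mate (flip x i) = x := by
  rw [mate_eq (x := flip x i) (by rwa [flippable_flip hH x (mem_flippable.1 h.1).1]), flip_flip]

theorem mem_cyclicIco_finRotate {a c : Fin m} (h : finRotate m a ≠ a) :
    c ∈ cyclicIco a (finRotate m a) ↔ c = a := by
  rw [← ind_eq_one_iff, ind_finRotate h]
  simp

theorem mem_emptyRects_thin (hi : finRotate m i ≠ i) (x : Gen m) :
    (i, finRotate m i) ∈ emptyRects x := by
  simp only [emptyRects, Finset.mem_filter, Finset.mem_univ, true_and]
  refine ⟨hi.symm, fun c hc => ?_⟩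
  rw [mem_cyclicIoo, mem_cyclicIco_finRotate hi] at hc
  exact absurd hc.2 hc.1

theorem rectO_thin (hi : finRotate m i ≠ i)
    (h : H.O i ∉ cyclicIco (x i) (x (finRotate m i))) : H.rectO x (i, finRotate m i) = ∅ := by
  ext c
  simp only [rectO, Finset.mem_filter, Finset.mem_univ, true_and, Finset.notMem_empty, iff_false,
    not_and]
  intro hc
  rwa [(mem_cyclicIco_finRotate hi).1 hc]

/-- The thin rectangle lies in a marked column, whose `O` is not affected by exchanging `O`'s of
unmarked columns. -/
theorem areaGrading_flip (hH : H.IsSparse) (hi : i ∈ H.Z)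
    (h : H.O i ∉ cyclicIco (x i) (x (finRotate m i))) :
    H.areaGrading (flip x i) = H.areaGrading x := by
  have hrot := hH.finRotate_ne hi
  have := areaGrading_rect (mem_emptyRects_thin hrot x) (rectO_thin hrot h)
  rw [Finset.sum_eq_zero] at this
  · rw [flip]; linarith
  intro c hc
  refine Finset.sum_eq_zero fun c' hc' => ?_
  rw [Finset.mem_compl] at hc hc'
  rw [rectO_thin hrot, Finset.card_empty, Nat.cast_zero, mul_zero]
  rwa [swapO, Equiv.Perm.mul_apply,
    Equiv.swap_apply_of_ne_of_ne (fun e : i = c => hc (e ▸ hi)) (fun e : i = c' => hc' (e ▸ hi))]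

theorem rowGrading_flip (hH : H.IsSparse) (hi : i ∈ H.flippable x) :
    H.rowGrading (flip x i) = H.rowGrading x := by
  rw [mem_flippable] at hi
  refine Finset.sum_congr rfl fun j hj => ?_
  rw [flip, mul_swap_symm_apply]
  refine columnDist_swap hi.1 (hH.finRotate_ne hi.1) _ ?_
  by_cases hij : j = i
  · refine Or.inr ?_
    rw [ne_eq, Equiv.symm_apply_eq, ne_eq, Equiv.symm_apply_eq, hij]
    exact ⟨hi.2.1.symm, hi.2.2.symm⟩
  · exact Or.inl hij

end Mate

/-- The pairs `[x, U^N (y, ε)]`. -/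
abbrev Cell (H : MarkedGrid V m) : Type := Gen m × (V →₀ ℕ) × H.EGen

/-- The positive pairs of a given index. -/
def positiveCells (H : MarkedGrid V m) (δ : ℤ) : Set H.Cell :=
  {a | H.IsPositivePair a.1 a.2.1 a.2.2 ∧ H.index a.1 a.2.1 a.2.2 = δ}

/-- The homomorphism that belongs to a pair. -/
noncomputable def cellHom (H : MarkedGrid V m) (a : H.Cell) : H.HomCx := H.pair a.1 a.2.1 a.2.2

/-- The coefficient of a homomorphism at a pair. -/
noncomputable def cellCoeff (H : MarkedGrid V m) (a : H.Cell) : H.HomCx →ₗ[ZMod 2] ZMod 2 where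
  toFun φ := MvPowerSeries.coeff a.2.1 (φ a.2.2 a.1)
  map_add' _ _ := by rw [Matrix.add_apply, map_add]
  map_smul' _ _ := by rw [Matrix.smul_apply, map_smul]; rfl

open Classical in
theorem cellCoeff_cellHom (H : MarkedGrid V m) (a b : H.Cell) :
    H.cellCoeff a (H.cellHom b) = if a = b then 1 else 0 := by
  obtain ⟨x, N, y⟩ := a
  obtain ⟨x', N', y'⟩ := b
  change MvPowerSeries.coeff N (H.pair x' N' y' y x) = _
  rw [pair_apply]
  by_cases h : y' = y ∧ x' = x
  · rw [if_pos h, MvPowerSeries.coeff_monomial, h.1, h.2]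
    simp
  · rw [if_neg h, map_zero, if_neg]
    rintro ⟨⟩
    exact h ⟨rfl, rfl⟩

theorem CP_eq_span (H : MarkedGrid V m) (δ : ℤ) :
    H.CP δ = Submodule.span (ZMod 2) (H.cellHom '' H.positiveCells δ) := by
  rw [CP]
  congr 1
  ext φ
  constructor
  · rintro ⟨x, N, y, h1, h2, rfl⟩
    exact ⟨(x, N, y), ⟨h1, h2⟩, rfl⟩
  · rintro ⟨⟨x, N, y⟩, ⟨h1, h2⟩, rfl⟩
    exact ⟨x, N, y, h1, h2, rfl⟩

/-- The monovariant of the Morse matching. -/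
noncomputable def monovariant (H : MarkedGrid V m) (a : H.Cell) : ℤ ×ₗ ℤ ×ₗ ℤ :=
  -- The first entry depends only on `U^N (y, ε)`; a rectangle at the front raises it by twice its
  -- number of `O`'s.
  toLex (H.index a.1 a.2.1 a.2.2 - H.maslov a.1, toLex (H.areaGrading a.1, - H.rowGrading a.1))

theorem monovariant_lt {H : MarkedGrid V m} {a b : H.Cell} : H.monovariant a < H.monovariant b ↔
    H.index a.1 a.2.1 a.2.2 - H.maslov a.1 < H.index b.1 b.2.1 b.2.2 - H.maslov b.1 ∨
    H.index a.1 a.2.1 a.2.2 - H.maslov a.1 = H.index b.1 b.2.1 b.2.2 - H.maslov b.1 ∧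
      (H.areaGrading a.1 < H.areaGrading b.1 ∨ H.areaGrading a.1 = H.areaGrading b.1 ∧
        H.rowGrading b.1 < H.rowGrading a.1) := by
  rw [monovariant, monovariant, Prod.Lex.toLex_lt_toLex, Prod.Lex.toLex_lt_toLex, neg_lt_neg_iff]

theorem maslov_rect_empty (H : MarkedGrid V m) {x : Gen m} {p : Fin m × Fin m}
    (hp : p ∈ emptyRects x) :
    H.maslov x - H.maslov (x * Equiv.swap p.1 p.2) = 1 - 2 * ((H.rectO x p).card : ℤ) := by
  simp only [emptyRects, Finset.mem_filter, Finset.mem_univ, true_and] at hp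
  simpa using H.maslov_rect hp.1 ∅ (by simp) (by simp) (fun c hc _ => hp.2 c hc) (by simp)

section Matching

variable {H : MarkedGrid V m}

/-- Arrows from a source of the Morse matching, other than the matched one, given by a rectangle
at the beginning of the pair. -/
theorem isLow_or_monovariant_lt (hH : H.IsSparse) {x : Gen m} {N : V →₀ ℕ} {y : H.EGen} {i : Fin m}
    (hi : IsLeast (H.flippable x : Set (Fin m)) i) (hlow : H.IsLow x) {x' : Gen m}
    {p : Fin m × Fin m} (hx : x' * Equiv.swap p.1 p.2 = x) (hp : p ∈ emptyRects x')
    (hne : p ≠ (i, finRotate m i)) :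
    H.IsLow x' ∨
      H.monovariant (x, N, y) < H.monovariant (x', N + H.expo (H.rectO x' p), y) := by
  have h1 := H.index_prepend N y hp hx
  have h2 := H.maslov_rect_empty hp
  rw [hx] at h2
  rw [monovariant_lt]
  simp only
  rcases Finset.eq_empty_or_nonempty (H.rectO x' p) with h0 | h0
  · rw [h0, Finset.card_empty] at h2
    rw [h1]
    rcases grading_trichotomy hH hp h0 with h | h | ⟨-, -, j, hj, rfl, -⟩
    · rw [hx] at h
      exact Or.inr (Or.inr ⟨by push_cast at h2; linarith, Or.inl h⟩)
    · rw [hx] at h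
      exact Or.inr (Or.inr ⟨by push_cast at h2; linarith, Or.inr h⟩)
    -- The rectangle flips a flippable column other than the first, which leaves the first one and
    -- the points on its sides unchanged.
    · left
      have hij : i ≠ j := by rintro rfl; exact hne rfl
      have hx' : x' = flip x j := by rw [← hx]; exact (flip_flip x' j).symm
      have hiZ := (mem_flippable.1 hi.1).1
      rw [hx', isLow_iff (i := i) (by rwa [flippable_flip hH x hj]), (flip_of_ne hH x hiZ hj hij).1,
        (flip_of_ne hH x hiZ hj hij).2]
      exact (isLow_iff hi).1 hlow
  · have := Finset.card_pos.2 h0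
    right; left
    rw [h1]
    have : (1 : ℤ) ≤ (H.rectO x' p).card := by exact_mod_cast this
    linarith

/-- Terms that change `U^N (y, ε)` raise the index with `x` fixed, hence the monovariant. Rectangles
at the front are handled by `isLow_or_monovariant_lt`. -/
theorem mate_matching (hH : H.IsSparse) {δ : ℤ} {x : Gen m} {N : V →₀ ℕ} {y : H.EGen}
    (ha : (x, N, y) ∈ H.positiveCells δ) (hlow : H.IsLow x) :
    (H.mate x, N, y) ∈ H.positiveCells (δ + 1) ∧ ¬ H.IsLow (H.mate x) ∧
      H.monovariant (H.mate x, N, y) = H.monovariant (x, N, y) ∧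
      H.homD (H.cellHom (x, N, y)) - H.cellHom (H.mate x, N, y) ∈
        Submodule.span (ZMod 2) (H.cellHom '' {b | b ∈ H.positiveCells (δ + 1) ∧
          (H.IsLow b.1 ∨ H.monovariant (x, N, y) < H.monovariant b)}) := by
  obtain ⟨hpos, hind⟩ := ha
  simp only at hpos hind
  obtain ⟨i, hi, hOi⟩ := id hlow
  have hiZ := (mem_flippable.1 hi.1).1
  have hrot := hH.finRotate_ne hiZ
  rw [mate_eq hi]
  have hO' : H.O i ∉ cyclicIco (flip x i i) (flip x i (finRotate m i)) := by
    rw [flip_left, flip_right, mem_cyclicIco_compl (x.injective.ne hrot.symm), not_not]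
    exact hOi
  have hrect := rectO_thin hrot hO'
  have hemp := mem_emptyRects_thin hrot (flip x i)
  have hend : flip x i * Equiv.swap (i, finRotate m i).1 (i, finRotate m i).2 = x := flip_flip x i
  have hindex := H.index_prepend N y hemp hend
  have hexpo : N + H.expo (H.rectO (flip x i) (i, finRotate m i)) = N := by
    rw [hrect, expo, Finset.sum_empty, add_zero]
  rw [hexpo] at hindex
  have hmas := H.maslov_rect_empty hemp
  rw [hend, hrect, Finset.card_empty] at hmas
  refine ⟨⟨hpos.flip hH hiZ (mem_flippable.1 hi.1).2.2, by simp only; rw [hindex, hind]⟩,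
    fun h => (isLow_flip hH hi).1 h hlow, ?_, ?_⟩
  · have harea : H.areaGrading x = H.areaGrading (flip x i) := by
      rw [← areaGrading_flip hH hiZ hO', flip_flip]
    rw [monovariant, monovariant, hindex, harea, rowGrading_flip hH hi.1]
    congr 2
    simp only [Nat.cast_zero] at hmas ⊢
    linarith
  · have hup : ∀ {N' : V →₀ ℕ} {y' : H.EGen}, H.index x N' y' = H.index x N y + 1 →
        H.monovariant (x, N, y) < H.monovariant (x, N', y') := by
      intro N' y' h
      rw [monovariant_lt]
      left
      simp only
      linarith
    have hadd : ∀ {N' : V →₀ ℕ} {y' : H.EGen}, H.IsPositivePair x N' y' →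
        H.index x N' y' = H.index x N y + 1 → H.pair x N' y' ∈
        Submodule.span (ZMod 2) (H.cellHom '' {b | b ∈ H.positiveCells (δ + 1) ∧
          (H.IsLow b.1 ∨ H.monovariant (x, N, y) < H.monovariant b)}) := fun {N' y'} h1 h2 =>
      Submodule.subset_span ⟨(x, N', y'), ⟨⟨h1, h2.trans (by rw [hind])⟩, Or.inr (hup h2)⟩, rfl⟩
    have hmem : (i, finRotate m i) ∈ Finset.univ.filter fun p : Fin m × Fin m =>
        p ∈ emptyRects (x * Equiv.swap p.1 p.2) := by
      rw [Finset.mem_filter]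
      exact ⟨Finset.mem_univ _, hemp⟩
    rw [cellHom, homD_pair, ← Finset.add_sum_erase _ _ hmem]
    have hterm : H.pair (x * Equiv.swap (i, finRotate m i).1 (i, finRotate m i).2)
        (N + H.expo (H.rectO (x * Equiv.swap (i, finRotate m i).1 (i, finRotate m i).2)
          (i, finRotate m i))) y = H.cellHom (flip x i, N, y) := by
      change H.pair (flip x i) (N + H.expo (H.rectO (flip x i) (i, finRotate m i))) y = _
      rw [hexpo]
      rfl
    rw [hterm, add_assoc, add_sub_cancel_left]
    refine Submodule.add_mem _ (Submodule.sum_mem _ fun p hp => ?_)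
      (Submodule.add_mem _ (Submodule.sum_mem _ fun p _ => ?_) (Submodule.sum_mem _ fun j _ => ?_))
    · rw [Finset.mem_erase, Finset.mem_filter] at hp
      have hx : x * Equiv.swap p.1 p.2 * Equiv.swap p.1 p.2 = x := by
        rw [mul_assoc, Equiv.swap_mul_self, mul_one]
      refine Submodule.subset_span ⟨(x * Equiv.swap p.1 p.2, _, y),
        ⟨⟨hpos.prepend _ p hx, ?_⟩, isLow_or_monovariant_lt hH hi hlow hx hp.2.2 hp.1⟩, rfl⟩
      exact (H.index_prepend N y hp.2.2 hx).trans (by rw [hind])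
    · exact hadd (hpos.append p.1 _ _) (H.index_append x N y p.2)
    · split_ifs with hj
      · exact Submodule.sub_mem _ (hadd (hpos.cone j hj) (H.index_cone x N y _ hj))
          (hadd (hpos.cone_below hH j hj) (H.index_cone x N y _ hj))
      · exact Submodule.zero_mem _

/-- The cohomology of the complex of positive pairs vanishes in negative degrees. -/
theorem exists_homD_eq (hH : H.IsSparse) {δ : ℤ} (hδ : δ < 0) {φ : H.HomCx} (hφ : φ ∈ H.CP δ)
    (hd : H.homD φ = 0) : φ ∈ (H.CP (δ - 1)).map H.homD := by
  classical
  rw [CP_eq_span] at hφ ⊢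
  refine exists_preimage_of_matching H.positiveCells H.cellHom H.cellCoeff
    (fun a => by rw [cellCoeff_cellHom, if_pos rfl])
    (fun a b hab => by rw [cellCoeff_cellHom, if_neg hab]) H.homD H.homD_homD
    (fun a => H.IsLow a.1) (fun a => (H.mate a.1, a.2)) H.monovariant
    (fun δ a ha hlow => mate_matching hH ha hlow) ?_ δ ?_ ?_ φ hφ hd
  · rintro ⟨x, a⟩ ⟨x', a'⟩ ⟨i, hi, -⟩ ⟨i', hi', -⟩ h
    rw [Prod.mk.injEq] at h ⊢
    refine ⟨?_, h.2⟩
    have h1 := h.1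
    simp only at h1 hi hi'
    rw [mate_eq hi, mate_eq hi'] at h1
    have h2 := mate_flip hH hi
    rwa [h1, mate_flip hH hi', eq_comm] at h2
  · rintro ⟨x, N, y⟩ ⟨hpos, hind⟩ hlow
    simp only at hpos hind hlow
    -- Without a flippable column the pair would be critical and its index nonnegative.
    have hne : (H.flippable x).Nonempty := by
      by_contra h
      rw [Finset.not_nonempty_iff_eq_empty] at h
      refine absurd (hpos.index_nonneg hH fun j hj => ?_) (by rw [hind]; exact not_le.2 hδ)
      by_contra h'
      rw [not_or] at h'
      exact Finset.notMem_empty j (h ▸ mem_flippable.2 ⟨hj, h'⟩)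
    have hi := (H.flippable x).isLeast_min' hne
    set i := (H.flippable x).min' hne
    have hiZ := (mem_flippable.1 hi.1).1
    have hpos' : H.IsPositivePair (flip x i) N y := hpos.flip hH hiZ (mem_flippable.1 hi.1).2.2
    have hlow' := (isLow_flip hH hi).2 hlow
    refine ⟨(flip x i, N, y), ⟨hpos', ?_⟩, hlow', ?_⟩
    · have h : H.index (H.mate (flip x i)) N y = H.index (flip x i) N y + 1 :=
        (mate_matching hH (N := N) (y := y) ⟨hpos', rfl⟩ hlow').1.2
      rw [mate_flip hH hi, hind] at h
      simp only
      linarith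
    · simp only [mate_flip hH hi]
  -- For a fixed index the monovariant depends only on `x`, although there is no bound on `N` at
  -- hand.
  · refine (Set.finite_range fun x : Gen m => (toLex (δ - H.maslov x,
      toLex (H.areaGrading x, - H.rowGrading x)) : ℤ ×ₗ ℤ ×ₗ ℤ)).subset ?_
    rintro _ ⟨a, ha, rfl⟩
    exact ⟨a.1, by rw [monovariant, ha.2]⟩

end Matching

end MarkedGrid

/-! ### Sparsity of the destabilized grids, and the conclusion. -/

/-- Renumbering the elements of a subset preserves cyclic successors that lie in the subset. -/
theorem orderIsoOfFin_finRotate {n m : ℕ} (S : Finset (Fin n)) (h : S.card = m) (c : Fin m)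
    (hc : finRotate n (S.orderIsoOfFin h c) ∈ S) :
    (S.orderIsoOfFin h (finRotate m c) : Fin n) = finRotate n (S.orderIsoOfFin h c) := by
  set f := S.orderIsoOfFin h with hf
  obtain ⟨d, hd⟩ := f.surjective ⟨_, hc⟩
  have hd' : (f d : Fin n) = finRotate n (f c) := congrArg Subtype.val hd
  have hmono : ∀ a b : Fin m, a < b → (f a : Fin n) < f b := fun a b hab => f.strictMono hab
  have hv := MarkedGrid.val_finRotate (f c : Fin n)
  have hv' := MarkedGrid.val_finRotate c
  rw [← hd'] at hv ⊢
  suffices finRotate m c = d by rw [this]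
  -- An element cyclically between `c` and `d` would be sent by the increasing map `f` between an
  -- element of `Fin n` and its successor.
  have key : ∀ e : Fin m, ¬ (e < d ∧ (c < e ∨ d ≤ c)) ∧ ¬ (c < e ∧ d ≤ c) := by
    intro e
    constructor
    · rintro ⟨h1, h2⟩
      have h3 := hmono e d h1
      rcases h2 with h2 | h2
      · have h4 := hmono c e h2
        simp only [Fin.lt_def] at h3 h4
        split_ifs at hv <;> omega
      · have h4 : (f d : Fin n) ≤ f c := f.monotone h2
        simp only [Fin.lt_def, Fin.le_def] at h3 h4
        split_ifs at hv <;> omega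
    · rintro ⟨h1, h2⟩
      have h3 := hmono c e h1
      have h4 : (f d : Fin n) ≤ f c := f.monotone h2
      have h5 := (f e : Fin n).isLt
      simp only [Fin.lt_def, Fin.le_def] at h3 h4
      split_ifs at hv <;> omega
  have h1 := key (finRotate m c)
  have h2 := key d
  have h3 := d.isLt
  have h4 := c.isLt
  simp only [Fin.lt_def, Fin.le_def] at h1 h2
  refine Fin.ext ?_
  split_ifs at hv' <;> omega

namespace GridDiagram

variable {n : ℕ} {G : GridDiagram n}

theorem mem_cols_isSome {W : Finset G.LinkedMarking} {c : Fin n} (h : c ∈ G.cols W) :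
    G.X c ≠ none := by
  obtain ⟨Z, -, rfl⟩ := Finset.mem_image.1 h
  exact Option.isSome_iff_ne_none.1 Z.1.2

theorem exists_X_eq_activeRow (s : G.Component → MarkKind) {c : Fin n} (h : G.X c ≠ none) :
    ∃ c', G.X c' = some (G.activeRow s c) := by
  have h' : (G.X c).isSome := Option.isSome_iff_ne_none.2 h
  cases hs : s (G.comp ⟨c, h'⟩) with
  | X => exact ⟨c, by simpa [activeRow, h', hs] using G.X_eq_some_xRow ⟨c, h'⟩⟩
  | O =>
    have := mt (G.free_iff c).2 h
    push Not at this
    obtain ⟨c', hc'⟩ := this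
    exact ⟨c', by simpa [activeRow, h', hs] using hc'⟩

/-- The column after a linked column of `G` is free, hence never deleted, so it remains the
successor after renumbering. The same holds for rows: a row without `X` has its active marking in a
free column. -/
theorem destab_isSparse (hG : G.IsSparse) (s : G.Component → MarkKind)
    (Z₀ Z : Finset G.LinkedMarking) : (G.destab s Z₀ Z).IsSparse := by
  set S := G.keptCols Z₀ with hS
  set S' := S.map (G.active s).toEmbedding with hS'
  set f := S.orderIsoOfFin rfl with hf
  set g := S'.orderIsoOfFin (Finset.card_map _) with hg
  have hZ : ∀ j, j ∈ (G.destab s Z₀ Z).Z ↔ (f j : Fin n) ∈ G.cols Z := fun j =>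
    Finset.mem_filter.trans ⟨And.right, fun h => ⟨Finset.mem_univ _, h⟩⟩
  have hO : ∀ j, (g ((G.destab s Z₀ Z).O j) : Fin n) = G.activeRow s (f j) := fun j => by
    change (g (g.symm _) : Fin n) = _
    rw [OrderIso.apply_symm_apply]
    rfl
  have hfree : ∀ c, G.X c = none → c ∈ S := fun c hc => by
    rw [hS, keptCols, Finset.mem_compl]
    exact fun h => mem_cols_isSome h hc
  intro j hj j' hj'
  have hjX := mem_cols_isSome ((hZ j).1 hj)
  have hjX' := mem_cols_isSome ((hZ j').1 hj')
  constructor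
  · rintro rfl
    have h1 := not_not.1 (hG.2 _ hjX)
    rw [orderIsoOfFin_finRotate S rfl j (hfree _ h1)] at hjX'
    exact hjX' h1
  · intro h
    have h1 := hG.1 _ (exists_X_eq_activeRow s hjX)
    rw [← hO] at h1
    have h2 : finRotate n (g ((G.destab s Z₀ Z).O j)) ∈ S' := by
      obtain ⟨c, hc⟩ := (G.active s).surjective (finRotate n (g ((G.destab s Z₀ Z).O j)))
      rw [← hc] at h1 ⊢
      refine Finset.mem_map_of_mem _ (hfree c ?_)
      by_contra hcX
      exact h1 (exists_X_eq_activeRow s hcX)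
    have h3 := orderIsoOfFin_finRotate S' (Finset.card_map _) _ h2
    rw [← h] at h3
    refine h1 ?_
    rw [← h3]
    have := exists_X_eq_activeRow s hjX'
    rwa [← hO] at this

end GridDiagram

theorem theorem3p4 {n : ℕ} (G : GridDiagram n) (hG : G.IsSparse) (k : ℕ)
    (s : ∀ i : G.ExtIndex k, G.JInf (i.Z₀ ∪ i.Z)) (d : ℤ) (hd : d < min 0 (2 - (k : ℤ))) :
    Subsingleton (G.HE k s d) := by
  rw [GridDiagram.HE, Submodule.Quotient.subsingleton_iff, Submodule.submoduleOf,
    Submodule.comap_subtype_eq_top]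
  rintro φ ⟨hφ, hdφ⟩
  -- Degrees and differential are componentwise, so primitives can be chosen in each summand
  -- separately.
  have h : ∀ i, ∃ ψ ∈ (G.summandGrid k s i).CP (d - 1), (G.summandGrid k s i).homD ψ = φ i :=
    fun i => MarkedGrid.exists_homD_eq (GridDiagram.destab_isSparse hG _ _ _)
      (hd.trans_le (min_le_left _ _)) (hφ i (Set.mem_univ i)) (congrFun (LinearMap.mem_ker.1 hdφ) i)
  choose ψ hψ hψφ using h
  exact ⟨ψ, fun i _ => hψ i, funext hψφ⟩
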